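/- A residuated lattice is an algebra $(A,\wedge,\vee,\cdot,\backslash,/,1)$ such that $(A,\wedge,\vee)$ is a lattice, $(A,\cdot,1)$ is a monoid and $xy\le z \iff y\le x\backslash z \iff x\le z/y$. It is *unilinear* if for all $u_1,u_2,z,w$: $u_1\le u_2$, or $u_2\le u_1$, or ($u_1\wedge u_2\le w$ and $z\le u_1\vee u_2$). Let $\mathsf{SRL}$ be the variety generated by the unilinear residuated lattices. A *knotted identity* is an identity $x^m\le x^n$ with natural numbers $m\ne n$. A *weak commutativity identity* is an identity $$x y_1 x y_2\cdots y_k x = x^{a_0}y_1x^{a_1}y_2\cdots y_kx^{a_k},$$ where $k\ge 1$ and $a_0,\dots,a_k$ are natural numbers (possibly $0$) with $a_0+\dots+a_k=k+1$, not all equal to $1$. A class $\mathcal K$ of residuated lattices has the *finite embeddability property* (FEP) if for every $A\in\mathcal K$ and every finite $B\subseteq A$ there are a finite $C\in\mathcal K$ and an injection $B\to C$ that preserves each of the operations $\wedge,\vee,\cdot,\backslash,/,1$ whenever its arguments and its value (computed in $A$) lie in $B$. **Theorem.** Let $\mathcal V$ be a subvariety of $\mathsf{SRL}$ that is axiomatized,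 relative to $\mathsf{SRL}$, by a knotted identity, a weak commutativity identity and a (possibly empty, possibly infinite) set $E$ of further equations over $\{\vee,\cdot,1\}$. Then $\mathcal V$ has the FEP. If moreover $E$ is finite, then the universal theory of $\mathcal V$ (the set of universal first-order sentences in the language of residuated lattices that are true in all members of $\mathcal V$) is decidable. -/

import Mathlib

universe u

/-- A residuated lattice `(A, ∧, ∨, ·, \, /, 1)`: a lattice and a monoid (not assumed commutative or
bounded) with `x * y ≤ z ↔ y ≤ x \ z ↔ x ≤ z / y`. Here `ldiv x z` is `x \ z` and `rdiv z y` is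
`z / y`. -/
class ResiduatedLattice (A : Type u) extends Lattice A, Monoid A where
  ldiv : A → A → A
  rdiv : A → A → A
  mul_le_iff_le_ldiv : ∀ x y z : A, x * y ≤ z ↔ y ≤ ldiv x z
  mul_le_iff_le_rdiv : ∀ x y z : A, x * y ≤ z ↔ x ≤ rdiv z y

namespace RL

/-- Terms in the language of residuated lattices over the variables `x₀, x₁, …`. -/
inductive Term : Type
  | var : ℕ → Term
  | one : Term
  | mul : Term → Term → Term
  | sup : Term → Term → Term
  | inf : Term → Term → Term
  | ldiv : Term → Term → Term
  | rdiv : Term → Term → Term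

namespace Term

/-- The value of a term in a residuated lattice under an assignment of the variables. -/
def eval {A : Type u} [ResiduatedLattice A] (v : ℕ → A) : Term → A
  | var i => v i
  | one => 1
  | mul s t => eval v s * eval v t
  | sup s t => eval v s ⊔ eval v t
  | inf s t => eval v s ⊓ eval v t
  | ldiv s t => ResiduatedLattice.ldiv (eval v s) (eval v t)
  | rdiv s t => ResiduatedLattice.rdiv (eval v s) (eval v t)

/-- The term contains no operation symbols other than `∨`, `·` and `1`. -/
def IsJoinMonoid : Term → Prop
  | var _ => True
  | one => True
  | mul s t => IsJoinMonoid s ∧ IsJoinMonoid t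
  | sup s t => IsJoinMonoid s ∧ IsJoinMonoid t
  | inf _ _ => False
  | ldiv _ _ => False
  | rdiv _ _ => False

/-- The power `t ^ n`. -/
def pow (t : Term) : ℕ → Term
  | 0 => one
  | n + 1 => mul (pow t n) t

/-- The term `x^(a 0) y₁ x^(a 1) y₂ ⋯ y_k x^(a k)`, where `x` is the variable with index `0` and
`y_i` is the variable with index `i`. -/
def interleave (a : ℕ → ℕ) : ℕ → Term
  | 0 => pow (var 0) (a 0)
  | k + 1 => mul (mul (interleave a k) (var (k + 1))) (pow (var 0) (a (k + 1)))

/-- Gödel numbers of terms. -/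
def code : Term → ℕ
  | var i => Nat.pair 0 i
  | one => Nat.pair 1 0
  | mul s t => Nat.pair 2 (Nat.pair (code s) (code t))
  | sup s t => Nat.pair 3 (Nat.pair (code s) (code t))
  | inf s t => Nat.pair 4 (Nat.pair (code s) (code t))
  | ldiv s t => Nat.pair 5 (Nat.pair (code s) (code t))
  | rdiv s t => Nat.pair 6 (Nat.pair (code s) (code t))

theorem code_injective : Function.Injective code := by
  intro s
  induction s with
  | var i => intro t h; cases t <;> simp_all [code, Nat.pair_eq_pair]
  | one => intro t h; cases t <;> simp_all [code, Nat.pair_eq_pair]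
  | mul _ _ ih₁ ih₂ | sup _ _ ih₁ ih₂ | inf _ _ ih₁ ih₂ | ldiv _ _ ih₁ ih₂ | rdiv _ _ ih₁ ih₂ =>
    intro t h
    cases t <;> simp [code, Nat.pair_eq_pair] at h
    rw [ih₁ h.1, ih₂ h.2]

end Term

/-- An equation `lhs = rhs` between terms. -/
structure Equation : Type where
  lhs : Term
  rhs : Term

namespace Equation

/-- The equation holds in `A` (identically, for all values of the variables). -/
def Holds (e : Equation) (A : Type u) [ResiduatedLattice A] : Prop :=
  ∀ v : ℕ → A, e.lhs.eval v = e.rhs.eval v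

/-- An equation over `{∨, ·, 1}`. -/
def IsJoinMonoid (e : Equation) : Prop :=
  e.lhs.IsJoinMonoid ∧ e.rhs.IsJoinMonoid

/-- The identity `x ^ m ≤ x ^ n`, written as the equation `x ^ m ∨ x ^ n = x ^ n`. -/
def knotted (m n : ℕ) : Equation :=
  ⟨Term.sup (Term.pow (Term.var 0) m) (Term.pow (Term.var 0) n), Term.pow (Term.var 0) n⟩

/-- The identity `x y₁ x y₂ ⋯ y_k x = x^(a 0) y₁ x^(a 1) y₂ ⋯ y_k x^(a k)`. -/
def weakComm (k : ℕ) (a : ℕ → ℕ) : Equation :=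
  ⟨Term.interleave (fun _ => 1) k, Term.interleave a k⟩

end Equation

/-- A residuated lattice is unilinear if for all `u₁, u₂, z, w`: `u₁ ≤ u₂`, or `u₂ ≤ u₁`, or both
`u₁ ∧ u₂ ≤ w` and `z ≤ u₁ ∨ u₂`. -/
def IsUnilinear (A : Type u) [ResiduatedLattice A] : Prop :=
  ∀ u₁ u₂ z w : A, u₁ ≤ u₂ ∨ u₂ ≤ u₁ ∨ (u₁ ⊓ u₂ ≤ w ∧ z ≤ u₁ ⊔ u₂)

/-- A class of residuated lattices. -/
abbrev AlgClass : Type (u + 1) := ∀ (A : Type u) [ResiduatedLattice A], Prop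

/-- The variety generated by a class `K`, that is, the least equational class containing `K`:
the models of all equations that hold in every member of `K`. -/
def generatedVariety (K : AlgClass.{u}) : AlgClass.{u} := fun A _ =>
  ∀ e : Equation, (∀ (R : Type u) [ResiduatedLattice R], K R → e.Holds R) → e.Holds A

/-- The variety of semiunilinear residuated lattices, generated by the unilinear ones. -/
def SRL : AlgClass.{u} :=
  generatedVariety (fun A _ => IsUnilinear A)

/-- The subvariety of `SRL` that is axiomatized, relative to `SRL`, by the equations in `E`. -/
def subvarietySRL (E : Set Equation) : AlgClass.{u} := fun A _ =>
  SRL A ∧ ∀ e ∈ E, e.Holds A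

/-- `h` restricted to `B` is an embedding into `C` of the partial subalgebra of `A` induced by
`B`: it is injective on `B` and it preserves each operation of `A` whenever the arguments and the
value lie in `B`. Values of `h` outside `B` are irrelevant. -/
structure IsPartialEmbedding {A C : Type u} [ResiduatedLattice A] [ResiduatedLattice C]
    (B : Set A) (h : A → C) : Prop where
  injOn : Set.InjOn h B
  map_one : (1 : A) ∈ B → h 1 = 1
  map_mul : ∀ x ∈ B, ∀ y ∈ B, x * y ∈ B → h (x * y) = h x * h y
  map_sup : ∀ x ∈ B, ∀ y ∈ B, x ⊔ y ∈ B → h (x ⊔ y) = h x ⊔ h y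
  map_inf : ∀ x ∈ B, ∀ y ∈ B, x ⊓ y ∈ B → h (x ⊓ y) = h x ⊓ h y
  map_ldiv : ∀ x ∈ B, ∀ y ∈ B, ResiduatedLattice.ldiv x y ∈ B →
    h (ResiduatedLattice.ldiv x y) = ResiduatedLattice.ldiv (h x) (h y)
  map_rdiv : ∀ x ∈ B, ∀ y ∈ B, ResiduatedLattice.rdiv x y ∈ B →
    h (ResiduatedLattice.rdiv x y) = ResiduatedLattice.rdiv (h x) (h y)

/-- The finite embeddability property of a class of residuated lattices. -/
def HasFEP (K : AlgClass.{u}) : Prop :=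
  ∀ (A : Type u) [ResiduatedLattice A], K A → ∀ B : Set A, B.Finite →
    ∃ (C : Type u) (_ : ResiduatedLattice C), Finite C ∧ K C ∧
      ∃ h : A → C, IsPartialEmbedding B h

/-- Quantifier-free formulas in the language of residuated lattices. Falsum and implication
define all the other connectives. A universal sentence is the universal closure of such a
formula. -/
inductive QFFormula : Type
  | falsum : QFFormula
  | equal : Term → Term → QFFormula
  | imp : QFFormula → QFFormula → QFFormula

namespace QFFormula

/-- Truth of a formula in `A` under an assignment of the variables. -/
def Realize {A : Type u} [ResiduatedLattice A] (v : ℕ → A) : QFFormula → Prop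
  | falsum => False
  | equal s t => s.eval v = t.eval v
  | imp p q => Realize v p → Realize v q

/-- The universal closure of the formula belongs to the universal theory of `K`. -/
def ValidIn (K : AlgClass.{u}) (p : QFFormula) : Prop :=
  ∀ (A : Type u) [ResiduatedLattice A], K A → ∀ v : ℕ → A, p.Realize v

/-- Gödel numbers of formulas. -/
def code : QFFormula → ℕ
  | falsum => Nat.pair 0 0
  | equal s t => Nat.pair 1 (Nat.pair s.code t.code)
  | imp p q => Nat.pair 2 (Nat.pair (code p) (code q))

theorem code_injective : Function.Injective code := by
  intro p
  induction p with
  | falsum => intro q h; cases q <;> simp_all [code, Nat.pair_eq_pair]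
  | equal s t =>
    intro q h
    cases q <;> simp [code, Nat.pair_eq_pair] at h
    rw [Term.code_injective h.1, Term.code_injective h.2]
  | imp _ _ ih₁ ih₂ =>
    intro q h
    cases q <;> simp [code, Nat.pair_eq_pair] at h
    rw [ih₁ h.1, ih₂ h.2]

end QFFormula

/-- The universal theory of `K` is decidable: the set of Gödel numbers of the universal sentences
that are true in all members of `K` is a computable set of natural numbers. -/
def HasDecidableUniversalTheory (K : AlgClass.{u}) : Prop :=
  ComputablePred (fun c : ℕ => ∃ p : QFFormula, p.code = c ∧ p.ValidIn K)

end RL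

universe w

/-!
# Finite embeddability and decidability for semiunilinear residuated lattices

The variety is reduced to its unilinear members. In a semiunilinear residuated lattice a normal
filter that is maximal among those that avoid a given element has a unilinear quotient: the
equations saying that joins of iterated conjugates of the negative parts of `x \ y`, `y \ x` and
`((x ∧ y) \ t) ∧ (z \ (x ∨ y))` are equal to `1` hold in all unilinear residuated lattices, where
one of the three elements lies above `1`, hence in the whole variety. So distinct elements are
separated by homomorphisms onto unilinear algebras (`SRL.exists_unilinear_quotient`), and a finite
product of finite algebras obtained from such quotients proves the finite embeddability property
(`hasFEP_of_unilinear`).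

A unilinear algebra `A` is embedded as a `{∨, ·, 1}`-algebra into an idempotent semiring `S`, by
adjoining a zero if `A` has no least element (`exists_zeroExtension`). For a finite `B ⊆ A` the
subsemiring generated by `B` is divided by the congruence that identifies `x` and `y` if
`u x v ≤ b ↔ u y v ≤ b` for all `u`, `v` and all `b ∈ B`. This quotient satisfies the same
equations over `{∨, ·, 1}`, it is again unilinear, and `B` embeds into it. It is finite
(`finite_image_contexts`): weak commutativity rewrites each product of generators as a product of a
bounded number of powers of generators, and the knotted inequality makes the value of such a product
monotone, or antitone, in the quotients of the exponents by `|m - n|`. The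
codes of the products are thus well-quasi-ordered, so there are only finitely many sets of contexts.
A finite idempotent semiring is a residuated lattice.

Decidability follows from the theorem of Post. The invalid formulas are recursively enumerable,
since an invalid formula fails in a product of finite algebras, whose operation tables can be
listed (`exists_isCountertable`). The valid formulas are recursively enumerable by compactness: a
countermodel is a family of equivalence relations on the terms that satisfies the universal axioms
of unilinear residuated lattices, and if there is none then this shows up on finitely many pairs of
terms (`validIn_iff_exists_isRefuted`). Both searches are through primitive recursive predicates.
-/

namespace RL

open ResiduatedLattice

/-! ### Raw algebras and their quotients -/

/-- A set with operations of the signature of residuated lattices, subject to no laws, and a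
relation that interprets the equality symbol. The binary operations are numbered by the tags of
the Gödel numbering of terms: `2` is `·`, `3` is `∨`, `4` is `∧`, `5` is `\` and `6` is `/`. -/
structure RawAlg (X : Type w) where
  one : X
  op : ℕ → X → X → X
  eq : X → X → Prop

/-- The value of a term in a raw algebra. -/
def Term.evalIn {X : Type w} (R : RawAlg X) (v : ℕ → X) : Term → X
  | var i => v i
  | one => R.one
  | mul s t => R.op 2 (evalIn R v s) (evalIn R v t)
  | sup s t => R.op 3 (evalIn R v s) (evalIn R v t)
  | inf s t => R.op 4 (evalIn R v s) (evalIn R v t)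
  | ldiv s t => R.op 5 (evalIn R v s) (evalIn R v t)
  | rdiv s t => R.op 6 (evalIn R v s) (evalIn R v t)

/-- Truth of a quantifier-free formula in a raw algebra. -/
def QFFormula.holdsIn {X : Type w} (R : RawAlg X) (v : ℕ → X) : QFFormula → Prop
  | falsum => False
  | equal s t => R.eq (s.evalIn R v) (t.evalIn R v)
  | imp p q => holdsIn R v p → holdsIn R v q

/-- The binary operation of a residuated lattice with a given tag. -/
def binOp (A : Type u) [ResiduatedLattice A] : ℕ → A → A → A
  | 2 => fun x y => x * y
  | 3 => fun x y => x ⊔ y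
  | 4 => fun x y => x ⊓ y
  | 5 => fun x y => ldiv x y
  | 6 => fun x y => rdiv x y
  | _ => fun x _ => x

/-- A residuated lattice as a raw algebra, with `r` as the interpretation of equality. -/
def rawOf (A : Type u) [ResiduatedLattice A] (r : A → A → Prop) : RawAlg A where
  one := 1
  op := binOp A
  eq := r

theorem evalIn_rawOf (A : Type u) [ResiduatedLattice A] (r : A → A → Prop) (v : ℕ → A)
    (t : Term) : t.evalIn (rawOf A r) v = t.eval v := by
  induction t <;> simp_all [Term.evalIn, Term.eval, rawOf, binOp]

theorem holdsIn_rawOf (A : Type u) [ResiduatedLattice A] (v : ℕ → A) (p : QFFormula) :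
    p.holdsIn (rawOf A Eq) v ↔ p.Realize v := by
  induction p with
  | falsum => rfl
  | equal s t => simp only [QFFormula.holdsIn, QFFormula.Realize, evalIn_rawOf]; rfl
  | imp p q hp hq => simp only [QFFormula.holdsIn, QFFormula.Realize, hp, hq]

/-- Pulling back the interpretation of equality along a homomorphism of raw algebras preserves
the truth of formulas. -/
theorem holdsIn_comap {X : Type w} {Y : Type u} (R : RawAlg X) (S : RawAlg Y) (f : X → Y)
    (hone : f R.one = S.one) (hop : ∀ k x y, 2 ≤ k → k ≤ 6 → f (R.op k x y) = S.op k (f x) (f y))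
    (heq : ∀ x y, R.eq x y ↔ S.eq (f x) (f y)) (v : ℕ → X) (p : QFFormula) :
    p.holdsIn R v ↔ p.holdsIn S (f ∘ v) := by
  have ht : ∀ t : Term, f (t.evalIn R v) = t.evalIn S (f ∘ v) := by
    intro t
    induction t <;> simp_all [Term.evalIn]
  induction p with
  | falsum => rfl
  | equal s t => simp only [QFFormula.holdsIn, heq, ht]
  | imp p q hp hq => simp only [QFFormula.holdsIn, hp, hq]

/-- The constructors of terms for the five binary operations. -/
def binTerms : List (Term → Term → Term) :=
  [Term.mul, Term.sup, Term.inf, Term.ldiv, Term.rdiv]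

/-- The formula `s ≤ t`, written as `s ∨ t = t`. -/
def leFormula (s t : Term) : QFFormula := .equal (.sup s t) t

/-- The negation of a formula. -/
def notFormula (p : QFFormula) : QFFormula := .imp p .falsum

/-- Axioms saying that the interpretation of equality is a congruence. -/
def congruenceAxioms : List QFFormula :=
  .equal (.var 0) (.var 0) ::
  .imp (.equal (.var 0) (.var 1)) (.imp (.equal (.var 2) (.var 1)) (.equal (.var 0) (.var 2))) ::
  (binTerms.map fun o =>
    .imp (.equal (.var 0) (.var 1)) (.equal (o (.var 0) (.var 2)) (o (.var 1) (.var 2)))) ++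
  (binTerms.map fun o =>
    .imp (.equal (.var 0) (.var 1)) (.equal (o (.var 2) (.var 0)) (o (.var 2) (.var 1))))

/-- The axioms of residuated lattices. -/
def latticeAxioms : List QFFormula :=
  [.equal (.sup (.var 0) (.var 1)) (.sup (.var 1) (.var 0)),
   .equal (.sup (.sup (.var 0) (.var 1)) (.var 2)) (.sup (.var 0) (.sup (.var 1) (.var 2))),
   .equal (.inf (.var 0) (.var 1)) (.inf (.var 1) (.var 0)),
   .equal (.inf (.inf (.var 0) (.var 1)) (.var 2)) (.inf (.var 0) (.inf (.var 1) (.var 2))),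
   .equal (.sup (.var 0) (.inf (.var 0) (.var 1))) (.var 0),
   .equal (.inf (.var 0) (.sup (.var 0) (.var 1))) (.var 0),
   .equal (.mul (.mul (.var 0) (.var 1)) (.var 2)) (.mul (.var 0) (.mul (.var 1) (.var 2))),
   .equal (.mul .one (.var 0)) (.var 0),
   .equal (.mul (.var 0) .one) (.var 0),
   .imp (leFormula (.mul (.var 0) (.var 1)) (.var 2))
     (leFormula (.var 1) (.ldiv (.var 0) (.var 2))),
   .imp (leFormula (.var 1) (.ldiv (.var 0) (.var 2)))
     (leFormula (.mul (.var 0) (.var 1)) (.var 2)),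
   .imp (leFormula (.mul (.var 0) (.var 1)) (.var 2))
     (leFormula (.var 0) (.rdiv (.var 2) (.var 1))),
   .imp (leFormula (.var 0) (.rdiv (.var 2) (.var 1)))
     (leFormula (.mul (.var 0) (.var 1)) (.var 2))]

/-- Axioms of unilinearity: the disjunction is expressed by implications from the negations. -/
def unilinearAxioms : List QFFormula :=
  [.imp (notFormula (leFormula (.var 0) (.var 1))) (.imp (notFormula (leFormula (.var 1) (.var 0)))
     (leFormula (.inf (.var 0) (.var 1)) (.var 2))),
   .imp (notFormula (leFormula (.var 0) (.var 1))) (.imp (notFormula (leFormula (.var 1) (.var 0)))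
     (leFormula (.var 2) (.sup (.var 0) (.var 1))))]

/-- Universal axioms of unilinear residuated lattices, with equality as a congruence. -/
def unilinearTheory : List QFFormula := congruenceAxioms ++ latticeAxioms ++ unilinearAxioms

theorem realize_unilinearTheory {A : Type u} [ResiduatedLattice A] (hA : IsUnilinear A)
    {p : QFFormula} (hp : p ∈ unilinearTheory) (v : ℕ → A) : p.Realize v := by
  simp only [unilinearTheory, List.mem_append, or_assoc] at hp
  rcases hp with hp | hp | hp
  · simp only [congruenceAxioms, binTerms, List.map_cons, List.map_nil, List.cons_append,
      List.nil_append, List.mem_cons, List.not_mem_nil, or_false] at hp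
    rcases hp with rfl | rfl | rfl | rfl | rfl | rfl | rfl | rfl | rfl | rfl | rfl | rfl <;>
      simp +contextual [QFFormula.Realize, Term.eval]
  · simp only [latticeAxioms, List.mem_cons, List.not_mem_nil, or_false] at hp
    rcases hp with rfl | rfl | rfl | rfl | rfl | rfl | rfl | rfl | rfl | rfl | rfl | rfl | rfl <;>
      simp only [QFFormula.Realize, leFormula, Term.eval, sup_eq_right]
    · exact sup_comm _ _
    · exact sup_assoc _ _ _
    · exact inf_comm _ _
    · exact inf_assoc _ _ _
    · exact sup_inf_self
    · exact inf_sup_self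
    · exact mul_assoc _ _ _
    · exact one_mul _
    · exact mul_one _
    · exact (mul_le_iff_le_ldiv _ _ _).1
    · exact (mul_le_iff_le_ldiv _ _ _).2
    · exact (mul_le_iff_le_rdiv _ _ _).1
    · exact (mul_le_iff_le_rdiv _ _ _).2
  · simp only [unilinearAxioms, List.mem_cons, List.not_mem_nil, or_false] at hp
    rcases hp with rfl | rfl <;>
      simp only [QFFormula.Realize, leFormula, notFormula, Term.eval, sup_eq_right] <;>
      intro h₁ h₂
    · rcases hA (v 0) (v 1) (v 2) (v 2) with h | h | h
      · exact (h₁ h).elim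
      · exact (h₂ h).elim
      · exact h.1
    · rcases hA (v 0) (v 1) (v 2) (v 2) with h | h | h
      · exact (h₁ h).elim
      · exact (h₂ h).elim
      · exact h.2

/-- Assignments of the first three variables, for instantiating axioms. -/
def assign3 {X : Type w} (x y z : X) : ℕ → X
  | 0 => x
  | 1 => y
  | _ => z

/-- A raw algebra that satisfies the universal axioms of unilinear residuated lattices becomes a
unilinear residuated lattice when it is divided by the interpretation of equality. -/
theorem exists_quotient {X : Type w} (R : RawAlg X)
    (h : ∀ p ∈ unilinearTheory, ∀ v : ℕ → X, p.holdsIn R v) :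
    ∃ (A : Type max u w) (_ : ResiduatedLattice A) (f : X → A), IsUnilinear A ∧
      Function.Surjective f ∧ (∀ x y, f x = f y ↔ R.eq x y) ∧
      ∀ (v : ℕ → X) (t : Term), f (t.evalIn R v) = t.eval (f ∘ v) := by
  have hc : ∀ p ∈ congruenceAxioms, ∀ x y z : X, p.holdsIn R (assign3 x y z) := fun p hp x y z =>
    h p (by simp [unilinearTheory, hp]) _
  have hl : ∀ p ∈ latticeAxioms, ∀ x y z : X, p.holdsIn R (assign3 x y z) := fun p hp x y z =>
    h p (by simp [unilinearTheory, hp]) _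
  have hu : ∀ p ∈ unilinearAxioms, ∀ x y z : X, p.holdsIn R (assign3 x y z) := fun p hp x y z =>
    h p (by simp [unilinearTheory, hp]) _
  clear h
  simp only [congruenceAxioms, binTerms, List.map_cons, List.map_nil, List.cons_append,
    List.nil_append, List.forall_mem_cons, QFFormula.holdsIn, Term.evalIn, assign3] at hc
  simp only [latticeAxioms, leFormula, List.forall_mem_cons, QFFormula.holdsIn, Term.evalIn,
    assign3] at hl
  simp only [unilinearAxioms, leFormula, notFormula, List.forall_mem_cons, QFFormula.holdsIn,
    Term.evalIn, assign3] at hu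
  obtain ⟨hrefl, htr, l2, l3, l4, l5, l6, r2, r3, r4, r5, r6, -⟩ := hc
  obtain ⟨a1, a2, a3, a4, a5, a6, a7, a8, a9, a10, a11, a12, a13, -⟩ := hl
  obtain ⟨u1, u2, -⟩ := hu
  have refl : ∀ x, R.eq x x := fun x => hrefl x x x
  have symm : ∀ x y, R.eq x y → R.eq y x := fun x y hxy => htr y y x (refl y) hxy
  have trans : ∀ x y z, R.eq x y → R.eq y z → R.eq x z := fun x y z hxy hyz =>
    htr x y z hxy (symm _ _ hyz)
  let S : Setoid (ULift.{u} X) :=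
    ⟨fun x y => R.eq x.down y.down, fun x => refl _, fun h => symm _ _ h, fun h h' =>
      trans _ _ _ h h'⟩
  have hcongr : ∀ k, (∀ x y z, R.eq x y → R.eq (R.op k x z) (R.op k y z)) →
      (∀ x y z, R.eq x y → R.eq (R.op k z x) (R.op k z y)) →
      ∀ ⦃x x' : ULift.{u} X⦄, x ≈ x' → ∀ ⦃y y' : ULift.{u} X⦄, y ≈ y' →
        (ULift.up (R.op k x.down y.down) : ULift.{u} X) ≈ ULift.up (R.op k x'.down y'.down) :=
    fun k hl hr x x' hx y y' hy => trans _ _ _ (hl _ _ _ hx) (hr _ _ _ hy)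
  let o2 : Quotient S → Quotient S → Quotient S := Quotient.map₂ _ (hcongr 2 l2 r2)
  let o3 : Quotient S → Quotient S → Quotient S := Quotient.map₂ _ (hcongr 3 l3 r3)
  let o4 : Quotient S → Quotient S → Quotient S := Quotient.map₂ _ (hcongr 4 l4 r4)
  let o5 : Quotient S → Quotient S → Quotient S := Quotient.map₂ _ (hcongr 5 l5 r5)
  let o6 : Quotient S → Quotient S → Quotient S := Quotient.map₂ _ (hcongr 6 l6 r6)
  let f : X → Quotient S := fun x => Quotient.mk S (ULift.up x)
  have feq : ∀ x y, f x = f y ↔ R.eq x y := fun x y => Quotient.eq (r := S)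
  have fsurj : Function.Surjective f := fun q => by
    induction q using Quotient.inductionOn with
    | h x => exact ⟨x.down, rfl⟩
  let : Max (Quotient S) := ⟨o3⟩
  let : Min (Quotient S) := ⟨o4⟩
  let : Lattice (Quotient S) := Lattice.mk'
    (fsurj.forall₂.2 fun x y => (feq _ _).2 (a1 x y y))
    (fsurj.forall₃.2 fun x y z => (feq _ _).2 (a2 x y z))
    (fsurj.forall₂.2 fun x y => (feq _ _).2 (a3 x y y))
    (fsurj.forall₃.2 fun x y z => (feq _ _).2 (a4 x y z))
    (fsurj.forall₂.2 fun x y => (feq _ _).2 (a5 x y y))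
    (fsurj.forall₂.2 fun x y => (feq _ _).2 (a6 x y y))
  let : Monoid (Quotient S) :=
    { mul := o2
      one := f R.one
      mul_assoc := fsurj.forall₃.2 fun x y z => (feq _ _).2 (a7 x y z)
      one_mul := fsurj.forall.2 fun x => (feq _ _).2 (a8 x x x)
      mul_one := fsurj.forall.2 fun x => (feq _ _).2 (a9 x x x) }
  have hle : ∀ x y, f x ≤ f y ↔ R.eq (R.op 3 x y) y := fun x y => by
    rw [← sup_eq_right]
    exact feq (R.op 3 x y) y
  let : ResiduatedLattice (Quotient S) :=
    { ldiv := o5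
      rdiv := o6
      mul_le_iff_le_ldiv := fsurj.forall₃.2 fun x y z =>
        ⟨fun h => (hle y (R.op 5 x z)).2 (a10 x y z ((hle (R.op 2 x y) z).1 h)),
          fun h => (hle (R.op 2 x y) z).2 (a11 x y z ((hle y (R.op 5 x z)).1 h))⟩
      mul_le_iff_le_rdiv := fsurj.forall₃.2 fun x y z =>
        ⟨fun h => (hle x (R.op 6 z y)).2 (a12 x y z ((hle (R.op 2 x y) z).1 h)),
          fun h => (hle (R.op 2 x y) z).2 (a13 x y z ((hle x (R.op 6 z y)).1 h))⟩ }
  refine ⟨Quotient S, inferInstance, f, ?_, fsurj, feq, ?_⟩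
  · refine fsurj.forall₂.2 fun x y => fsurj.forall₂.2 fun z t => ?_
    by_cases h₁ : f x ≤ f y
    · exact Or.inl h₁
    by_cases h₂ : f y ≤ f x
    · exact Or.inr (Or.inl h₂)
    rw [hle] at h₁ h₂
    exact Or.inr (Or.inr ⟨(hle (R.op 4 x y) t).2 (u1 x y t h₁ h₂),
      (hle z (R.op 3 x y)).2 (u2 x y z h₁ h₂)⟩)
  · intro v t
    induction t with
    | var i => rfl
    | one => rfl
    | mul s t hs ht => rw [Term.eval, ← hs, ← ht]; rfl
    | sup s t hs ht => rw [Term.eval, ← hs, ← ht]; rfl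
    | inf s t hs ht => rw [Term.eval, ← hs, ← ht]; rfl
    | ldiv s t hs ht => rw [Term.eval, ← hs, ← ht]; rfl
    | rdiv s t hs ht => rw [Term.eval, ← hs, ← ht]; rfl

/-! ### Subdirect representation by unilinear residuated lattices -/

section Basic

variable {A : Type u} [ResiduatedLattice A]

theorem mul_le_mul_of_le {x x' y y' : A} (hx : x ≤ x') (hy : y ≤ y') : x * y ≤ x' * y' :=
  (mul_le_iff_le_rdiv _ _ _).2 (hx.trans ((mul_le_iff_le_rdiv _ _ _).1
    ((mul_le_iff_le_ldiv _ _ _).2 (hy.trans ((mul_le_iff_le_ldiv _ _ _).1 le_rfl)))))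

theorem mul_ldiv_le (x z : A) : x * ldiv x z ≤ z := (mul_le_iff_le_ldiv _ _ _).2 le_rfl

theorem rdiv_mul_le (z y : A) : rdiv z y * y ≤ z := (mul_le_iff_le_rdiv _ _ _).2 le_rfl

theorem mul_sup_distrib (x y z : A) : x * (y ⊔ z) = x * y ⊔ x * z :=
  le_antisymm
    ((mul_le_iff_le_ldiv _ _ _).2 (sup_le ((mul_le_iff_le_ldiv _ _ _).1 le_sup_left)
      ((mul_le_iff_le_ldiv _ _ _).1 le_sup_right)))
    (sup_le (mul_le_mul_of_le le_rfl le_sup_left) (mul_le_mul_of_le le_rfl le_sup_right))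

theorem sup_mul_distrib (x y z : A) : (x ⊔ y) * z = x * z ⊔ y * z :=
  le_antisymm
    ((mul_le_iff_le_rdiv _ _ _).2 (sup_le ((mul_le_iff_le_rdiv _ _ _).1 le_sup_left)
      ((mul_le_iff_le_rdiv _ _ _).1 le_sup_right)))
    (sup_le (mul_le_mul_of_le le_sup_left le_rfl) (mul_le_mul_of_le le_sup_right le_rfl))

theorem one_le_ldiv_iff {x y : A} : 1 ≤ ldiv x y ↔ x ≤ y := by
  rw [← mul_le_iff_le_ldiv, mul_one]

/-- Left (`true`) and right (`false`) conjugation by an element. -/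
def conj (p : Bool × A) (x : A) : A :=
  if p.1 then ldiv p.2 (x * p.2) else rdiv (p.2 * x) p.2

theorem conj_mono (p : Bool × A) {x y : A} (h : x ≤ y) : conj p x ≤ conj p y := by
  unfold conj
  split_ifs
  · exact (mul_le_iff_le_ldiv _ _ _).1 ((mul_ldiv_le _ _).trans (mul_le_mul_of_le h le_rfl))
  · exact (mul_le_iff_le_rdiv _ _ _).1 ((rdiv_mul_le _ _).trans (mul_le_mul_of_le le_rfl h))

theorem one_le_conj_one (p : Bool × A) : 1 ≤ conj p 1 := by
  unfold conj
  split_ifs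
  · rw [one_le_ldiv_iff, one_mul]
  · rw [← mul_le_iff_le_rdiv, mul_one, one_mul]

theorem conj_mul_le (p : Bool × A) (x y : A) : conj p x * conj p y ≤ conj p (x * y) := by
  unfold conj
  split_ifs
  · rw [← mul_le_iff_le_ldiv, ← mul_assoc]
    refine (mul_le_mul_of_le (mul_ldiv_le _ _) le_rfl).trans ?_
    rw [mul_assoc, mul_assoc]
    exact mul_le_mul_of_le le_rfl (mul_ldiv_le _ _)
  · rw [← mul_le_iff_le_rdiv, mul_assoc]
    refine (mul_le_mul_of_le le_rfl (rdiv_mul_le _ _)).trans ?_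
    rw [← mul_assoc, ← mul_assoc]
    exact mul_le_mul_of_le (rdiv_mul_le _ _) le_rfl

/-- Iterated conjugates of the negative part of `d`, where the negative part is taken at each
step. -/
def iterConj (d : A) (l : List (Bool × A)) : A :=
  l.foldr (fun p x => conj p x ⊓ 1) (d ⊓ 1)

theorem iterConj_le_one (d : A) (l : List (Bool × A)) : iterConj d l ≤ 1 := by
  cases l <;> exact inf_le_right

theorem iterConj_of_one_le {d : A} (h : 1 ≤ d) (l : List (Bool × A)) : iterConj d l = 1 := by
  refine le_antisymm (iterConj_le_one d l) ?_
  induction l with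
  | nil => exact le_inf h le_rfl
  | cons p l ih => exact le_inf ((one_le_conj_one p).trans (conj_mono p ih)) le_rfl

/-- A normal filter: the upward closed sets that arise as the sets of elements above the unit in
a quotient. -/
structure IsNormalFilter (F : Set A) : Prop where
  one_mem : (1 : A) ∈ F
  mem_of_le : ∀ {x y}, x ∈ F → x ≤ y → y ∈ F
  mul_mem : ∀ {x y}, x ∈ F → y ∈ F → x * y ∈ F
  inf_one_mem : ∀ {x}, x ∈ F → x ⊓ 1 ∈ F
  conj_mem : ∀ p {x}, x ∈ F → conj p x ∈ F

/-- The generators of the submonoid of the negative cone whose upward closure is the normal filter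
generated by `F` and `d`. -/
def negGenerators (F : Set A) (d : A) : Set A :=
  {x | (x ∈ F ∧ x ≤ 1) ∨ ∃ l, x = iterConj d l}

theorem negGenerators_le_one {F : Set A} {d x : A} (hx : x ∈ negGenerators F d) : x ≤ 1 := by
  rcases hx with hx | ⟨l, rfl⟩
  · exact hx.2
  · exact iterConj_le_one d l

/-- The normal filter generated by `F` and `d`. -/
def adjoin (F : Set A) (d : A) : Set A :=
  {x | ∃ y ∈ Submonoid.closure (negGenerators F d), y ≤ x}

theorem le_one_of_mem_closure {F : Set A} {d x : A}
    (hx : x ∈ Submonoid.closure (negGenerators F d)) : x ≤ 1 := by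
  induction hx using Submonoid.closure_induction with
  | mem x hx => exact negGenerators_le_one hx
  | one => exact le_rfl
  | mul x y _ _ hx hy => exact (mul_le_mul_of_le hx hy).trans (one_mul _).le

theorem exists_le_conj_inf_one {F : Set A} (hF : IsNormalFilter F) {d x : A} (p : Bool × A)
    (hx : x ∈ Submonoid.closure (negGenerators F d)) :
    ∃ y ∈ Submonoid.closure (negGenerators F d), y ≤ conj p x := by
  induction hx using Submonoid.closure_induction with
  | mem x hx =>
    refine ⟨conj p x ⊓ 1, Submonoid.subset_closure ?_, inf_le_left⟩
    rcases hx with hx | ⟨l, rfl⟩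
    · exact Or.inl ⟨hF.inf_one_mem (hF.conj_mem p hx.1), inf_le_right⟩
    · exact Or.inr ⟨p :: l, rfl⟩
  | one => exact ⟨1, one_mem _, one_le_conj_one p⟩
  | mul x y _ _ hx hy =>
    obtain ⟨x', hx', hxx'⟩ := hx
    obtain ⟨y', hy', hyy'⟩ := hy
    exact ⟨x' * y', mul_mem hx' hy', (mul_le_mul_of_le hxx' hyy').trans (conj_mul_le p x y)⟩

theorem isNormalFilter_adjoin {F : Set A} (hF : IsNormalFilter F) (d : A) :
    IsNormalFilter (adjoin F d) where
  one_mem := ⟨1, one_mem _, le_rfl⟩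
  mem_of_le := fun ⟨z, hz, h⟩ h' => ⟨z, hz, h.trans h'⟩
  mul_mem := fun ⟨z, hz, h⟩ ⟨z', hz', h'⟩ => ⟨z * z', mul_mem hz hz', mul_le_mul_of_le h h'⟩
  inf_one_mem := fun ⟨z, hz, h⟩ => ⟨z, hz, le_inf h (le_one_of_mem_closure hz)⟩
  conj_mem := fun p x ⟨z, hz, h⟩ => by
    obtain ⟨y, hy, hyz⟩ := exists_le_conj_inf_one hF p hz
    exact ⟨y, hy, hyz.trans (conj_mono p h)⟩

theorem subset_adjoin {F : Set A} (hF : IsNormalFilter F) (d : A) : F ⊆ adjoin F d :=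
  fun x hx => ⟨x ⊓ 1, Submonoid.subset_closure (Or.inl ⟨hF.inf_one_mem hx, inf_le_right⟩),
    inf_le_left⟩

theorem mem_adjoin (F : Set A) (d : A) : d ∈ adjoin F d :=
  ⟨d ⊓ 1, Submonoid.subset_closure (Or.inr ⟨[], rfl⟩), inf_le_left⟩

/-- If `x ∨ y` lies in a filter for all `x` in a set of negative elements, where `y` is negative,
then it does for all products `x` of elements of the set: `(x ∨ y)(x' ∨ y) ≤ xx' ∨ y`. -/
theorem sup_mem_of_mem_closure {F N : Set A} (hF : IsNormalFilter F) (hN : ∀ x ∈ N, x ≤ 1) {y : A}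
    (hy : y ≤ 1) (h : ∀ x ∈ N, x ⊔ y ∈ F) {x : A} (hx : x ∈ Submonoid.closure N) :
    x ⊔ y ∈ F := by
  have key : x ≤ 1 ∧ x ⊔ y ∈ F := by
    induction hx using Submonoid.closure_induction with
    | mem x hx => exact ⟨hN x hx, h x hx⟩
    | one => exact ⟨le_rfl, hF.mem_of_le hF.one_mem le_sup_left⟩
    | mul x x' _ _ hx hx' =>
      refine ⟨(mul_le_mul_of_le hx.1 hx'.1).trans (one_mul _).le,
        hF.mem_of_le (hF.mul_mem hx.2 hx'.2) ?_⟩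
      rw [mul_sup_distrib, sup_mul_distrib]
      refine sup_le (sup_le le_sup_left (le_sup_of_le_right ?_)) (le_sup_of_le_right ?_)
      · exact (mul_le_mul_of_le le_rfl hx'.1).trans (mul_one _).le
      · exact (mul_le_mul_of_le (sup_le hx.1 hy) le_rfl).trans (one_mul _).le
  exact key.2

end Basic

/-- The term for conjugation by a variable. -/
def conjTerm (p : Bool × ℕ) (t : Term) : Term :=
  if p.1 then .ldiv (.var p.2) (.mul t (.var p.2)) else .rdiv (.mul (.var p.2) t) (.var p.2)

/-- The term for an iterated conjugate, with variables as parameters. -/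
def iterConjTerm (d : Term) (l : List (Bool × ℕ)) : Term :=
  l.foldr (fun p t => .inf (conjTerm p t) .one) (.inf d .one)

theorem eval_iterConjTerm {A : Type u} [ResiduatedLattice A] (v : ℕ → A) (d : Term)
    (l : List (Bool × ℕ)) :
    (iterConjTerm d l).eval v = iterConj (d.eval v) (l.map fun q => (q.1, v q.2)) := by
  induction l with
  | nil => rfl
  | cons p l ih =>
    simp only [iterConjTerm, iterConj, List.foldr_cons, List.map_cons, Term.eval] at ih ⊢
    rw [← ih, conjTerm, conj]
    split_ifs <;> rfl

/-- In a semiunilinear residuated lattice, the joins of iterated conjugates of the elements that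
express the three cases of unilinearity are trivial. -/
theorem SRL.iterConj_sup_eq_one {A : Type u} [ResiduatedLattice A] (hA : SRL A) (x y z t : A)
    (l₁ l₂ l₃ : List (Bool × A)) :
    iterConj (ldiv x y) l₁ ⊔ (iterConj (ldiv y x) l₂ ⊔
      iterConj (ldiv (x ⊓ y) t ⊓ ldiv z (x ⊔ y)) l₃) = 1 := by
  -- All the elements that occur are values of an assignment of the variables.
  obtain ⟨v, hv⟩ : ∃ v : ℕ → A, ∀ b ∈ [x, y, z, t] ++ (l₁ ++ l₂ ++ l₃).map Prod.snd,
      ∃ i, v i = b := by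
    refine ⟨fun i => ([x, y, z, t] ++ (l₁ ++ l₂ ++ l₃).map Prod.snd).getD i 1, fun b hb => ?_⟩
    obtain ⟨i, hi, rfl⟩ := List.getElem_of_mem hb
    exact ⟨i, List.getD_eq_getElem _ _ hi⟩
  have hlist : ∀ l : List (Bool × A), (∀ p ∈ l, p ∈ l₁ ++ l₂ ++ l₃) →
      ∃ l' : List (Bool × ℕ), l'.map (fun q => (q.1, v q.2)) = l := by
    intro l
    induction l with
    | nil => exact fun _ => ⟨[], rfl⟩
    | cons p l ih =>
      intro h
      obtain ⟨l', hl'⟩ := ih fun q hq => h q (List.mem_cons_of_mem _ hq)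
      obtain ⟨i, hi⟩ := hv p.2 (List.mem_append_right _ (List.mem_map_of_mem (h p (by simp))))
      exact ⟨(p.1, i) :: l', by simp [hl', hi]⟩
  obtain ⟨m₁, rfl⟩ := hlist l₁ (by simp +contextual)
  obtain ⟨m₂, rfl⟩ := hlist l₂ (by simp +contextual)
  obtain ⟨m₃, rfl⟩ := hlist l₃ (by simp +contextual)
  obtain ⟨i, rfl⟩ := hv x (by simp)
  obtain ⟨j, rfl⟩ := hv y (by simp)
  obtain ⟨p, rfl⟩ := hv z (by simp)
  obtain ⟨q, rfl⟩ := hv t (by simp)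
  have key := hA ⟨.sup (iterConjTerm (.ldiv (.var i) (.var j)) m₁)
    (.sup (iterConjTerm (.ldiv (.var j) (.var i)) m₂)
      (iterConjTerm (.inf (.ldiv (.inf (.var i) (.var j)) (.var q))
        (.ldiv (.var p) (.sup (.var i) (.var j)))) m₃)), .one⟩
  refine Eq.trans ?_ (key ?_ v)
  · simp only [Term.eval, eval_iterConjTerm]
  · intro R _ hR v
    simp only [Term.eval, eval_iterConjTerm]
    refine le_antisymm (sup_le (iterConj_le_one _ _) (sup_le (iterConj_le_one _ _)
      (iterConj_le_one _ _))) ?_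
    rcases hR (v i) (v j) (v p) (v q) with h | h | h
    · exact le_sup_of_le_left (iterConj_of_one_le (one_le_ldiv_iff.2 h) _).ge
    · exact le_sup_of_le_right (le_sup_of_le_left (iterConj_of_one_le (one_le_ldiv_iff.2 h) _).ge)
    · exact le_sup_of_le_right (le_sup_of_le_right (iterConj_of_one_le
        (le_inf (one_le_ldiv_iff.2 h.1) (one_le_ldiv_iff.2 h.2)) _).ge)

/-- A normal filter that contains `c` as soon as one of `x \ y`, `y \ x` and the third element
of unilinearity is adjoined contains `c`. -/
theorem SRL.mem_of_mem_adjoin {A : Type u} [ResiduatedLattice A] (hA : SRL A) {F : Set A}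
    (hF : IsNormalFilter F) {x y z t c : A} (h₁ : c ∈ adjoin F (ldiv x y))
    (h₂ : c ∈ adjoin F (ldiv y x))
    (h₃ : c ∈ adjoin F (ldiv (x ⊓ y) t ⊓ ldiv z (x ⊔ y))) : c ∈ F := by
  obtain ⟨p, hp, hpc⟩ := h₁
  obtain ⟨q, hq, hqc⟩ := h₂
  obtain ⟨r, hr, hrc⟩ := h₃
  refine hF.mem_of_le ?_ (sup_le hpc (sup_le hqc hrc))
  have hq1 := le_one_of_mem_closure hq
  have hr1 := le_one_of_mem_closure hr
  refine sup_mem_of_mem_closure hF (fun _ => negGenerators_le_one) (sup_le hq1 hr1) ?_ hp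
  intro p hp
  rw [sup_left_comm]
  have hp1 := negGenerators_le_one hp
  refine sup_mem_of_mem_closure hF (fun _ => negGenerators_le_one) (sup_le hp1 hr1) ?_ hq
  intro q hq
  rw [← sup_assoc, sup_comm]
  have hq1 := negGenerators_le_one hq
  refine sup_mem_of_mem_closure hF (fun _ => negGenerators_le_one) (sup_le hq1 hp1) ?_ hr
  intro r hr
  rcases hp with hp | ⟨l₁, rfl⟩
  · exact hF.mem_of_le hp.1 (le_sup_of_le_right le_sup_right)
  rcases hq with hq | ⟨l₂, rfl⟩
  · exact hF.mem_of_le hq.1 (le_sup_of_le_right le_sup_left)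
  rcases hr with hr | ⟨l₃, rfl⟩
  · exact hF.mem_of_le hr.1 le_sup_left
  rw [sup_comm, sup_comm (iterConj (ldiv y x) l₂), sup_assoc, hA.iterConj_sup_eq_one]
  exact hF.one_mem

section Quotient

variable {A : Type u} [ResiduatedLattice A] {F : Set A}

theorem IsNormalFilter.inf_mem (hF : IsNormalFilter F) {x y : A} (hx : x ∈ F) (hy : y ∈ F) :
    x ⊓ y ∈ F :=
  hF.mem_of_le (hF.mul_mem (hF.inf_one_mem hx) (hF.inf_one_mem hy))
    (le_inf ((mul_le_mul_of_le inf_le_left inf_le_right).trans (mul_one _).le)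
      ((mul_le_mul_of_le inf_le_right inf_le_left).trans (one_mul _).le))

theorem IsNormalFilter.ldiv_mem_of_le (hF : IsNormalFilter F) {x y : A} (h : x ≤ y) :
    ldiv x y ∈ F :=
  hF.mem_of_le hF.one_mem (one_le_ldiv_iff.2 h)

theorem IsNormalFilter.ldiv_trans (hF : IsNormalFilter F) {x y z : A} (h : ldiv x y ∈ F)
    (h' : ldiv y z ∈ F) : ldiv x z ∈ F := by
  refine hF.mem_of_le (hF.mul_mem h h') ((mul_le_iff_le_ldiv _ _ _).1 ?_)
  rw [← mul_assoc]
  exact (mul_le_mul_of_le (mul_ldiv_le _ _) le_rfl).trans (mul_ldiv_le _ _)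

theorem IsNormalFilter.ldiv_mul_left (hF : IsNormalFilter F) {x y : A} (z : A)
    (h : ldiv x y ∈ F) : ldiv (z * x) (z * y) ∈ F := by
  refine hF.mem_of_le h ((mul_le_iff_le_ldiv _ _ _).1 ?_)
  rw [mul_assoc]
  exact mul_le_mul_of_le le_rfl (mul_ldiv_le _ _)

theorem IsNormalFilter.ldiv_mul_right (hF : IsNormalFilter F) {x y : A} (z : A)
    (h : ldiv x y ∈ F) : ldiv (x * z) (y * z) ∈ F := by
  refine hF.mem_of_le (hF.conj_mem (true, z) h) ((mul_le_iff_le_ldiv _ _ _).1 ?_)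
  simp only [conj, if_true]
  rw [mul_assoc]
  refine (mul_le_mul_of_le le_rfl (mul_ldiv_le _ _)).trans ?_
  rw [← mul_assoc]
  exact mul_le_mul_of_le (mul_ldiv_le _ _) le_rfl

theorem IsNormalFilter.ldiv_sup (hF : IsNormalFilter F) {x y z : A} (h : ldiv x z ∈ F)
    (h' : ldiv y z ∈ F) : ldiv (x ⊔ y) z ∈ F := by
  refine hF.mem_of_le (hF.inf_mem h h') ((mul_le_iff_le_ldiv _ _ _).1 ?_)
  rw [sup_mul_distrib]
  exact sup_le ((mul_le_mul_of_le le_rfl inf_le_left).trans (mul_ldiv_le _ _))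
    ((mul_le_mul_of_le le_rfl inf_le_right).trans (mul_ldiv_le _ _))

theorem IsNormalFilter.ldiv_inf (hF : IsNormalFilter F) {x y z : A} (h : ldiv x y ∈ F)
    (h' : ldiv x z ∈ F) : ldiv x (y ⊓ z) ∈ F :=
  hF.mem_of_le (hF.inf_mem h h') ((mul_le_iff_le_ldiv _ _ _).1
    (le_inf ((mul_le_mul_of_le le_rfl inf_le_left).trans (mul_ldiv_le _ _))
    ((mul_le_mul_of_le le_rfl inf_le_right).trans (mul_ldiv_le _ _))))

theorem IsNormalFilter.ldiv_ldiv_mem_iff (hF : IsNormalFilter F) (x y z : A) :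
    ldiv (x * y) z ∈ F ↔ ldiv y (ldiv x z) ∈ F := by
  constructor <;> intro h <;> refine hF.mem_of_le h ?_
  · rw [← mul_le_iff_le_ldiv, ← mul_le_iff_le_ldiv, ← mul_assoc]
    exact mul_ldiv_le _ _
  · rw [← mul_le_iff_le_ldiv, mul_assoc]
    exact (mul_le_mul_of_le le_rfl (mul_ldiv_le _ _)).trans (mul_ldiv_le _ _)

theorem IsNormalFilter.ldiv_rdiv_mem_iff (hF : IsNormalFilter F) (x y z : A) :
    ldiv (x * y) z ∈ F ↔ ldiv x (rdiv z y) ∈ F := by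
  rw [hF.ldiv_ldiv_mem_iff]
  constructor <;> intro h
  · refine hF.mem_of_le (hF.conj_mem (false, y) h) ?_
    rw [← mul_le_iff_le_ldiv, ← mul_le_iff_le_rdiv, mul_assoc]
    simp only [conj, Bool.false_eq_true, if_false]
    exact (mul_le_mul_of_le le_rfl ((rdiv_mul_le _ _).trans (mul_ldiv_le _ _))).trans
      (mul_ldiv_le _ _)
  · refine hF.mem_of_le (hF.conj_mem (true, y) h) ?_
    rw [← mul_le_iff_le_ldiv, ← mul_le_iff_le_ldiv]
    simp only [conj, if_true]
    refine (mul_le_mul_of_le le_rfl (mul_ldiv_le _ _)).trans ?_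
    rw [← mul_assoc]
    exact (mul_le_mul_of_le (mul_ldiv_le _ _) le_rfl).trans (rdiv_mul_le _ _)

end Quotient

/-- In a semiunilinear residuated lattice, distinct elements are separated by a homomorphism onto a
unilinear residuated lattice. -/
theorem SRL.exists_unilinear_quotient {A : Type u} [ResiduatedLattice A] (hA : SRL A) {a b : A}
    (hab : a ≠ b) : ∃ (Q : Type u) (_ : ResiduatedLattice Q) (f : A → Q), IsUnilinear Q ∧
      Function.Surjective f ∧ f a ≠ f b ∧
      ∀ (v : ℕ → A) (t : Term), f (t.eval v) = t.eval (f ∘ v) := by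
  wlog hle : ¬ a ≤ b generalizing a b
  · obtain ⟨Q, i, f, hQ, hf, hne, h⟩ := this hab.symm fun h => hab (le_antisymm (not_not.1 hle) h)
    exact ⟨Q, i, f, hQ, hf, hne.symm, h⟩
  -- A normal filter that is maximal among those that do not contain `a \ b`.
  obtain ⟨F, hF⟩ : ∃ F, Maximal (fun F : Set A => IsNormalFilter F ∧ ldiv a b ∉ F) F := by
    have h0 : IsNormalFilter {x : A | 1 ≤ x} :=
      { one_mem := le_rfl
        mem_of_le := fun h h' => (show (1 : A) ≤ _ from h).trans h'
        mul_mem := fun h h' => (one_mul (1 : A)).ge.trans (mul_le_mul_of_le h h')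
        inf_one_mem := fun h => le_inf h le_rfl
        conj_mem := fun p _ h => (one_le_conj_one p).trans (conj_mono p h) }
    obtain ⟨F, -, hF⟩ := zorn_subset_nonempty {F : Set A | IsNormalFilter F ∧ ldiv a b ∉ F}
      (fun c hc hchain ⟨F₀, hF₀⟩ => by
        refine ⟨⋃₀ c, ⟨⟨⟨F₀, hF₀, (hc hF₀).1.one_mem⟩, ?_, ?_, ?_, ?_⟩, ?_⟩,
          fun s => Set.subset_sUnion_of_mem⟩
        · rintro x y ⟨F, hF, hx⟩ hxy
          exact ⟨F, hF, (hc hF).1.mem_of_le hx hxy⟩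
        · rintro x y ⟨F, hF, hx⟩ ⟨G, hG, hy⟩
          rcases hchain.total hF hG with h | h
          · exact ⟨G, hG, (hc hG).1.mul_mem (h hx) hy⟩
          · exact ⟨F, hF, (hc hF).1.mul_mem hx (h hy)⟩
        · rintro x ⟨F, hF, hx⟩
          exact ⟨F, hF, (hc hF).1.inf_one_mem hx⟩
        · rintro p x ⟨F, hF, hx⟩
          exact ⟨F, hF, (hc hF).1.conj_mem p hx⟩
        · rintro ⟨F, hF, hx⟩
          exact (hc hF).2 hx)
      {x : A | 1 ≤ x} ⟨h0, fun h => hle (one_le_ldiv_iff.1 h)⟩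
    exact ⟨F, hF⟩
  have hN := hF.prop.1
  have hmem : ∀ d ∉ F, ldiv a b ∈ adjoin F d := fun d hd => by
    by_contra h
    exact hd (hF.le_of_ge ⟨isNormalFilter_adjoin hN d, h⟩ (subset_adjoin hN d) (mem_adjoin F d))
  let r : A → A → Prop := fun x y => ldiv x y ∈ F ∧ ldiv y x ∈ F
  have hrefl : ∀ x, r x x := fun x => ⟨hN.ldiv_mem_of_le le_rfl, hN.ldiv_mem_of_le le_rfl⟩
  have hr : ∀ {x y}, x = y → r x y := fun {x y} h => h ▸ hrefl x
  have hle_iff : ∀ x y, r (x ⊔ y) y ↔ ldiv x y ∈ F := fun x y =>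
    ⟨fun h => hN.ldiv_trans (hN.ldiv_mem_of_le le_sup_left) h.1, fun h =>
      ⟨hN.ldiv_sup h (hN.ldiv_mem_of_le le_rfl), hN.ldiv_mem_of_le le_sup_right⟩⟩
  obtain ⟨Q, i, f, hQ, hf, hrf, heval⟩ := exists_quotient.{u} (rawOf A r) (by
    intro p hp v
    simp only [unilinearTheory, List.mem_append, or_assoc] at hp
    rcases hp with hp | hp | hp
    · simp only [congruenceAxioms, binTerms, List.map_cons, List.map_nil, List.cons_append,
        List.nil_append, List.mem_cons, List.not_mem_nil, or_false] at hp
      rcases hp with rfl | rfl | rfl | rfl | rfl | rfl | rfl | rfl | rfl | rfl | rfl | rfl <;>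
        simp only [QFFormula.holdsIn, evalIn_rawOf, Term.eval]
      · exact hrefl _
      · exact fun h h' => ⟨hN.ldiv_trans h.1 h'.2, hN.ldiv_trans h'.1 h.2⟩
      · exact fun h => ⟨hN.ldiv_mul_right _ h.1, hN.ldiv_mul_right _ h.2⟩
      · exact fun h => ⟨hN.ldiv_sup (hN.ldiv_trans h.1 (hN.ldiv_mem_of_le le_sup_left))
          (hN.ldiv_mem_of_le le_sup_right),
          hN.ldiv_sup (hN.ldiv_trans h.2 (hN.ldiv_mem_of_le le_sup_left))
          (hN.ldiv_mem_of_le le_sup_right)⟩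
      · exact fun h => ⟨hN.ldiv_inf (hN.ldiv_trans (hN.ldiv_mem_of_le inf_le_left) h.1)
          (hN.ldiv_mem_of_le inf_le_right),
          hN.ldiv_inf (hN.ldiv_trans (hN.ldiv_mem_of_le inf_le_left) h.2)
          (hN.ldiv_mem_of_le inf_le_right)⟩
      · exact fun h => ⟨(hN.ldiv_ldiv_mem_iff _ _ _).1 (hN.ldiv_trans (hN.ldiv_mul_right _ h.2)
          (hN.ldiv_mem_of_le (mul_ldiv_le _ _))),
          (hN.ldiv_ldiv_mem_iff _ _ _).1 (hN.ldiv_trans (hN.ldiv_mul_right _ h.1)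
          (hN.ldiv_mem_of_le (mul_ldiv_le _ _)))⟩
      · exact fun h => ⟨(hN.ldiv_rdiv_mem_iff _ _ _).1 (hN.ldiv_trans
          (hN.ldiv_mem_of_le (rdiv_mul_le _ _)) h.1),
          (hN.ldiv_rdiv_mem_iff _ _ _).1 (hN.ldiv_trans
          (hN.ldiv_mem_of_le (rdiv_mul_le _ _)) h.2)⟩
      · exact fun h => ⟨hN.ldiv_mul_left _ h.1, hN.ldiv_mul_left _ h.2⟩
      · exact fun h => ⟨hN.ldiv_sup (hN.ldiv_mem_of_le le_sup_left)
          (hN.ldiv_trans h.1 (hN.ldiv_mem_of_le le_sup_right)),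
          hN.ldiv_sup (hN.ldiv_mem_of_le le_sup_left)
          (hN.ldiv_trans h.2 (hN.ldiv_mem_of_le le_sup_right))⟩
      · exact fun h => ⟨hN.ldiv_inf (hN.ldiv_mem_of_le inf_le_left)
          (hN.ldiv_trans (hN.ldiv_mem_of_le inf_le_right) h.1),
          hN.ldiv_inf (hN.ldiv_mem_of_le inf_le_left)
          (hN.ldiv_trans (hN.ldiv_mem_of_le inf_le_right) h.2)⟩
      · exact fun h => ⟨(hN.ldiv_ldiv_mem_iff _ _ _).1 (hN.ldiv_trans
          (hN.ldiv_mem_of_le (mul_ldiv_le _ _)) h.1),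
          (hN.ldiv_ldiv_mem_iff _ _ _).1 (hN.ldiv_trans
          (hN.ldiv_mem_of_le (mul_ldiv_le _ _)) h.2)⟩
      · exact fun h => ⟨(hN.ldiv_rdiv_mem_iff _ _ _).1 (hN.ldiv_trans (hN.ldiv_mul_left _ h.2)
          (hN.ldiv_mem_of_le (rdiv_mul_le _ _))),
          (hN.ldiv_rdiv_mem_iff _ _ _).1 (hN.ldiv_trans (hN.ldiv_mul_left _ h.1)
          (hN.ldiv_mem_of_le (rdiv_mul_le _ _)))⟩
    · simp only [latticeAxioms, List.mem_cons, List.not_mem_nil, or_false] at hp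
      rcases hp with rfl | rfl | rfl | rfl | rfl | rfl | rfl | rfl | rfl | rfl | rfl | rfl |
          rfl <;>
        simp only [QFFormula.holdsIn, leFormula, evalIn_rawOf, Term.eval]
      · exact hr (sup_comm _ _)
      · exact hr (sup_assoc _ _ _)
      · exact hr (inf_comm _ _)
      · exact hr (inf_assoc _ _ _)
      · exact hr sup_inf_self
      · exact hr inf_sup_self
      · exact hr (mul_assoc _ _ _)
      · exact hr (one_mul _)
      · exact hr (mul_one _)
      · exact fun h => (hle_iff _ _).2 ((hN.ldiv_ldiv_mem_iff _ _ _).1 ((hle_iff _ _).1 h))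
      · exact fun h => (hle_iff _ _).2 ((hN.ldiv_ldiv_mem_iff _ _ _).2 ((hle_iff _ _).1 h))
      · exact fun h => (hle_iff _ _).2 ((hN.ldiv_rdiv_mem_iff _ _ _).1 ((hle_iff _ _).1 h))
      · exact fun h => (hle_iff _ _).2 ((hN.ldiv_rdiv_mem_iff _ _ _).2 ((hle_iff _ _).1 h))
    · have huni : ∀ x y z t : A, ¬ r (x ⊔ y) y → ¬ r (y ⊔ x) x →
          ldiv (x ⊓ y) t ⊓ ldiv z (x ⊔ y) ∈ F := by
        intro x y z t h₁ h₂
        rw [hle_iff] at h₁ h₂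
        by_contra h₃
        exact hF.prop.2 (hA.mem_of_mem_adjoin hN (hmem _ h₁) (hmem _ h₂) (hmem _ h₃))
      simp only [unilinearAxioms, List.mem_cons, List.not_mem_nil, or_false] at hp
      rcases hp with rfl | rfl <;>
        simp only [QFFormula.holdsIn, leFormula, notFormula, evalIn_rawOf, Term.eval] <;>
        intro h₁ h₂
      · exact (hle_iff _ _).2 (hN.mem_of_le (huni _ _ (v 2) _ h₁ h₂) inf_le_left)
      · exact (hle_iff _ _).2 (hN.mem_of_le (huni _ _ _ (v 2) h₁ h₂) inf_le_right))
  refine ⟨Q, i, f, hQ, hf, fun h => hF.prop.2 ((hrf a b).1 h).1, fun v t => ?_⟩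
  rw [← heval, evalIn_rawOf]

/-! ### Finitely many contexts -/

/-- A relation between two well-quasi-ordered sets that is monotone in both arguments has only
finitely many sections: an infinite set of sections contains a strictly increasing sequence of upper
sets. -/
theorem finite_range_of_wellQuasiOrdered {X : Type u} {Y : Type w} {r : X → X → Prop}
    {s : Y → Y → Prop} [IsPreorder X r] [Std.Refl s] (hr : WellQuasiOrdered r)
    (hs : WellQuasiOrdered s) {R : X → Y → Prop}
    (hR : ∀ x x' y y', r x x' → s y y' → R x y → R x' y') : (Set.range R).Finite := by
  by_contra hinf
  have hinf : (Set.range R).Infinite := hinf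
  choose f hf using fun i => (hinf.natEmbedding _ i).2
  have hfinj : ∀ i j, R (f i) = R (f j) → i = j := fun i j h =>
    (hinf.natEmbedding _).injective (Subtype.ext (by rw [← hf i, ← hf j, h]))
  obtain ⟨g, hg⟩ := hr.exists_monotone_subseq f
  have hstrict : ∀ i, ∃ y, R (f (g (i + 1))) y ∧ ¬ R (f (g i)) y := by
    intro i
    by_contra! h
    have := hfinj (g i) (g (i + 1)) (funext fun y => propext
      ⟨hR _ _ _ _ (hg i (i + 1) i.le_succ) (refl_of s y), h y⟩)
    exact absurd (g.injective this) (by simp)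
  choose y hy hy' using hstrict
  obtain ⟨i, j, hij, h⟩ := hs y
  exact hy' j (hR _ _ _ _ (hg (i + 1) j hij) h (hy i))

section Lists

variable {S : Type u}

/-- The list of blocks `(x, e 0), Y 1, (x, e 1), …, Y k, (x, e k)`. -/
def blockList (x : S) (e : ℕ → ℕ) (Y : ℕ → List (S × ℕ)) : ℕ → List (S × ℕ)
  | 0 => [(x, e 0)]
  | k + 1 => blockList x e Y k ++ Y (k + 1) ++ [(x, e (k + 1))]

theorem blockList_congr (x : S) {e e' : ℕ → ℕ} {Y Y' : ℕ → List (S × ℕ)} {k : ℕ}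
    (h : ∀ i ≤ k, e i = e' i) (hY : ∀ i ≤ k, Y i = Y' i) :
    blockList x e Y k = blockList x e' Y' k := by
  induction k with
  | zero => rw [blockList, blockList, h 0 le_rfl]
  | succ k ih =>
    rw [blockList, blockList, ih (fun i hi => h i (by omega)) (fun i hi => hY i (by omega)),
      h _ le_rfl, hY _ le_rfl]

theorem map_fst_blockList (x : S) (e e' : ℕ → ℕ) (Y : ℕ → List (S × ℕ)) (k : ℕ) :
    (blockList x e Y k).map Prod.fst = (blockList x e' Y k).map Prod.fst := by
  induction k with
  | zero => rfl
  | succ k ih => simp [blockList, ih]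

theorem mem_blockList (x : S) (e : ℕ → ℕ) (Y : ℕ → List (S × ℕ)) {i k : ℕ} (hi : i ≤ k) :
    (x, e i) ∈ blockList x e Y k := by
  induction k with
  | zero => simp [blockList, Nat.le_zero.1 hi]
  | succ k ih =>
    rcases Nat.lt_or_eq_of_le hi with h | rfl
    · simp [blockList, ih (Nat.le_of_lt_succ h)]
    · simp [blockList]

/-- A list in which a letter `x` occurs more than `k` times contains a list of the form
`blockList`. -/
theorem exists_eq_append_blockList [DecidableEq S] (x : S) (k : ℕ) (L : List (S × ℕ))
    (h : k < (L.map Prod.fst).count x) :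
    ∃ pre e Y post, L = pre ++ blockList x e Y k ++ post ∧
      (post.map Prod.fst).count x + (k + 1) = (L.map Prod.fst).count x := by
  have split : ∀ L : List (S × ℕ), 0 < (L.map Prod.fst).count x →
      ∃ s e t, L = s ++ (x, e) :: t ∧
        (t.map Prod.fst).count x + 1 = (L.map Prod.fst).count x := by
    intro L
    induction L with
    | nil => simp
    | cons p L ih =>
      intro hL
      by_cases hp : p.1 = x
      · exact ⟨[], p.2, L, by simp [← hp], by simp [hp]⟩
      · obtain ⟨s, e, t, rfl, ht⟩ := ih (by simpa [List.count_cons, hp] using hL)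
        refine ⟨p :: s, e, t, rfl, ?_⟩
        rw [ht]
        simp [hp]
  induction k with
  | zero =>
    obtain ⟨s, e, t, rfl, ht⟩ := split L h
    exact ⟨s, fun _ => e, fun _ => [], t, by simp [blockList], ht⟩
  | succ k ih =>
    obtain ⟨pre, e, Y, post, hL, hcount⟩ := ih (by omega)
    obtain ⟨s, e₁, t, rfl, ht⟩ := split post (by omega)
    refine ⟨pre, Function.update e (k + 1) e₁, Function.update Y (k + 1) s, t, ?_, by omega⟩
    rw [blockList, Function.update_self, Function.update_self,
      blockList_congr x (e' := e) (Y' := Y)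
        (fun i hi => Function.update_of_ne (by omega) _ _)
        (fun i hi => Function.update_of_ne (by omega) _ _), hL]
    simp

end Lists

section Blocks

variable {S : Type u} [Monoid S]

/-- The product `x ^ e 0 * Y 1 * x ^ e 1 * ⋯ * Y k * x ^ e k`. -/
def interProd (x : S) (e : ℕ → ℕ) (Y : ℕ → S) : ℕ → S
  | 0 => x ^ e 0
  | k + 1 => interProd x e Y k * Y (k + 1) * x ^ e (k + 1)

theorem interProd_congr (x : S) {e e' : ℕ → ℕ} {Y Y' : ℕ → S} {k : ℕ}
    (h : ∀ i ≤ k, e i = e' i) (hY : ∀ i ≤ k, Y i = Y' i) :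
    interProd x e Y k = interProd x e' Y' k := by
  induction k with
  | zero => rw [interProd, interProd, h 0 le_rfl]
  | succ k ih =>
    rw [interProd, interProd, ih (fun i hi => h i (by omega)) (fun i hi => hY i (by omega)),
      h _ le_rfl, hY _ le_rfl]

/-- Powers of `x` can be moved between the exponents and the factors `Y i`. -/
theorem interProd_shift (x : S) (f g : ℕ → ℕ) (Y : ℕ → S) (k : ℕ) :
    interProd x f (fun i => x ^ g (i - 1) * Y i) k * x ^ g k =
      interProd x (fun i => f i + g i) Y k := by
  induction k with
  | zero => rw [interProd, interProd, pow_add]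
  | succ k ih =>
    rw [interProd, interProd, ← ih, pow_add, Nat.add_sub_cancel]
    simp only [mul_assoc]

/-- The weak commutativity law with exponents `a 0, …, a k`. -/
def WeaklyCommutative (S : Type u) [Monoid S] (k : ℕ) (a : ℕ → ℕ) : Prop :=
  ∀ (x : S) (Y : ℕ → S), interProd x (fun _ => 1) Y k = interProd x a Y k

/-- If `k + 1` numbers with sum `k + 1` are not all equal to `1` then one of them is `0`. -/
theorem exists_eq_zero_of_sum_eq {k : ℕ} {a : ℕ → ℕ}
    (hsum : ∑ i ∈ Finset.range (k + 1), a i = k + 1)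
    (hne : ∃ i ∈ Finset.range (k + 1), a i ≠ 1) : ∃ j ≤ k, a j = 0 := by
  by_contra! h
  have hpos : ∀ i ∈ Finset.range (k + 1), 1 ≤ a i := fun i hi =>
    Nat.one_le_iff_ne_zero.2 (h i (Nat.le_of_lt_succ (Finset.mem_range.1 hi)))
  obtain ⟨i, hi, hi1⟩ := hne
  exact hi1 (((Finset.sum_eq_sum_iff_of_le hpos).1 (by simp [hsum]) i hi).symm)

/-- The exponent at a position `j` with `a j = 0` decreases as long as all the exponents are
positive, so that weak commutativity empties one of the powers of `x`. -/
theorem WeaklyCommutative.exists_zero {k : ℕ} {a : ℕ → ℕ} (h : WeaklyCommutative S k a) {j : ℕ}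
    (hj : j ≤ k) (haj : a j = 0) (x : S) (Y : ℕ → S) (e : ℕ → ℕ) :
    ∃ e' : ℕ → ℕ, interProd x e' Y k = interProd x e Y k ∧ ∃ i ≤ k, e' i = 0 := by
  induction hN : e j generalizing e with
  | zero => exact ⟨e, rfl, j, hj, hN⟩
  | succ N ih =>
    by_cases hz : ∃ i ≤ k, e i = 0
    · exact ⟨e, rfl, hz⟩
    push Not at hz
    obtain ⟨e', he', hz'⟩ := ih (fun i => a i + (e i - 1)) (by simp [haj, hN])
    refine ⟨e', he'.trans ?_, hz'⟩
    rw [← interProd_shift x a (fun i => e i - 1), ← h,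
      interProd_shift x (fun _ => 1) (fun i => e i - 1)]
    exact interProd_congr x (fun i hi => by have := hz i hi; omega) fun _ _ => rfl

/-- The value of a word that is written as a list of powers of letters. -/
def blockProd (L : List (S × ℕ)) : S := (L.map fun p => p.1 ^ p.2).prod

theorem blockProd_append (L L' : List (S × ℕ)) :
    blockProd (L ++ L') = blockProd L * blockProd L' := by
  simp [blockProd]

theorem blockProd_blockList (x : S) (e : ℕ → ℕ) (Y : ℕ → List (S × ℕ)) (k : ℕ) :
    blockProd (blockList x e Y k) = interProd x e (fun i => blockProd (Y i)) k := by
  induction k with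
  | zero => simp [blockList, interProd, blockProd]
  | succ k ih =>
    rw [blockList, blockProd_append, blockProd_append, ih, interProd]
    simp [blockProd]

/-- Under weak commutativity, every product of powers of letters from a finite set `G` is a product
of at most `k * #G` such powers. -/
theorem WeaklyCommutative.exists_short {k : ℕ} {a : ℕ → ℕ} (h : WeaklyCommutative S k a) {j : ℕ}
    (hj : j ≤ k) (haj : a j = 0) (G : Finset S) (L : List (S × ℕ)) (hL : ∀ p ∈ L, p.1 ∈ G) :
    ∃ L' : List (S × ℕ), (∀ p ∈ L', p.1 ∈ G) ∧ blockProd L' = blockProd L ∧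
      L'.length ≤ k * G.card := by
  classical
  induction hN : L.length using Nat.strong_induction_on generalizing L with
  | _ N ih =>
  subst hN
  by_cases hshort : L.length ≤ k * G.card
  · exact ⟨L, hL, rfl, hshort⟩
  push Not at hshort
  obtain ⟨x, -, hx⟩ : ∃ x ∈ G, k < (L.map Prod.fst).count x := by
    by_contra! hcon
    have h1 : (L.map Prod.fst).toFinset ⊆ G := fun x hx => by
      rw [List.mem_toFinset, List.mem_map] at hx
      obtain ⟨p, hp, rfl⟩ := hx
      exact hL p hp
    have h2 := List.sum_toFinset_count_eq_length (L.map Prod.fst)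
    rw [List.length_map] at h2
    have h3 := (Finset.sum_le_sum_of_subset (f := fun x => (L.map Prod.fst).count x) h1).trans
      (Finset.sum_le_card_nsmul G _ k hcon)
    rw [smul_eq_mul, mul_comm] at h3
    omega
  obtain ⟨pre, e, Y, post, rfl, -⟩ := exists_eq_append_blockList x k L hx
  obtain ⟨e', he', i, hi, hi0⟩ := h.exists_zero hj haj x (fun i => blockProd (Y i)) e
  obtain ⟨s, t, hst⟩ := List.append_of_mem (hi0 ▸ mem_blockList x e' Y hi)
  have hfst := map_fst_blockList x e e' Y k
  have hlen : s.length + t.length + 1 = (blockList x e Y k).length := by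
    have := congrArg List.length hfst
    simp only [List.length_map, hst, List.length_append, List.length_cons] at this
    omega
  have hG : ∀ q ∈ blockList x e' Y k, q.1 ∈ G := fun q hq => by
    have : q.1 ∈ (blockList x e Y k).map Prod.fst := hfst ▸ List.mem_map_of_mem hq
    obtain ⟨q', hq', heq⟩ := List.mem_map.1 this
    exact heq ▸ hL q' (by simp [hq'])
  obtain ⟨L', hL', hval, hlen'⟩ := ih (pre ++ (s ++ t) ++ post).length
    (by simp only [List.length_append]; omega) (pre ++ (s ++ t) ++ post) (by
      intro p hp
      simp only [List.mem_append] at hp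
      rcases hp with (hp | hp | hp) | hp
      · exact hL p (by simp [hp])
      · exact hG p (by simp [hst, hp])
      · exact hG p (by simp [hst, hp])
      · exact hL p (by simp [hp])) rfl
  refine ⟨L', hL', hval.trans ?_, hlen'⟩
  simp only [blockProd_append, blockProd_blockList, ← he']
  rw [← blockProd_blockList, hst, blockProd_append]
  simp [blockProd]

end Blocks

/-- The exponents from the threshold `l` on are decomposed into residue classes modulo `d`:
exponents below the threshold are their own codes. -/
def decodeExp (l d r q : ℕ) : ℕ := if r < l then r else r + q * d

theorem exists_decodeExp {l d : ℕ} (hd : 0 < d) (e : ℕ) :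
    ∃ r < l + d, ∃ q, decodeExp l d r q = e := by
  by_cases h : e < l
  · exact ⟨e, by omega, 0, by simp [decodeExp, h]⟩
  · refine ⟨l + (e - l) % d, by have := Nat.mod_lt (e - l) hd; omega, (e - l) / d, ?_⟩
    have := Nat.mod_add_div (e - l) d
    rw [mul_comm] at this
    simp only [decodeExp, Nat.not_lt.2 (Nat.le_add_right _ _), if_false]
    omega

/-- The value of a word of `K` blocks, given by the letters and residues `p.1` and the quotients
`p.2`. -/
def codeVal {S : Type u} [Monoid S] (l d : ℕ) {K N : ℕ} {G : Set S}
    (p : (Fin K → G × Fin N) × (Fin K → ℕ)) : S :=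
  (List.ofFn fun i => ((p.1 i).1 : S) ^ decodeExp l d (p.1 i).2 (p.2 i)).prod

/-- The order on codes of words: the same letters and residues, and pointwise comparison of the
quotients. -/
def codeLE {K : ℕ} {σ : Type u} (p p' : σ × (Fin K → ℕ)) : Prop := p.1 = p'.1 ∧ p.2 ≤ p'.2

instance {K : ℕ} {σ : Type u} : IsPreorder (σ × (Fin K → ℕ)) codeLE where
  refl _ := ⟨rfl, le_rfl⟩
  trans _ _ _ h h' := ⟨h.1.trans h'.1, h.2.trans h'.2⟩

theorem wellQuasiOrdered_codeLE {K : ℕ} {σ : Type u} [Finite σ] :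
    WellQuasiOrdered (codeLE (K := K) (σ := σ)) :=
  WellQuasiOrdered.prod (Finite.wellQuasiOrdered (Eq : σ → σ → Prop)) wellQuasiOrdered_le

section Order

variable {S : Type u} [Monoid S] [PartialOrder S] [MulRightMono S]

theorem pow_decodeExp_mono {m d : ℕ} (h : ∀ x : S, x ^ m ≤ x ^ (m + d)) (x : S) (r : ℕ)
    {q q' : ℕ} (hq : q ≤ q') : x ^ decodeExp m d r q ≤ x ^ decodeExp m d r q' := by
  unfold decodeExp
  split_ifs with hr
  · exact le_rfl
  · refine monotone_nat_of_le_succ (f := fun q => x ^ (r + q * d)) (fun q => ?_) hq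
    obtain ⟨t, ht⟩ := Nat.exists_eq_add_of_le (show m ≤ r + q * d by omega)
    have : r + (q + 1) * d = (m + d) + t := by rw [Nat.succ_mul]; omega
    simp only [this, ht, pow_add x _ t]
    exact mul_le_mul_left (h x) _

theorem pow_decodeExp_anti {m d : ℕ} (h : ∀ x : S, x ^ (m + d) ≤ x ^ m) (x : S) (r : ℕ)
    {q q' : ℕ} (hq : q ≤ q') : x ^ decodeExp m d r q' ≤ x ^ decodeExp m d r q := by
  unfold decodeExp
  split_ifs with hr
  · exact le_rfl
  · refine antitone_nat_of_succ_le (f := fun q => x ^ (r + q * d)) (fun q => ?_) hq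
    obtain ⟨t, ht⟩ := Nat.exists_eq_add_of_le (show m ≤ r + q * d by omega)
    have : r + (q + 1) * d = (m + d) + t := by rw [Nat.succ_mul]; omega
    simp only [this, ht, pow_add x _ t]
    exact mul_le_mul_left (h x) _

variable [MulLeftMono S]

theorem ofFn_prod_le {K : ℕ} {f g : Fin K → S} (h : ∀ i, f i ≤ g i) :
    (List.ofFn f).prod ≤ (List.ofFn g).prod := by
  rw [List.ofFn_eq_map, List.ofFn_eq_map]
  exact List.prod_le_prod' fun i _ => h i

/-- The pairs of factors and bounds that an element satisfies: `(u, v, b)` with `u * x * v ≤ b`. -/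
def contexts (W D : Set S) (x : S) : Set (S × S × S) :=
  {c | c.1 ∈ W ∧ c.2.1 ∈ W ∧ c.2.2 ∈ D ∧ c.1 * x * c.2.1 ≤ c.2.2}

/-- A finitely generated submonoid has only finitely many sets of contexts if the ordered monoid
satisfies a knotted inequality and a weak commutativity law. -/
theorem finite_image_contexts {m n : ℕ} (hmn : m ≠ n) (hknot : ∀ x : S, x ^ m ≤ x ^ n)
    {k : ℕ} {a : ℕ → ℕ} (hweak : WeaklyCommutative S k a) {j : ℕ} (hj : j ≤ k) (haj : a j = 0)
    {G D : Set S} (hG : G.Finite) (hD : D.Finite) :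
    (contexts (Submonoid.closure G : Set S) D '' (Submonoid.closure G : Set S)).Finite := by
  classical
  set l := min m n with hl
  set d := max m n - l with hd
  set K := k * hG.toFinset.card with hK
  have hdpos : 0 < d := by omega
  let P := (Fin K → (insert 1 G : Set S) × Fin (l + d)) × (Fin K → ℕ)
  let val : P → S := codeVal l d
  have : Finite (insert 1 G : Set S) := hG.insert 1
  have : Finite D := hD
  have hmem : ∀ p : P, val p ∈ Submonoid.closure G := fun p => by
    refine Submonoid.list_prod_mem _ fun x hx => ?_
    obtain ⟨i, rfl⟩ := (List.mem_ofFn' _ _).1 hx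
    refine pow_mem ?_ _
    rcases (p.1 i).1.2 with h | h
    · rw [h]
      exact one_mem _
    · exact Submonoid.subset_closure h
  have hsurj : ∀ x ∈ Submonoid.closure G, ∃ p : P, val p = x := by
    intro x hx
    obtain ⟨L₀, hL₀, rfl⟩ := Submonoid.exists_list_of_mem_closure hx
    obtain ⟨L, hL, hval, hlen⟩ := hweak.exists_short hj haj hG.toFinset (L₀.map fun y => (y, 1))
      (by simpa using hL₀)
    -- Shorter lists are filled up with blocks of value `1`.
    set L₁ := L ++ List.replicate (K - L.length) (1, 0) with hL₁
    have hlen₁ : L₁.length = K := by simp [hL₁]; omega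
    have hL₁mem : ∀ p ∈ L₁, p.1 ∈ insert 1 G := fun p hp => by
      rcases List.mem_append.1 hp with h | h
      · exact Or.inr (by simpa using hL p h)
      · rw [List.eq_of_mem_replicate h]
        exact Or.inl rfl
    choose r hr q hq using exists_decodeExp (l := l) hdpos
    have hget : ∀ i : Fin K, L₁.get (i.cast hlen₁.symm) ∈ L₁ := fun i => List.get_mem _ _
    refine ⟨(fun i => (⟨(L₁.get (i.cast hlen₁.symm)).1, hL₁mem _ (hget i)⟩,
      ⟨r (L₁.get (i.cast hlen₁.symm)).2, hr _⟩), fun i => q (L₁.get (i.cast hlen₁.symm)).2), ?_⟩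
    have : blockProd L₁ = L₀.prod := by
      rw [hL₁, blockProd_append, hval]
      simp [blockProd, Function.comp_def]
    rw [← this]
    simp only [val, codeVal, hq]
    rw [blockProd]
    congr 1
    apply List.ext_get
    · simp [hlen₁]
    · intro i h₁ h₂
      simp
  -- The contexts of a word, in terms of codes.
  let R : P → P × P × D → Prop := fun p c => val c.1 * val p * val c.2.1 ≤ c.2.2
  let s : P × P × D → P × P × D → Prop := fun c c' =>
    codeLE c.1 c'.1 ∧ (codeLE c.2.1 c'.2.1 ∧ c.2.2 = c'.2.2)
  have : Std.Refl s := ⟨fun c => ⟨refl _, refl _, rfl⟩⟩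
  have hs : WellQuasiOrdered s :=
    WellQuasiOrdered.prod wellQuasiOrdered_codeLE
      (WellQuasiOrdered.prod wellQuasiOrdered_codeLE (Finite.wellQuasiOrdered Eq))
  have hfin : (Set.range R).Finite := by
    rcases lt_or_gt_of_ne hmn with hlt | hlt
    · have hval : ∀ p p', codeLE p p' → val p ≤ val p' := by
        rintro ⟨p, q⟩ ⟨_, q'⟩ ⟨rfl, hq⟩
        exact ofFn_prod_le fun i => pow_decodeExp_mono (fun x => by
          convert hknot x using 2 <;> omega) _ _ (hq i)
      -- The complement of the relation is monotone.
      have := finite_range_of_wellQuasiOrdered (R := fun p c => ¬ R p c) wellQuasiOrdered_codeLE hs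
        (fun p p' c c' hp hc hR hR' => hR (by
          refine (mul_le_mul' (mul_le_mul' (hval _ _ hc.1) (hval _ _ hp))
            (hval _ _ hc.2.1)).trans ?_
          rw [hc.2.2]
          exact hR'))
      refine (this.image fun f c => ¬ f c).subset ?_
      rintro _ ⟨p, rfl⟩
      exact ⟨_, ⟨p, rfl⟩, by simp⟩
    · have hval : ∀ p p', codeLE p p' → val p' ≤ val p := by
        rintro ⟨p, q⟩ ⟨_, q'⟩ ⟨rfl, hq⟩
        exact ofFn_prod_le fun i => pow_decodeExp_anti (fun x => by
          convert hknot x using 2 <;> omega) _ _ (hq i)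
      exact finite_range_of_wellQuasiOrdered (R := R) wellQuasiOrdered_codeLE hs
        (fun p p' c c' hp hc hR => by
          refine (mul_le_mul' (mul_le_mul' (hval _ _ hc.1) (hval _ _ hp))
            (hval _ _ hc.2.1)).trans ?_
          rw [← hc.2.2]
          exact hR)
  refine (hfin.image fun f => {c : S × S × S | ∃ pu pv b, val pu = c.1 ∧ val pv = c.2.1 ∧
    (b : D) = c.2.2 ∧ f (pu, pv, b)}).subset ?_
  rintro _ ⟨x, hx, rfl⟩
  obtain ⟨p, rfl⟩ := hsurj x hx
  refine ⟨_, ⟨p, rfl⟩, ?_⟩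
  ext ⟨u, v, b⟩
  constructor
  · rintro ⟨pu, pv, b, rfl, rfl, rfl, h⟩
    exact ⟨hmem _, hmem _, b.2, h⟩
  · rintro ⟨hu, hv, hb, h⟩
    obtain ⟨pu, rfl⟩ := hsurj u hu
    obtain ⟨pv, rfl⟩ := hsurj v hv
    exact ⟨pu, pv, ⟨b, hb⟩, rfl, rfl, rfl, h⟩

end Order

/-! ### Idempotent semirings -/

/-- The value of a term over `{∨, ·, 1}` in a semiring, with addition as the join. The operations
that a semiring lacks are given the value `0`. -/
def Term.semiEval {S : Type u} [Semiring S] (v : ℕ → S) : Term → S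
  | var i => v i
  | one => 1
  | mul s t => semiEval v s * semiEval v t
  | sup s t => semiEval v s + semiEval v t
  | inf _ _ => 0
  | ldiv _ _ => 0
  | rdiv _ _ => 0

/-- The equation holds in a semiring. -/
def Equation.SemiHolds (e : Equation) (S : Type u) [Semiring S] : Prop :=
  ∀ v : ℕ → S, e.lhs.semiEval v = e.rhs.semiEval v

section Semiring

variable {S : Type u} [Semiring S] {T : Type w} [Semiring T]

theorem map_semiEval (f : S →+* T) (v : ℕ → S) (t : Term) :
    f (t.semiEval v) = t.semiEval (f ∘ v) := by
  induction t <;> simp_all [Term.semiEval]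

theorem Equation.SemiHolds.of_injective {e : Equation} (h : e.SemiHolds T) (f : S →+* T)
    (hf : Function.Injective f) : e.SemiHolds S := fun v => hf (by
  rw [map_semiEval, map_semiEval, h])

theorem Equation.SemiHolds.of_surjective {e : Equation} (h : e.SemiHolds S) (f : S →+* T)
    (hf : Function.Surjective f) : e.SemiHolds T := fun v => by
  choose g hg using hf
  have hv : v = f ∘ fun i => g (v i) := funext fun i => (hg (v i)).symm
  rw [hv, ← map_semiEval, ← map_semiEval, h]

theorem semiEval_pow (v : ℕ → S) (t : Term) (n : ℕ) :
    (t.pow n).semiEval v = t.semiEval v ^ n := by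
  induction n with
  | zero => simp [Term.pow, Term.semiEval]
  | succ n ih => rw [Term.pow, Term.semiEval, ih, pow_succ]

theorem semiEval_interleave (v : ℕ → S) (a : ℕ → ℕ) (k : ℕ) :
    (Term.interleave a k).semiEval v = interProd (v 0) a v k := by
  induction k with
  | zero => rw [Term.interleave, semiEval_pow]; rfl
  | succ k ih => rw [Term.interleave, Term.semiEval, Term.semiEval, ih, semiEval_pow]; rfl

theorem weaklyCommutative_of_semiHolds {k : ℕ} {a : ℕ → ℕ}
    (h : (Equation.weakComm k a).SemiHolds S) : WeaklyCommutative S k a := fun x Y => by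
  have := h fun i => if i = 0 then x else Y i
  simp only [Equation.weakComm, semiEval_interleave, if_true] at this
  have hcongr : ∀ e : ℕ → ℕ, ∀ k, interProd x e (fun i => if i = 0 then x else Y i) k =
      interProd x e Y k := by
    intro e k
    induction k with
    | zero => rfl
    | succ k ih => simp [interProd, ih]
  rwa [hcongr, hcongr] at this

end Semiring

theorem pow_le_pow_of_semiHolds {S : Type u} [IdemSemiring S] {m n : ℕ}
    (h : (Equation.knotted m n).SemiHolds S) (x : S) : x ^ m ≤ x ^ n := by
  have := h fun _ => x
  simp only [Equation.knotted, Term.semiEval, semiEval_pow] at this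
  exact add_eq_right_iff_le.1 this

theorem isJoinMonoid_pow {t : Term} (ht : t.IsJoinMonoid) (n : ℕ) : (t.pow n).IsJoinMonoid := by
  induction n with
  | zero => trivial
  | succ n ih => exact ⟨ih, ht⟩

theorem isJoinMonoid_knotted (m n : ℕ) : (Equation.knotted m n).IsJoinMonoid :=
  ⟨⟨isJoinMonoid_pow (t := .var 0) trivial m, isJoinMonoid_pow (t := .var 0) trivial n⟩,
    isJoinMonoid_pow (t := .var 0) trivial n⟩

theorem isJoinMonoid_weakComm (k : ℕ) (a : ℕ → ℕ) : (Equation.weakComm k a).IsJoinMonoid := by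
  have : ∀ a : ℕ → ℕ, ∀ k, (Term.interleave a k).IsJoinMonoid := by
    intro a k
    induction k with
    | zero => exact isJoinMonoid_pow (t := .var 0) trivial _
    | succ k ih => exact ⟨⟨ih, trivial⟩, isJoinMonoid_pow (t := .var 0) trivial _⟩
  exact ⟨this _ k, this _ k⟩

section FiniteResiduatedLattice

variable (C : Type u) [IdemSemiring C] [Finite C]

/-- The join of all the elements with a given property, in a finite idempotent semiring. -/
noncomputable def joinOf {C : Type u} [IdemSemiring C] [Finite C] (p : C → Prop) : C :=
  (Set.toFinite {x | p x}).toFinset.sup id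

variable {C}

theorem le_joinOf {p : C → Prop} {x : C} (hx : p x) : x ≤ joinOf p :=
  Finset.le_sup (f := id) ((Set.Finite.mem_toFinset _).2 hx)

/-- A property that passes from the elements with the property `p` to their joins holds for
`joinOf p`. The join over no elements is `0`. -/
theorem joinOf_induction {p q : C → Prop} (h : ∀ x, p x → q x) (h0 : q 0)
    (hadd : ∀ x y, q x → q y → q (x + y)) : q (joinOf p) := by
  refine Finset.sup_induction ?_ ?_ ?_
  · rwa [← bot_eq_zero] at h0
  · intro x hx y hy
    rw [← add_eq_sup]
    exact hadd x y hx hy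
  · intro x hx
    exact h x ((Set.Finite.mem_toFinset _).1 hx)

variable (C)

/-- A finite idempotent semiring is a residuated lattice with addition as the join: the
multiplication preserves all joins, the empty one included. -/
@[reducible]
noncomputable def finiteResiduatedLattice : ResiduatedLattice C :=
  { (inferInstance : SemilatticeSup C), (inferInstance : Monoid C) with
    inf := fun x y => joinOf fun z => z ≤ x ∧ z ≤ y
    inf_le_left := fun x y => joinOf_induction (q := (· ≤ x)) (fun z hz => hz.1) zero_le
      fun _ _ => add_le
    inf_le_right := fun x y => joinOf_induction (q := (· ≤ y)) (fun z hz => hz.2) zero_le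
      fun _ _ => add_le
    le_inf := fun x y z hxy hxz => le_joinOf ⟨hxy, hxz⟩
    ldiv := fun x z => joinOf fun y => x * y ≤ z
    rdiv := fun z y => joinOf fun x => x * y ≤ z
    mul_le_iff_le_ldiv := fun x y z => ⟨fun h => le_joinOf h, fun h =>
      (mul_le_mul_right h x).trans (joinOf_induction (q := fun y => x * y ≤ z) (fun _ => id)
        (by rw [mul_zero]; exact zero_le)
        fun y y' hy hy' => by rw [mul_add]; exact add_le hy hy')⟩
    mul_le_iff_le_rdiv := fun x y z => ⟨fun h => le_joinOf h, fun h =>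
      (mul_le_mul_left h y).trans (joinOf_induction (q := fun x => x * y ≤ z) (fun _ => id)
        (by rw [zero_mul]; exact zero_le)
        fun y y' hy hy' => by rw [add_mul]; exact add_le hy hy')⟩ }

variable {C}

theorem holds_finiteResiduatedLattice {e : Equation} (he : e.IsJoinMonoid) (h : e.SemiHolds C) :
    @Equation.Holds e C (finiteResiduatedLattice C) := by
  intro v
  have key : ∀ t : Term, t.IsJoinMonoid →
      @Term.eval C (finiteResiduatedLattice C) v t = t.semiEval v := by
    intro t
    induction t with
    | var i => exact fun _ => rfl
    | one => exact fun _ => rfl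
    | mul s t hs ht => exact fun h => congrArg₂ (· * ·) (hs h.1) (ht h.2)
    | sup s t hs ht =>
      exact fun h => (congrArg₂ (· ⊔ ·) (hs h.1) (ht h.2)).trans (add_eq_sup _ _).symm
    | inf s t hs ht => exact fun h => h.elim
    | ldiv s t hs ht => exact fun h => h.elim
    | rdiv s t hs ht => exact fun h => h.elim
  rw [key _ he.1, key _ he.2, h]

end FiniteResiduatedLattice

section Syntactic

variable {S : Type u} [IdemSemiring S]

/-- The syntactic congruence of the bounds in `G`, on the semiring generated by `G`: elements are
identified if they have the same contexts. -/
def syntacticCon (G : Set S) : RingCon (Subsemiring.closure G) where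
  r x y := ∀ u v : Subsemiring.closure G, ∀ b ∈ G,
    (u : S) * x * v ≤ b ↔ (u : S) * y * v ≤ b
  iseqv := ⟨fun _ _ _ _ _ => Iff.rfl, fun h u v b hb => (h u v b hb).symm,
    fun h h' u v b hb => (h u v b hb).trans (h' u v b hb)⟩
  add' := by
    intro x x' y y' h h' u v b hb
    simp only [Subsemiring.coe_add, mul_add, add_mul, add_le_iff, h u v b hb, h' u v b hb]
  mul' := by
    intro x x' y y' h h' u v b hb
    have h₁ := h u (y * v) b hb
    have h₂ := h' (u * x') v b hb
    simp only [Subsemiring.coe_mul, mul_assoc] at h₁ h₂ ⊢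
    exact h₁.trans h₂

/-- The quotient by the syntactic congruence is an idempotent semiring. -/
@[reducible]
def syntacticSemiring (G : Set S) : IdemSemiring (syntacticCon G).Quotient :=
  IdemSemiring.ofSemiring fun q => by
    induction q using Quotient.inductionOn' with
    | h x =>
      exact congrArg (fun y => ((y : Subsemiring.closure G) : (syntacticCon G).Quotient))
        (Subtype.ext (add_idem (x : S)))

theorem syntactic_le_iff (G : Set S) (x y : Subsemiring.closure G) :
    (syntacticSemiring G).le (x : (syntacticCon G).Quotient) y ↔
      ∀ u v : Subsemiring.closure G, ∀ b ∈ G, (u : S) * y * v ≤ b → (u : S) * x * v ≤ b := by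
  refine (RingCon.eq (syntacticCon G) (a := x + y) (b := y)).trans ?_
  refine forall_congr' fun u => forall_congr' fun v => forall_congr' fun b =>
    forall_congr' fun hb => ?_
  simp only [Subsemiring.coe_add, mul_add, add_mul, add_le_iff]
  tauto

/-- Contexts from the generated monoid determine those from the generated semiring, and the set
of contexts of a sum is the intersection of those of its summands. -/
theorem finite_syntactic_quotient {G : Set S}
    (h : (contexts (Submonoid.closure G : Set S) G '' (Submonoid.closure G : Set S)).Finite) :
    Finite (syntacticCon G).Quotient := by
  set W := Submonoid.closure G with hW
  set 𝒯 := contexts (W : Set S) G '' (W : Set S) with h𝒯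
  let base : Set (S × S × S) := {c | c.1 ∈ W ∧ c.2.1 ∈ W ∧ c.2.2 ∈ G}
  have hcl : ∀ x ∈ Subsemiring.closure G, ∃ Z ⊆ 𝒯, contexts (W : Set S) G x = base ∩ ⋂₀ Z := by
    intro x hx
    rw [Subsemiring.mem_closure_iff] at hx
    induction hx using AddSubmonoid.closure_induction with
    | mem x hx =>
      refine ⟨{contexts (W : Set S) G x}, by
        rw [Set.singleton_subset_iff]
        exact ⟨x, hx, rfl⟩, ?_⟩
      have hsub : contexts (W : Set S) G x ⊆ base := fun c hc => ⟨hc.1, hc.2.1, hc.2.2.1⟩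
      rw [Set.sInter_singleton, Set.inter_eq_right.2 hsub]
    | zero =>
      refine ⟨∅, Set.empty_subset _, ?_⟩
      ext c
      simp [contexts, base]
    | add x y _ _ hx hy =>
      obtain ⟨Z, hZ, hxZ⟩ := hx
      obtain ⟨Z', hZ', hyZ⟩ := hy
      refine ⟨Z ∪ Z', Set.union_subset hZ hZ', ?_⟩
      rw [Set.sInter_union, Set.inter_inter_distrib_left, ← hxZ, ← hyZ]
      ext c
      simp only [contexts, Set.mem_ofPred_eq, Set.mem_inter_iff, mul_add, add_mul, add_le_iff]
      tauto
  have hfin : (Set.range fun x : Subsemiring.closure G => contexts (W : Set S) G x).Finite := by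
    refine (h.powerset.image fun Z => base ∩ ⋂₀ Z).subset ?_
    rintro _ ⟨x, rfl⟩
    obtain ⟨Z, hZ, hxZ⟩ := hcl x x.2
    exact ⟨Z, hZ, hxZ.symm⟩
  have hle : ∀ x y : S, contexts (W : Set S) G x ⊆ contexts (W : Set S) G y →
      ∀ u ∈ Subsemiring.closure G, ∀ v ∈ Subsemiring.closure G, ∀ b ∈ G, u * x * v ≤ b →
        u * y * v ≤ b := by
    intro x y hxy u hu v hv b hb
    rw [Subsemiring.mem_closure_iff] at hu hv
    induction hu using AddSubmonoid.closure_induction with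
    | mem u hu =>
      induction hv using AddSubmonoid.closure_induction with
      | mem v hv =>
        intro h
        have hmem : (u, v, b) ∈ contexts (W : Set S) G x := ⟨hu, hv, hb, h⟩
        exact (hxy hmem).2.2.2
      | zero => simp
      | add v v' _ _ hv hv' =>
        simp only [mul_add, add_le_iff]
        exact fun h => ⟨hv h.1, hv' h.2⟩
    | zero => simp
    | add u u' _ _ hu hu' =>
      simp only [add_mul, add_le_iff]
      exact fun h => ⟨hu h.1, hu' h.2⟩
  have := hfin.to_subtype
  refine Finite.of_surjective (fun f : Set.range
    (fun x : Subsemiring.closure G => contexts (W : Set S) G x) =>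
      ((f.2.choose : Subsemiring.closure G) : (syntacticCon G).Quotient)) fun q => ?_
  induction q using Quotient.inductionOn' with
  | h x =>
    refine ⟨⟨_, x, rfl⟩, ?_⟩
    refine (RingCon.eq (syntacticCon G)).2 fun u v b hb => ?_
    have hspec := (show contexts (W : Set S) G x ∈ Set.range
      (fun x : Subsemiring.closure G => contexts (W : Set S) G x) from ⟨x, rfl⟩).choose_spec
    exact ⟨hle _ _ hspec.subset u u.2 v v.2 b hb, hle _ _ hspec.superset u u.2 v v.2 b hb⟩

end Syntactic

/-! ### Adjoining a zero -/

/-- `j` embeds `A` as a `{∨, ·, 1}`-algebra into the idempotent semiring `S`, where `0` is the least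
element of `A`, if there is one, and the only element outside the range of `j` otherwise. -/
structure IsZeroExtension (A : Type u) [ResiduatedLattice A] (S : Type u) [IdemSemiring S]
    (j : A → S) : Prop where
  map_one : j 1 = 1
  map_mul : ∀ x y, j (x * y) = j x * j y
  map_sup : ∀ x y, j (x ⊔ y) = j x + j y
  injective : Function.Injective j
  eq_zero_of_isBot : ∀ o, (∀ x, o ≤ x) → j o = 0
  eq_zero_or : ∀ s, s = 0 ∨ ∃ x, s = j x

theorem IsZeroExtension.le_iff {A : Type u} [ResiduatedLattice A] {S : Type u} [IdemSemiring S]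
    {j : A → S} (hj : IsZeroExtension A S j) (x y : A) : j x ≤ j y ↔ x ≤ y := by
  rw [← add_eq_right_iff_le, ← hj.map_sup, hj.injective.eq_iff, sup_eq_right]

/-- A residuated lattice with a least element is itself a semiring with `0`. -/
theorem exists_zeroExtension_of_isBot {A : Type u} [ResiduatedLattice A] {o : A}
    (ho : ∀ x, o ≤ x) : ∃ (S : Type u) (_ : IdemSemiring S) (j : A → S), IsZeroExtension A S j ∧
      ∀ e : Equation, e.IsJoinMonoid → e.Holds A → e.SemiHolds S := by
  let _ : Zero A := ⟨o⟩
  let _ : Add A := ⟨fun x y => x ⊔ y⟩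
  let i : Semiring A :=
    { (inferInstance : Monoid A) with
      add_assoc := sup_assoc
      zero_add := fun x => sup_eq_right.2 (ho x)
      add_zero := fun x => sup_eq_left.2 (ho x)
      add_comm := sup_comm
      nsmul := nsmulRec
      left_distrib := mul_sup_distrib
      right_distrib := sup_mul_distrib
      zero_mul := fun x => le_antisymm ((mul_le_iff_le_rdiv _ _ _).2 (ho _)) (ho _)
      mul_zero := fun x => le_antisymm ((mul_le_iff_le_ldiv _ _ _).2 (ho _)) (ho _) }
  let i' : IdemSemiring A := @IdemSemiring.ofSemiring A i fun x => sup_idem x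
  refine ⟨A, i', id,
    ⟨rfl, fun _ _ => rfl, fun _ _ => rfl, Function.injective_id,
      fun o' ho' => le_antisymm (ho' o) (ho o'), fun s => Or.inr ⟨s, rfl⟩⟩, ?_⟩
  intro e he h v
  have key : ∀ t : Term, t.IsJoinMonoid → @Term.semiEval A i v t = t.eval v := by
    intro t
    induction t with
    | var i => exact fun _ => rfl
    | one => exact fun _ => rfl
    | mul s t hs ht => exact fun h => congrArg₂ (· * ·) (hs h.1) (ht h.2)
    | sup s t hs ht => exact fun h => congrArg₂ (· ⊔ ·) (hs h.1) (ht h.2)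
    | inf s t hs ht => exact fun h => h.elim
    | ldiv s t hs ht => exact fun h => h.elim
    | rdiv s t hs ht => exact fun h => h.elim
  exact (key _ he.1).trans ((h v).trans (key _ he.2).symm)

/-- The elements of `A` and a new zero. -/
inductive WithNewZero (A : Type u) : Type u
  | zero : WithNewZero A
  | of : A → WithNewZero A

namespace WithNewZero

variable {A : Type u} [ResiduatedLattice A]

/-- The join, with the new zero as the least element. -/
def add : WithNewZero A → WithNewZero A → WithNewZero A
  | zero, y => y
  | of x, zero => of x
  | of x, of y => of (x ⊔ y)

/-- The product, with the new zero as an absorbing element. -/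
def mul : WithNewZero A → WithNewZero A → WithNewZero A
  | of x, of y => of (x * y)
  | of _, zero => zero
  | zero, _ => zero

instance : Zero (WithNewZero A) := ⟨zero⟩

instance : Add (WithNewZero A) := ⟨add⟩

instance : Semiring (WithNewZero A) where
  add_assoc := by
    rintro (_ | x) (_ | y) (_ | z) <;> first | rfl | exact congrArg of (sup_assoc x y z)
  zero_add := fun x => rfl
  add_zero := by rintro (_ | x) <;> rfl
  add_comm := by
    rintro (_ | x) (_ | y) <;> first | rfl | exact congrArg of (sup_comm x y)
  nsmul := nsmulRec
  mul := mul
  left_distrib := by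
    rintro (_ | x) (_ | y) (_ | z) <;> first | rfl | exact congrArg of (mul_sup_distrib x y z)
  right_distrib := by
    rintro (_ | x) (_ | y) (_ | z) <;> first | rfl | exact congrArg of (sup_mul_distrib x y z)
  zero_mul := fun x => rfl
  mul_zero := by rintro (_ | x) <;> rfl
  mul_assoc := by
    rintro (_ | x) (_ | y) (_ | z) <;> first | rfl | exact congrArg of (mul_assoc x y z)
  one := of 1
  one_mul := by rintro (_ | x) <;> first | rfl | exact congrArg of (one_mul x)
  mul_one := by rintro (_ | x) <;> first | rfl | exact congrArg of (mul_one x)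

instance : IdemSemiring (WithNewZero A) :=
  IdemSemiring.ofSemiring (by rintro (_ | x) <;> first | rfl | exact congrArg of (sup_idem x))

open Filter

/-- A function on `A` tends to an element of `A` with a new zero, for small arguments: it is
eventually equal to an element of `A`, or falls below every element of `A`. -/
def Tends (f : A → A) : WithNewZero A → Prop
  | zero => ∀ d, ∀ᶠ c in atBot, f c ≤ d
  | of x => ∀ᶠ c in atBot, f c = x

theorem Tends.sup {f g : A → A} {x y : WithNewZero A} (hf : Tends f x) (hg : Tends g y) :
    Tends (fun c => f c ⊔ g c) (x + y) := by
  rcases x with _ | x <;> rcases y with _ | y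
  · intro d
    filter_upwards [hf d, hg d] with c h h' using sup_le h h'
  · change ∀ᶠ c in atBot, f c ⊔ g c = y
    filter_upwards [hf y, hg] with c h h'
    rw [h', sup_eq_right.2 h]
  · change ∀ᶠ c in atBot, f c ⊔ g c = x
    filter_upwards [hf, hg x] with c h h'
    rw [h, sup_eq_left.2 h']
  · change ∀ᶠ c in atBot, f c ⊔ g c = x ⊔ y
    filter_upwards [hf, hg] with c h h'
    rw [h, h']

theorem Tends.mul {f g : A → A} {x y : WithNewZero A} (hf : Tends f x) (hg : Tends g y) :
    Tends (fun c => f c * g c) (x * y) := by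
  rcases x with _ | x <;> rcases y with _ | y
  · intro d
    filter_upwards [hf d, hg 1] with c h h'
    exact (mul_le_mul_of_le h h').trans (mul_one d).le
  · intro d
    filter_upwards [hf (rdiv d y), hg] with c h h'
    rw [h']
    exact (mul_le_iff_le_rdiv _ _ _).2 h
  · intro d
    filter_upwards [hf, hg (ldiv x d)] with c h h'
    rw [h]
    exact (mul_le_iff_le_ldiv _ _ _).2 h'
  · change ∀ᶠ c in atBot, f c * g c = x * y
    filter_upwards [hf, hg] with c h h'
    rw [h, h']

theorem Tends.unique (hbot : ∀ o : A, ∃ x, ¬ o ≤ x) {f : A → A} {x y : WithNewZero A}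
    (hx : Tends f x) (hy : Tends f y) : x = y := by
  have : Nonempty A := ⟨1⟩
  rcases x with _ | x <;> rcases y with _ | y
  · rfl
  · obtain ⟨d, hd⟩ := hbot y
    obtain ⟨c, h, h'⟩ := ((hx d).and hy).exists
    exact (hd (h' ▸ h)).elim
  · obtain ⟨d, hd⟩ := hbot x
    obtain ⟨c, h, h'⟩ := (hx.and (hy d)).exists
    exact (hd (h ▸ h')).elim
  · obtain ⟨c, h, h'⟩ := (Eventually.and hx hy).exists
    rw [← h, ← h']

/-- Without a least element in `A`, the values of a term over `{∨, ·, 1}` at assignments with the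
new zero are the limits of its values in `A`, where the new zero is replaced by small elements. -/
theorem semiHolds (hbot : ∀ o : A, ∃ x, ¬ o ≤ x) {e : Equation} (he : e.IsJoinMonoid)
    (h : e.Holds A) : e.SemiHolds (WithNewZero A) := by
  intro v
  let v' : A → ℕ → A := fun c i =>
    match v i with
    | zero => c
    | of x => x
  have key : ∀ t : Term, t.IsJoinMonoid → Tends (fun c => t.eval (v' c)) (t.semiEval v) := by
    intro t
    induction t with
    | var i =>
      intro _
      simp only [Term.eval, Term.semiEval, v']
      cases v i with
      | zero => exact fun d => eventually_le_atBot d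
      | of x => exact Eventually.of_forall fun c => rfl
    | one => exact fun _ => Eventually.of_forall fun c => rfl
    | mul s t hs ht => exact fun h => (hs h.1).mul (ht h.2)
    | sup s t hs ht => exact fun h => (hs h.1).sup (ht h.2)
    | inf s t hs ht => exact fun h => h.elim
    | ldiv s t hs ht => exact fun h => h.elim
    | rdiv s t hs ht => exact fun h => h.elim
  refine Tends.unique hbot (key _ he.1) ?_
  simp only [h _]
  exact key _ he.2

end WithNewZero

theorem exists_zeroExtension (A : Type u) [ResiduatedLattice A] :
    ∃ (S : Type u) (_ : IdemSemiring S) (j : A → S), IsZeroExtension A S j ∧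
      ∀ e : Equation, e.IsJoinMonoid → e.Holds A → e.SemiHolds S := by
  by_cases h : ∃ o : A, ∀ x, o ≤ x
  · obtain ⟨o, ho⟩ := h
    exact exists_zeroExtension_of_isBot ho
  · push Not at h
    exact ⟨WithNewZero A, inferInstance, .of, ⟨rfl, fun _ _ => rfl, fun _ _ => rfl,
      fun x y h => WithNewZero.of.inj h,
      fun o ho => (h o).elim fun x hx => (hx (ho x)).elim,
      by rintro (_ | x); exacts [Or.inl rfl, Or.inr ⟨x, rfl⟩]⟩,
      fun e he => WithNewZero.semiHolds h he⟩

/-! ### The finite embeddability property -/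

/-- Incomparable elements of a zero extension of a unilinear residuated lattice have the greatest
element as their join and `0` as their only common lower bound. -/
theorem IsZeroExtension.unilinear {A : Type u} [ResiduatedLattice A] (hA : IsUnilinear A)
    {S : Type u} [IdemSemiring S] {j : A → S} (hj : IsZeroExtension A S j) (x y : S) :
    x ≤ y ∨ y ≤ x ∨ ((∀ z, z ≤ x + y) ∧ ∀ z, z ≤ x → z ≤ y → z = 0) := by
  rcases hj.eq_zero_or x with rfl | ⟨x, rfl⟩
  · exact Or.inl zero_le
  rcases hj.eq_zero_or y with rfl | ⟨y, rfl⟩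
  · exact Or.inr (Or.inl zero_le)
  simp only [hj.le_iff]
  by_cases h₁ : x ≤ y
  · exact Or.inl h₁
  by_cases h₂ : y ≤ x
  · exact Or.inr (Or.inl h₂)
  have h : ∀ z w, x ⊓ y ≤ w ∧ z ≤ x ⊔ y := fun z w =>
    ((hA x y z w).resolve_left h₁).resolve_left h₂
  refine Or.inr (Or.inr ⟨fun z => ?_, fun z hzx hzy => ?_⟩)
  · rcases hj.eq_zero_or z with rfl | ⟨z, rfl⟩
    · exact zero_le
    · rw [← hj.map_sup, hj.le_iff]
      exact (h z z).2
  · rcases hj.eq_zero_or z with rfl | ⟨z, rfl⟩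
    · rfl
    rw [hj.le_iff] at hzx hzy
    exact hj.eq_zero_of_isBot z fun w => (le_inf hzx hzy).trans (h z w).1

/-- Unilinearity is inherited by the syntactic quotient: if the representatives of two classes are
incomparable then their join is the greatest element, and a common lower bound of the classes has a
representative that is a lower bound of the representatives, unless the classes are comparable. -/
theorem isUnilinear_syntactic {S : Type u} [IdemSemiring S]
    (hS : ∀ x y : S, x ≤ y ∨ y ≤ x ∨ ((∀ z, z ≤ x + y) ∧ ∀ z, z ≤ x → z ≤ y → z = 0)) (G : Set S)
    [Finite (syntacticCon G).Quotient] :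
    @IsUnilinear _ (@finiteResiduatedLattice _ (syntacticSemiring G) _) := by
  let _ := syntacticSemiring G
  let _ := finiteResiduatedLattice (syntacticCon G).Quotient
  let q : Subsemiring.closure G → (syntacticCon G).Quotient := fun x => x
  have hq : Function.Surjective q := Quotient.mk''_surjective
  have hadd : ∀ x y, q x ⊔ q y = q (x + y) := fun x y => rfl
  have hmono : ∀ x y : Subsemiring.closure G, (x : S) ≤ y → q x ≤ q y := fun x y h =>
    (syntactic_le_iff G x y).2 fun u v b _ hb =>
      (mul_le_mul' (mul_le_mul' le_rfl h) le_rfl).trans hb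
  -- A class that lies above one with an incomparable representative lies above all classes.
  have htop : ∀ x z y : Subsemiring.closure G, q z ≤ q x → (z : S) ≤ x ∨ (x : S) ≤ z ∨
      q y ≤ q x := by
    intro x z y hzx
    rcases hS z x with h | h | h
    · exact Or.inl h
    · exact Or.inr (Or.inl h)
    · refine Or.inr (Or.inr ((hmono y (z + x) (h.1 y)).trans ?_))
      rw [← hadd]
      exact sup_le hzx le_rfl
  refine hq.forall₂.2 fun x y => hq.forall₂.2 fun t w => ?_
  rcases hS x y with h | h | ⟨hj, hm⟩
  · exact Or.inl (hmono _ _ h)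
  · exact Or.inr (Or.inl (hmono _ _ h))
  obtain ⟨z, hz⟩ := hq (q x ⊓ q y)
  have hzx : q z ≤ q x := hz.trans_le inf_le_left
  have hzy : q z ≤ q y := hz.trans_le inf_le_right
  rcases htop x z y hzx with h₁ | h₁ | h₁
  · rcases htop y z x hzy with h₂ | h₂ | h₂
    · refine Or.inr (Or.inr ⟨?_, ?_⟩)
      · rw [← hz]
        refine hmono z w ?_
        rw [hm z h₁ h₂]
        exact zero_le
      · rw [hadd]
        exact hmono _ _ (hj _)
    · exact Or.inr (Or.inl ((hmono _ _ h₂).trans hzx))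
    · exact Or.inl h₂
  · exact Or.inl ((hmono _ _ h₁).trans hzy)
  · exact Or.inr (Or.inl h₁)

/-- The map to the syntactic quotient is a partial embedding, since the class of a semiring element
`z` lies below the class of a generator `b` only if `z ≤ b`. -/
theorem IsZeroExtension.exists_isPartialEmbedding {A : Type u} [ResiduatedLattice A] {S : Type u}
    [IdemSemiring S] {j : A → S} (hj : IsZeroExtension A S j) (B : Set A)
    [Finite (syntacticCon (j '' B)).Quotient] :
    ∃ h : A → (syntacticCon (j '' B)).Quotient, @IsPartialEmbedding _ _ _
      (@finiteResiduatedLattice _ (syntacticSemiring (j '' B)) _) B h := by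
  classical
  set G := j '' B with hG
  let _ := syntacticSemiring G
  let _ := finiteResiduatedLattice (syntacticCon G).Quotient
  let q : Subsemiring.closure G → (syntacticCon G).Quotient := fun x => x
  have hq : Function.Surjective q := Quotient.mk''_surjective
  have hmem : ∀ x ∈ B, j x ∈ Subsemiring.closure G := fun x hx =>
    Subsemiring.subset_closure ⟨x, hx, rfl⟩
  let h : A → (syntacticCon G).Quotient := fun x => if hx : x ∈ B then q ⟨j x, hmem x hx⟩ else 0
  have hB : ∀ x (hx : x ∈ B), h x = q ⟨j x, hmem x hx⟩ := fun x hx => dif_pos hx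
  have hle : ∀ (z : Subsemiring.closure G) (x : A), x ∈ B → (q z ≤ h x ↔ (z : S) ≤ j x) := by
    intro z x hx
    rw [hB x hx]
    refine (syntactic_le_iff G z ⟨j x, hmem x hx⟩).trans ⟨fun H => ?_, fun H u v b _ hb =>
      (mul_le_mul' (mul_le_mul' le_rfl H) le_rfl).trans hb⟩
    have := H 1 1 (j x) ⟨x, hx, rfl⟩
    simpa using this
  have hle' : ∀ x ∈ B, ∀ y ∈ B, (h x ≤ h y ↔ x ≤ y) := fun x hx y hy => by
    rw [hB x hx, hle _ y hy, hj.le_iff]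
  have hmul : ∀ x y, q x * q y = q (x * y) := fun x y => rfl
  refine ⟨h, ⟨fun x hx y hy hxy => ?_, fun hx => ?_, fun x hx y hy hxy => ?_,
    fun x hx y hy hxy => ?_, fun x hx y hy hxy => ?_, fun x hx y hy hxy => ?_,
    fun x hx y hy hxy => ?_⟩⟩
  · exact le_antisymm ((hle' x hx y hy).1 hxy.le) ((hle' y hy x hx).1 hxy.ge)
  · rw [hB 1 hx]
    exact congrArg q (Subtype.ext hj.map_one)
  · rw [hB _ hxy, hB x hx, hB y hy]
    exact congrArg q (Subtype.ext (hj.map_mul x y))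
  · rw [hB _ hxy, hB x hx, hB y hy]
    exact congrArg q (Subtype.ext (hj.map_sup x y))
  · refine eq_of_forall_le_iff (hq.forall.2 fun z => ?_)
    rw [le_inf_iff, hle z x hx, hle z y hy, hle z _ hxy]
    rcases hj.eq_zero_or z with hz | ⟨z', hz⟩
    · simp [hz]
    · simp [hz, hj.le_iff]
  · refine eq_of_forall_le_iff (hq.forall.2 fun z => ?_)
    rw [← mul_le_iff_le_ldiv, hB x hx, hmul, hle _ y hy, hle z _ hxy, Subsemiring.coe_mul]
    rcases hj.eq_zero_or z with hz | ⟨z', hz⟩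
    · simp [hz]
    · rw [hz, ← hj.map_mul, hj.le_iff, hj.le_iff, mul_le_iff_le_ldiv]
  · refine eq_of_forall_le_iff (hq.forall.2 fun z => ?_)
    rw [← mul_le_iff_le_rdiv, hB y hy, hmul, hle _ x hx, hle z _ hxy, Subsemiring.coe_mul]
    rcases hj.eq_zero_or z with hz | ⟨z', hz⟩
    · simp [hz]
    · rw [hz, ← hj.map_mul, hj.le_iff, hj.le_iff, mul_le_iff_le_rdiv]

/-- The finite embeddability property of the class of unilinear members of the variety. -/
def UnilinearFEP (E : Set Equation) : Prop :=
  ∀ (A : Type u) [ResiduatedLattice A], IsUnilinear A → (∀ e ∈ E, e.Holds A) →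
    ∀ B : Set A, B.Finite → ∃ (C : Type u) (_ : ResiduatedLattice C), Finite C ∧ IsUnilinear C ∧
      (∀ e ∈ E, e.Holds C) ∧ ∃ h : A → C, IsPartialEmbedding B h

/-- The syntactic quotient of the subsemiring generated by a finite subset of a zero extension is
the required finite algebra. -/
theorem unilinearFEP {m n : ℕ} (hmn : m ≠ n) {k : ℕ} {a : ℕ → ℕ} {j : ℕ} (hj : j ≤ k)
    (haj : a j = 0) {E : Set Equation} (hE : ∀ e ∈ E, e.IsJoinMonoid)
    (hknot : Equation.knotted m n ∈ E) (hweak : Equation.weakComm k a ∈ E) :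
    UnilinearFEP.{u} E := by
  intro A _ hA hAE B hB
  obtain ⟨S, _, f, hf, hS⟩ := exists_zeroExtension A
  have hSE : ∀ e ∈ E, e.SemiHolds S := fun e he => hS e (hE e he) (hAE e he)
  have hfin : Finite (syntacticCon (f '' B)).Quotient := finite_syntactic_quotient
    (finite_image_contexts hmn (pow_le_pow_of_semiHolds (hSE _ hknot))
      (weaklyCommutative_of_semiHolds (hSE _ hweak)) hj haj (hB.image f) (hB.image f))
  let _ := syntacticSemiring (f '' B)
  refine ⟨(syntacticCon (f '' B)).Quotient, finiteResiduatedLattice _, hfin,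
    isUnilinear_syntactic (hf.unilinear hA) _, fun e he => ?_, hf.exists_isPartialEmbedding B⟩
  refine holds_finiteResiduatedLattice (hE e he) ?_
  exact ((hSE e he).of_injective (Subsemiring.closure (f '' B)).subtype
    Subtype.val_injective).of_surjective (syntacticCon (f '' B)).mk'
      (syntacticCon (f '' B)).mk'_surjective

/-- The product of residuated lattices, with pointwise operations. -/
instance piResiduatedLattice {ι : Type w} (Q : ι → Type u) [∀ i, ResiduatedLattice (Q i)] :
    ResiduatedLattice (∀ i, Q i) where
  ldiv x z := fun i => ldiv (x i) (z i)
  rdiv z y := fun i => rdiv (z i) (y i)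
  mul_le_iff_le_ldiv _ _ _ := forall_congr' fun _ => mul_le_iff_le_ldiv _ _ _
  mul_le_iff_le_rdiv _ _ _ := forall_congr' fun _ => mul_le_iff_le_rdiv _ _ _

theorem eval_pi {ι : Type w} (Q : ι → Type u) [∀ i, ResiduatedLattice (Q i)] (v : ℕ → ∀ i, Q i)
    (t : Term) (i : ι) : t.eval v i = t.eval fun n => v n i := by
  induction t with
  | var _ => rfl
  | one => rfl
  | mul s t hs ht => rw [Term.eval, Term.eval, ← hs, ← ht]; rfl
  | sup s t hs ht => rw [Term.eval, Term.eval, ← hs, ← ht]; rfl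
  | inf s t hs ht => rw [Term.eval, Term.eval, ← hs, ← ht]; rfl
  | ldiv s t hs ht => rw [Term.eval, Term.eval, ← hs, ← ht]; rfl
  | rdiv s t hs ht => rw [Term.eval, Term.eval, ← hs, ← ht]; rfl

theorem holds_pi {ι : Type w} {Q : ι → Type u} [∀ i, ResiduatedLattice (Q i)] {e : Equation}
    (h : ∀ i, e.Holds (Q i)) : e.Holds (∀ i, Q i) := fun v => by
  funext i
  rw [eval_pi, eval_pi, h i]

/-- A product of unilinear residuated lattices that satisfy the equations lies in the variety. -/
theorem subvarietySRL_pi {ι : Type u} {Q : ι → Type u} [∀ i, ResiduatedLattice (Q i)]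
    {E : Set Equation} (hQ : ∀ i, IsUnilinear (Q i)) (h : ∀ i, ∀ e ∈ E, e.Holds (Q i)) :
    subvarietySRL E (∀ i, Q i) :=
  ⟨fun _ he => holds_pi fun i => he (Q i) (hQ i), fun e he => holds_pi fun i => h i e he⟩

theorem holds_of_surjective {A Q : Type u} [ResiduatedLattice A] [ResiduatedLattice Q] {f : A → Q}
    (hf : Function.Surjective f) (heval : ∀ (v : ℕ → A) (t : Term), f (t.eval v) = t.eval (f ∘ v))
    {e : Equation} (h : e.Holds A) : e.Holds Q := fun v => by
  choose g hg using hf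
  have hv : v = f ∘ fun i => g (v i) := funext fun i => (hg (v i)).symm
  rw [hv, ← heval, ← heval, h]

/-- Semiunilinear residuated lattices with the finite embeddability property for their unilinear
quotients: finitely many quotients separate the points of a finite set, and the product of the
finite algebras obtained from them is the required one. -/
theorem hasFEP_of_unilinear {E : Set Equation} (H : UnilinearFEP.{u} E) :
    HasFEP.{u} (subvarietySRL E) := by
  intro A _ hA B hB
  choose Q iQ f hQ hsurj hne heval using fun p : {p : B × B // (p.1 : A) ≠ p.2} =>
    hA.1.exists_unilinear_quotient p.2
  choose C iC hfin hC hCE h hh using fun p => H (Q p) (hQ p)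
    (fun e he => holds_of_surjective (hsurj p) (heval p) (hA.2 e he)) (f p '' B) (hB.image _)
  have : Finite B := hB
  have hm : ∀ p x, x ∈ B → f p x ∈ f p '' B := fun p x hx => ⟨x, hx, rfl⟩
  have hmul : ∀ p x y, f p (x * y) = f p x * f p y := fun p x y =>
    heval p (assign3 x y y) (.mul (.var 0) (.var 1))
  have hsup : ∀ p x y, f p (x ⊔ y) = f p x ⊔ f p y := fun p x y =>
    heval p (assign3 x y y) (.sup (.var 0) (.var 1))
  have hinf : ∀ p x y, f p (x ⊓ y) = f p x ⊓ f p y := fun p x y =>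
    heval p (assign3 x y y) (.inf (.var 0) (.var 1))
  have hldiv : ∀ p x y, f p (ldiv x y) = ldiv (f p x) (f p y) := fun p x y =>
    heval p (assign3 x y y) (.ldiv (.var 0) (.var 1))
  have hrdiv : ∀ p x y, f p (rdiv x y) = rdiv (f p x) (f p y) := fun p x y =>
    heval p (assign3 x y y) (.rdiv (.var 0) (.var 1))
  have hone : ∀ p, f p 1 = 1 := fun p => heval p (fun _ => 1) .one
  refine ⟨∀ p, C p, inferInstance, inferInstance, subvarietySRL_pi hC hCE,
    fun x p => h p (f p x), ⟨fun x hx y hy hxy => ?_, fun h1 => funext fun p => ?_,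
      fun x hx y hy hxy => funext fun p => ?_, fun x hx y hy hxy => funext fun p => ?_,
      fun x hx y hy hxy => funext fun p => ?_, fun x hx y hy hxy => funext fun p => ?_,
      fun x hx y hy hxy => funext fun p => ?_⟩⟩
  · by_contra hcon
    let p : {p : B × B // (p.1 : A) ≠ p.2} := ⟨(⟨x, hx⟩, ⟨y, hy⟩), hcon⟩
    exact hne p ((hh p).injOn (hm p x hx) (hm p y hy) (congrFun hxy p))
  · exact (congrArg (h p) (hone p)).trans ((hh p).map_one (hone p ▸ hm p 1 h1))
  · exact (congrArg (h p) (hmul p x y)).trans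
      ((hh p).map_mul _ (hm p x hx) _ (hm p y hy) (hmul p x y ▸ hm p _ hxy))
  · exact (congrArg (h p) (hsup p x y)).trans
      ((hh p).map_sup _ (hm p x hx) _ (hm p y hy) (hsup p x y ▸ hm p _ hxy))
  · exact (congrArg (h p) (hinf p x y)).trans
      ((hh p).map_inf _ (hm p x hx) _ (hm p y hy) (hinf p x y ▸ hm p _ hxy))
  · exact (congrArg (h p) (hldiv p x y)).trans
      ((hh p).map_ldiv _ (hm p x hx) _ (hm p y hy) (hldiv p x y ▸ hm p _ hxy))
  · exact (congrArg (h p) (hrdiv p x y)).trans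
      ((hh p).map_rdiv _ (hm p x hx) _ (hm p y hy) (hrdiv p x y ▸ hm p _ hxy))

/-! ### Recursion on Gödel numbers -/

/-- Recursion on Gödel numbers: the value at `c = ⟨k, ⟨x, y⟩⟩` is computed by `g` from the tag `k`,
the rest `⟨x, y⟩` and the values at `x` and `y`, where `d` replaces the values at arguments that are
not smaller than `c`. -/
def codeRec {X : Type w} (g : ℕ → ℕ → X → X → X) (d : X) (c : ℕ) : X :=
  g c.unpair.1 c.unpair.2
    (if _h : c.unpair.2.unpair.1 < c then codeRec g d c.unpair.2.unpair.1 else d)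
    (if _h : c.unpair.2.unpair.2 < c then codeRec g d c.unpair.2.unpair.2 else d)

theorem lt_pair_of_pos {k : ℕ} (hk : 1 ≤ k) (r : ℕ) : r < Nat.pair k r := by
  unfold Nat.pair
  split_ifs <;> nlinarith

theorem codeRec_pair {X : Type w} (g : ℕ → ℕ → X → X → X) (d : X) {k : ℕ} (hk : 1 ≤ k)
    (x y : ℕ) : codeRec g d (Nat.pair k (Nat.pair x y)) =
      g k (Nat.pair x y) (codeRec g d x) (codeRec g d y) := by
  have hx := (Nat.left_le_pair x y).trans_lt (lt_pair_of_pos hk _)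
  have hy := (Nat.right_le_pair x y).trans_lt (lt_pair_of_pos hk _)
  rw [codeRec]
  simp only [Nat.unpair_pair, dif_pos hx, dif_pos hy]

theorem code_induction {P : ℕ → Prop}
    (h : ∀ k x y, (1 ≤ k → P x ∧ P y) → P (Nat.pair k (Nat.pair x y))) (c : ℕ) : P c := by
  induction c using Nat.strong_induction_on with
  | _ c ih =>
  have hc : c = Nat.pair c.unpair.1 (Nat.pair c.unpair.2.unpair.1 c.unpair.2.unpair.2) := by
    simp
  rw [hc] at ih ⊢
  exact h _ _ _ fun hk => ⟨ih _ ((Nat.left_le_pair _ _).trans_lt (lt_pair_of_pos hk _)),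
    ih _ ((Nat.right_le_pair _ _).trans_lt (lt_pair_of_pos hk _))⟩

/-- The value of a Gödel number in a raw algebra. Numbers with tag `1`, and those whose tag does not
belong to any operation symbol, have the value `1`. -/
def evalCode {X : Type w} (R : RawAlg X) (v : ℕ → X) : ℕ → X :=
  codeRec (fun k r x y => if k = 0 then v r else if 2 ≤ k ∧ k ≤ 6 then R.op k x y else R.one) R.one

section EvalCode

variable {X : Type w} (R : RawAlg X) (v : ℕ → X)

theorem evalCode_var (i : ℕ) : evalCode R v (Nat.pair 0 i) = v i := by
  rw [evalCode, codeRec]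
  simp

theorem evalCode_op {k : ℕ} (hk : 2 ≤ k) (hk' : k ≤ 6) (x y : ℕ) :
    evalCode R v (Nat.pair k (Nat.pair x y)) = R.op k (evalCode R v x) (evalCode R v y) := by
  rw [evalCode, codeRec_pair _ _ (by omega), if_neg (by omega), if_pos ⟨hk, hk'⟩]

theorem evalCode_one {k : ℕ} (hk : 1 ≤ k) (hk' : ¬ (2 ≤ k ∧ k ≤ 6)) (x y : ℕ) :
    evalCode R v (Nat.pair k (Nat.pair x y)) = R.one := by
  rw [evalCode, codeRec_pair _ _ hk, if_neg (by omega), if_neg hk']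

theorem evalCode_code (t : Term) : evalCode R v t.code = t.evalIn R v := by
  induction t with
  | var i => exact evalCode_var R v i
  | one => exact evalCode_one R v (k := 1) le_rfl (by omega) 0 0
  | mul s t hs ht => rw [Term.code, evalCode_op R v (by omega) (by omega), hs, ht]; rfl
  | sup s t hs ht => rw [Term.code, evalCode_op R v (by omega) (by omega), hs, ht]; rfl
  | inf s t hs ht => rw [Term.code, evalCode_op R v (by omega) (by omega), hs, ht]; rfl
  | ldiv s t hs ht => rw [Term.code, evalCode_op R v (by omega) (by omega), hs, ht]; rfl
  | rdiv s t hs ht => rw [Term.code, evalCode_op R v (by omega) (by omega), hs, ht]; rfl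

/-- A map that commutes with the operations that occur in the evaluation of the numbers up to `c`
commutes with their evaluation. -/
theorem map_evalCode {Y : Type u} (S : RawAlg Y) (v' : ℕ → Y) (f : X → Y) (c : ℕ)
    (hone : f R.one = S.one) (hvar : ∀ i, Nat.pair 0 i ≤ c → f (v i) = v' i)
    (hop : ∀ k x y, 2 ≤ k → k ≤ 6 → Nat.pair k (Nat.pair x y) ≤ c →
      f (R.op k (evalCode R v x) (evalCode R v y)) =
        S.op k (f (evalCode R v x)) (f (evalCode R v y))) :
    ∀ x ≤ c, f (evalCode R v x) = evalCode S v' x := by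
  intro x
  induction x using code_induction with
  | h k x y ih =>
  intro hle
  rcases Nat.eq_zero_or_pos k with rfl | hk
  · rw [evalCode_var, evalCode_var]
    exact hvar _ hle
  by_cases hk' : 2 ≤ k ∧ k ≤ 6
  · have hr := (lt_pair_of_pos hk (Nat.pair x y)).le
    rw [evalCode_op _ _ hk'.1 hk'.2, evalCode_op _ _ hk'.1 hk'.2, hop k x y hk'.1 hk'.2 hle,
      (ih hk).1 ((Nat.left_le_pair x y).trans (hr.trans hle)),
      (ih hk).2 ((Nat.right_le_pair x y).trans (hr.trans hle))]
  · rw [evalCode_one _ _ hk hk', evalCode_one _ _ hk hk', hone]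

end EvalCode

/-- The truth of a Gödel number of a formula, from the truth values `τ` of the pairs of Gödel
numbers of terms. -/
def truthCode (τ : ℕ → Bool) : ℕ → Bool :=
  codeRec (fun k r x y => if k = 1 then τ r else if k = 2 then !x || y else false) false

theorem truthCode_code {A : Type u} [ResiduatedLattice A] (v : ℕ → A) (τ : ℕ → Bool)
    (hτ : ∀ s t : Term, τ (Nat.pair s.code t.code) = true ↔ s.eval v = t.eval v)
    (p : QFFormula) : truthCode τ p.code = true ↔ p.Realize v := by
  induction p with
  | falsum =>
    rw [QFFormula.code, truthCode, codeRec]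
    simp [QFFormula.Realize]
  | equal s t =>
    rw [QFFormula.code, truthCode, codeRec_pair _ _ le_rfl, if_pos rfl, hτ]
    rfl
  | imp p q hp hq =>
    rw [truthCode] at hp hq ⊢
    rw [QFFormula.code, codeRec_pair _ _ (by omega), if_neg (by omega), if_pos rfl,
      QFFormula.Realize, ← hp, ← hq]
    cases codeRec _ false p.code <;> simp

/-- The truth of a formula depends only on the truth values of pairs up to its Gödel number. -/
theorem truthCode_congr {τ τ' : ℕ → Bool} {c : ℕ} (h : ∀ e ≤ c, τ e = τ' e) :
    truthCode τ c = truthCode τ' c := by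
  induction c using code_induction with
  | h k x y ih =>
  rcases Nat.eq_zero_or_pos k with rfl | hk
  · have h0 : ∀ τ, truthCode τ (Nat.pair 0 (Nat.pair x y)) = false := fun τ => by
      rw [truthCode, codeRec]
      simp
    rw [h0, h0]
  have hr := (lt_pair_of_pos hk (Nat.pair x y)).le
  have hx := (ih hk).1 fun e he => h e (he.trans ((Nat.left_le_pair x y).trans hr))
  have hy := (ih hk).2 fun e he => h e (he.trans ((Nat.right_le_pair x y).trans hr))
  rw [truthCode] at hx hy ⊢
  rw [truthCode] at hx hy ⊢
  rw [codeRec_pair _ _ hk, codeRec_pair _ _ hk, hx, hy, h _ hr]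

/-- The characteristic function of the Gödel numbers of terms. -/
def isTermCode : ℕ → Bool :=
  codeRec (fun k r x y => if k = 0 then true else if k = 1 then r == 0 else
    if k ≤ 6 then x && y else false) false

/-- The characteristic function of the Gödel numbers of formulas. -/
def isFormulaCode : ℕ → Bool :=
  codeRec (fun k r x y => if k = 0 then r == 0 else
    if k = 1 then isTermCode r.unpair.1 && isTermCode r.unpair.2 else
    if k = 2 then x && y else false) false

theorem isTermCode_iff (c : ℕ) : isTermCode c = true ↔ ∃ t : Term, t.code = c := by
  constructor
  · induction c using code_induction with
    | h k x y ih =>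
    intro h
    rcases Nat.eq_zero_or_pos k with rfl | hk
    · exact ⟨.var (Nat.pair x y), rfl⟩
    rw [isTermCode] at ih h
    rw [codeRec_pair _ _ hk, if_neg (by omega)] at h
    by_cases h1 : k = 1
    · rw [if_pos h1, beq_iff_eq] at h
      exact ⟨.one, by rw [Term.code, h, h1]⟩
    rw [if_neg h1] at h
    by_cases h6 : k ≤ 6
    · rw [if_pos h6, Bool.and_eq_true] at h
      obtain ⟨s, rfl⟩ := (ih hk).1 h.1
      obtain ⟨t, rfl⟩ := (ih hk).2 h.2
      have hk2 : 2 ≤ k := by omega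
      interval_cases k
      exacts [⟨.mul s t, rfl⟩, ⟨.sup s t, rfl⟩, ⟨.inf s t, rfl⟩, ⟨.ldiv s t, rfl⟩, ⟨.rdiv s t, rfl⟩]
    · rw [if_neg h6] at h
      exact absurd h (by simp)
  · rintro ⟨t, rfl⟩
    rw [isTermCode]
    induction t with
    | var i => rw [Term.code, codeRec]; simp
    | one => rw [Term.code, codeRec]; simp
    | mul s t hs ht | sup s t hs ht | inf s t hs ht | ldiv s t hs ht | rdiv s t hs ht =>
      rw [Term.code, codeRec_pair _ _ (by omega), hs, ht]
      rfl

theorem isFormulaCode_iff (c : ℕ) : isFormulaCode c = true ↔ ∃ p : QFFormula, p.code = c := by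
  constructor
  · induction c using code_induction with
    | h k x y ih =>
    intro h
    rcases Nat.eq_zero_or_pos k with rfl | hk
    · rw [isFormulaCode, codeRec] at h
      refine ⟨.falsum, ?_⟩
      simp only [Nat.unpair_pair, if_true, beq_iff_eq] at h
      rw [QFFormula.code, h]
    rw [isFormulaCode] at ih h
    rw [codeRec_pair _ _ hk, if_neg (by omega)] at h
    by_cases h1 : k = 1
    · rw [if_pos h1, Bool.and_eq_true, isTermCode_iff, isTermCode_iff, Nat.unpair_pair] at h
      obtain ⟨⟨s, rfl⟩, ⟨t, rfl⟩⟩ := h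
      exact ⟨.equal s t, by rw [h1]; rfl⟩
    rw [if_neg h1] at h
    by_cases h2 : k = 2
    · rw [if_pos h2, Bool.and_eq_true] at h
      obtain ⟨p, rfl⟩ := (ih hk).1 h.1
      obtain ⟨q, rfl⟩ := (ih hk).2 h.2
      exact ⟨.imp p q, by rw [h2]; rfl⟩
    · rw [if_neg h2] at h
      exact absurd h (by simp)
  · rintro ⟨p, rfl⟩
    rw [isFormulaCode]
    induction p with
    | falsum => rw [QFFormula.code, codeRec]; simp
    | equal s t =>
      rw [QFFormula.code, codeRec_pair _ _ le_rfl, if_neg (by omega), if_pos rfl,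
        Bool.and_eq_true, isTermCode_iff, isTermCode_iff, Nat.unpair_pair]
      exact ⟨⟨s, rfl⟩, ⟨t, rfl⟩⟩
    | imp p q hp hq =>
      rw [QFFormula.code, codeRec_pair _ _ (by omega), hp, hq]
      rfl

/-! ### Universal axioms for the unilinear members of the variety -/

/-- Universal axioms for the unilinear residuated lattices that satisfy the equations in `E`. -/
def theoryOf (E : List Equation) : List QFFormula :=
  unilinearTheory ++ E.map fun e => .equal e.lhs e.rhs

theorem realize_theoryOf {E : List Equation} {A : Type u} [ResiduatedLattice A]
    (hA : IsUnilinear A) (hE : ∀ e ∈ E, e.Holds A) {p : QFFormula} (hp : p ∈ theoryOf E)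
    (v : ℕ → A) : p.Realize v := by
  rcases List.mem_append.1 hp with hp | hp
  · exact realize_unilinearTheory hA hp v
  · obtain ⟨e, he, rfl⟩ := List.mem_map.1 hp
    exact hE e he v

theorem exists_quotient_of_theoryOf {E : List Equation} {X : Type w} (R : RawAlg X)
    (h : ∀ p ∈ theoryOf E, ∀ v : ℕ → X, p.holdsIn R v) :
    ∃ (A : Type max u w) (_ : ResiduatedLattice A) (f : X → A), IsUnilinear A ∧
      (∀ e ∈ E, e.Holds A) ∧ (∀ x y, f x = f y ↔ R.eq x y) ∧
      ∀ (v : ℕ → X) (t : Term), f (t.evalIn R v) = t.eval (f ∘ v) := by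
  obtain ⟨A, i, f, hA, hf, heq, heval⟩ := exists_quotient.{u, w} R fun p hp =>
    h p (List.mem_append_left _ hp)
  refine ⟨A, i, f, hA, fun e he v => ?_, heq, heval⟩
  choose g hg using hf
  have hv : v = f ∘ fun i => g (v i) := funext fun i => (hg (v i)).symm
  rw [hv, ← heval, ← heval, heq]
  exact h (.equal e.lhs e.rhs) (List.mem_append_right _ (List.mem_map.2 ⟨e, he, rfl⟩)) _

/-- The one-element residuated lattice. -/
instance : ResiduatedLattice PUnit.{u + 1} where
  ldiv _ _ := 1
  rdiv _ _ := 1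
  mul_le_iff_le_ldiv _ _ _ := Iff.rfl
  mul_le_iff_le_rdiv _ _ _ := Iff.rfl

/-- For equal elements any unilinear quotient will do, such as the one-element algebra. -/
theorem exists_separating {E : Set Equation} {A : Type u} [ResiduatedLattice A]
    (hA : subvarietySRL E A) (a b : A) :
    ∃ (Q : Type u) (_ : ResiduatedLattice Q) (f : A → Q), IsUnilinear Q ∧ (∀ e ∈ E, e.Holds Q) ∧
      (f a = f b → a = b) ∧ ∀ (v : ℕ → A) (t : Term), f (t.eval v) = t.eval (f ∘ v) := by
  by_cases hab : a = b
  · exact ⟨PUnit, inferInstance, fun _ => 1, fun _ _ _ _ => Or.inl le_rfl, fun _ _ _ => rfl,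
      fun _ => hab, fun _ _ => rfl⟩
  · obtain ⟨Q, i, f, hQ, hf, hne, heval⟩ := hA.1.exists_unilinear_quotient hab
    exact ⟨Q, i, f, hQ, fun e he => holds_of_surjective hf heval (hA.2 e he),
      fun h => (hne h).elim, heval⟩

/-- A homomorphism is compatible with the operations of the raw algebras. -/
theorem map_binOp {A Q : Type u} [ResiduatedLattice A] [ResiduatedLattice Q] {f : A → Q}
    (heval : ∀ (v : ℕ → A) (t : Term), f (t.eval v) = t.eval (f ∘ v)) {k : ℕ} (hk : 2 ≤ k)
    (hk' : k ≤ 6) (x y : A) : f (binOp A k x y) = binOp Q k (f x) (f y) := by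
  interval_cases k
  · exact heval (assign3 x y y) (.mul (.var 0) (.var 1))
  · exact heval (assign3 x y y) (.sup (.var 0) (.var 1))
  · exact heval (assign3 x y y) (.inf (.var 0) (.var 1))
  · exact heval (assign3 x y y) (.ldiv (.var 0) (.var 1))
  · exact heval (assign3 x y y) (.rdiv (.var 0) (.var 1))

/-! ### Patterns of equality between terms -/

/-- The raw algebra of Gödel numbers, with `r` as the interpretation of equality. Numbers that
are not Gödel numbers of terms are further generators. -/
def codeAlg (r : ℕ → ℕ → Prop) : RawAlg ℕ where
  one := Nat.pair 1 0
  op k x y := Nat.pair k (Nat.pair x y)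
  eq := r

theorem evalIn_codeAlg (r : ℕ → ℕ → Prop) (t : Term) :
    t.evalIn (codeAlg r) (Nat.pair 0) = t.code := by
  induction t <;> simp_all [Term.evalIn, Term.code, codeAlg]

/-- The relation on Gödel numbers of the `i`-th component of `T`. -/
def component (T : ℕ → Bool) (i : ℕ) (x y : ℕ) : Prop := T (Nat.pair i (Nat.pair x y)) = true

/-- A family of interpretations of equality between terms, each of which satisfies the axioms. The
`e`-th component, where `e` is a pair of terms, is the one that separates the two terms if any
component does. The formula with Gödel number `c` is false in the product. -/
structure IsCounterpattern (E : List Equation) (c : ℕ) (T : ℕ → Bool) : Prop where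
  holds : ∀ i, ∀ p ∈ theoryOf E, ∀ v : ℕ → ℕ, p.holdsIn (codeAlg (component T i)) v
  separates : ∀ i e, T (Nat.pair e e) = true → T (Nat.pair i e) = true
  false : truthCode (fun e => T (Nat.pair e e)) c = false

/-- The formula fails in the product of the unilinear quotients of the algebra of Gödel numbers by
the components of the pattern, under the assignment of the generators to the variables. -/
theorem not_validIn_of_isCounterpattern {E : List Equation} {p : QFFormula} {T : ℕ → Bool}
    (hT : IsCounterpattern E p.code T) : ¬ p.ValidIn (subvarietySRL.{u} {e | e ∈ E}) := by
  choose A iA f hA hE heq heval using fun i : ULift.{u} ℕ =>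
    exists_quotient_of_theoryOf.{u, 0} (codeAlg (component T i.down)) (hT.holds i.down)
  intro hvalid
  have hreal := hvalid (∀ i, A i) (subvarietySRL_pi hA hE) (fun n i => f i (Nat.pair 0 n))
  rw [← truthCode_code _ (fun e => T (Nat.pair e e)) (fun s t => ?_), hT.false] at hreal
  · exact absurd hreal (by simp)
  have hval : ∀ (t : Term) i, t.eval (fun n i => f i (Nat.pair 0 n)) i = f i t.code := by
    intro t i
    rw [eval_pi, ← evalIn_codeAlg, heval]
    rfl
  rw [funext_iff]
  simp only [hval, heq]
  exact ⟨fun h i => hT.separates _ _ h, fun h => h ⟨Nat.pair s.code t.code⟩⟩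

/-- The pattern is read off from an assignment that falsifies the formula, with one unilinear
quotient for each pair of terms. -/
theorem exists_isCounterpattern {E : List Equation} {p : QFFormula}
    (h : ¬ p.ValidIn (subvarietySRL.{u} {e | e ∈ E})) : ∃ T, IsCounterpattern E p.code T := by
  classical
  unfold QFFormula.ValidIn at h
  push Not at h
  obtain ⟨A, _, hA, v, hv⟩ := h
  set g : ℕ → A := evalCode (rawOf A Eq) v with hg
  choose Q iQ f hQ hE hsep heval using fun e : ℕ =>
    exists_separating hA (g e.unpair.1) (g e.unpair.2)
  have hdiag : ∀ e, f e (g e.unpair.1) = f e (g e.unpair.2) ↔ g e.unpair.1 = g e.unpair.2 :=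
    fun e => ⟨hsep e, congrArg _⟩
  obtain ⟨P, hP⟩ : ∃ P : ℕ → ℕ → ℕ → Prop, ∀ i x y, P i x y ↔ f i (g x) = f i (g y) :=
    ⟨_, fun _ _ _ => Iff.rfl⟩
  simp only [← hP] at hdiag
  refine ⟨fun j => decide (P j.unpair.1 j.unpair.2.unpair.1 j.unpair.2.unpair.2),
    fun i p hp w => ?_, fun i e => ?_, ?_⟩
  · rw [holdsIn_comap _ (rawOf (Q i) Eq) (fun x => f i (g x))]
    · exact (holdsIn_rawOf _ _ _).2 (realize_theoryOf (hQ i) (hE i) hp _)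
    · have : g (Nat.pair 1 0) = 1 := evalCode_one _ _ (k := 1) le_rfl (by omega) 0 0
      exact (congrArg (f i) this).trans (heval i v .one)
    · intro k x y hk hk'
      refine (congrArg (f i) (evalCode_op (rawOf A Eq) v hk hk' x y)).trans ?_
      exact map_binOp (heval i) hk hk' _ _
    · intro x y
      simpa [component, codeAlg, rawOf] using hP i x y
  · simp only [Nat.unpair_pair, decide_eq_true_eq, hdiag]
    exact fun h => (hP _ _ _).2 (congrArg _ h)
  · rw [← Bool.not_eq_true, truthCode_code v]
    · exact hv
    · intro s t
      simp only [Nat.unpair_pair, decide_eq_true_eq]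
      rw [← evalIn_rawOf A Eq v s, ← evalIn_rawOf A Eq v t, ← evalCode_code, ← evalCode_code]
      simpa using hdiag (Nat.pair s.code t.code)

/-! ### Variables and assignments -/

/-- A strict upper bound for the indices of the variables of a term. -/
def Term.varBound : Term → ℕ
  | var i => i + 1
  | one => 0
  | mul s t => max (varBound s) (varBound t)
  | sup s t => max (varBound s) (varBound t)
  | inf s t => max (varBound s) (varBound t)
  | ldiv s t => max (varBound s) (varBound t)
  | rdiv s t => max (varBound s) (varBound t)

/-- A strict upper bound for the indices of the variables of a formula. -/
def QFFormula.varBound : QFFormula → ℕ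
  | falsum => 0
  | equal s t => max s.varBound t.varBound
  | imp p q => max (varBound p) (varBound q)

theorem evalIn_congr {X : Type w} (R : RawAlg X) {v v' : ℕ → X} {t : Term}
    (h : ∀ i < t.varBound, v i = v' i) : t.evalIn R v = t.evalIn R v' := by
  induction t with
  | var i => exact h i (Nat.lt_succ_self i)
  | one => rfl
  | mul s t hs ht | sup s t hs ht | inf s t hs ht | ldiv s t hs ht | rdiv s t hs ht =>
    simp only [Term.evalIn]
    rw [hs fun i hi => h i (lt_max_of_lt_left hi), ht fun i hi => h i (lt_max_of_lt_right hi)]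

theorem holdsIn_congr {X : Type w} (R : RawAlg X) {v v' : ℕ → X} {p : QFFormula}
    (h : ∀ i < p.varBound, v i = v' i) : p.holdsIn R v ↔ p.holdsIn R v' := by
  induction p with
  | falsum => rfl
  | equal s t =>
    simp only [QFFormula.holdsIn]
    rw [evalIn_congr R (t := s) fun i hi => h i (lt_max_of_lt_left hi),
      evalIn_congr R (t := t) fun i hi => h i (lt_max_of_lt_right hi)]
  | imp p q hp hq =>
    simp only [QFFormula.holdsIn]
    rw [hp fun i hi => h i (lt_max_of_lt_left hi), hq fun i hi => h i (lt_max_of_lt_right hi)]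

/-- The lists of length `r` with entries below `n`. -/
def allLists (n : ℕ) : ℕ → List (List ℕ)
  | 0 => [[]]
  | r + 1 => (allLists n r).flatMap fun l => (List.range n).map fun x => x :: l

theorem mem_allLists {n r : ℕ} {l : List ℕ} (hl : l.length = r) (h : ∀ x ∈ l, x < n) :
    l ∈ allLists n r := by
  induction r generalizing l with
  | zero => simp [allLists, List.length_eq_zero_iff.1 hl]
  | succ r ih =>
    obtain _ | ⟨x, l⟩ := l
    · simp at hl
    rw [allLists, List.mem_flatMap]
    exact ⟨l, ih (by simpa using hl) fun y hy => h y (by simp [hy]), List.mem_map.2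
      ⟨x, List.mem_range.2 (h x (by simp)), rfl⟩⟩

theorem getD_map_range {X : Type w} (f : ℕ → X) (d : X) {i n : ℕ} (h : i < n) :
    ((List.range n).map f).getD i d = f i := by
  simp [h]

/-! ### Compactness -/

/-- The assignment of the variables that is coded by a number. -/
def listVal (w : ℕ) (i : ℕ) : ℕ := (Denumerable.ofNat (List ℕ) w).getD i 0

theorem exists_listVal (v : ℕ → ℕ) (r : ℕ) : ∃ w, ∀ i < r, listVal w i = v i :=
  ⟨Encodable.encode ((List.range r).map v), fun i hi => by
    rw [listVal, Denumerable.ofNat_encode, getD_map_range _ _ hi]⟩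

/-- The largest of the indices at which the truth of a formula in the `i`-th component of a family
of interpretations of equality depends on the family. -/
def QFFormula.touch (i : ℕ) (v : ℕ → ℕ) : QFFormula → ℕ
  | falsum => 0
  | equal s t =>
    Nat.pair i (Nat.pair (s.evalIn (codeAlg Eq) v) (t.evalIn (codeAlg Eq) v))
  | imp p q => max (touch i v p) (touch i v q)

theorem evalIn_codeAlg_eq (r : ℕ → ℕ → Prop) (v : ℕ → ℕ) (t : Term) :
    t.evalIn (codeAlg r) v = t.evalIn (codeAlg Eq) v := by
  induction t <;> simp_all [Term.evalIn, codeAlg]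

theorem holdsIn_component_congr {T T' : ℕ → Bool} {N i : ℕ} {v : ℕ → ℕ} {p : QFFormula}
    (hp : p.touch i v < N) (h : ∀ j < N, T j = T' j) :
    p.holdsIn (codeAlg (component T i)) v ↔ p.holdsIn (codeAlg (component T' i)) v := by
  induction p with
  | falsum => rfl
  | equal s t =>
    simp only [QFFormula.holdsIn, evalIn_codeAlg_eq (component _ _)]
    exact iff_of_eq (congrArg (· = true) (h _ hp))
  | imp p q hp' hq' =>
    simp only [QFFormula.holdsIn]
    rw [hp' (lt_of_le_of_lt (le_max_left _ _) hp), hq' (lt_of_le_of_lt (le_max_right _ _) hp)]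

/-- The values of `T` at arguments below `N` show that `T` is not a counterpattern for the formula
with Gödel number `c`: an axiom fails, a pair is not separated, or the formula is true. -/
def IsRefuted (E : List Equation) (c : ℕ) (T : ℕ → Bool) (N : ℕ) : Prop :=
  (∃ p ∈ theoryOf E, ∃ i < N, ∃ w < N, p.touch i (listVal w) < N ∧
    ¬ p.holdsIn (codeAlg (component T i)) (listVal w)) ∨
  (∃ i < N, ∃ e < N, Nat.pair e e < N ∧ Nat.pair i e < N ∧ T (Nat.pair e e) = true ∧
    T (Nat.pair i e) = false) ∨
  (Nat.pair c c < N ∧ truthCode (fun e => T (Nat.pair e e)) c = true)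

theorem pair_le_pair {a a' b b' : ℕ} (ha : a ≤ a') (hb : b ≤ b') :
    Nat.pair a b ≤ Nat.pair a' b' :=
  le_trans (ha.eq_or_lt.elim (fun h => h ▸ le_rfl) fun h => (Nat.pair_lt_pair_left _ h).le)
    (hb.eq_or_lt.elim (fun h => h ▸ le_rfl) fun h => (Nat.pair_lt_pair_right _ h).le)

theorem IsRefuted.congr {E : List Equation} {c N : ℕ} {T T' : ℕ → Bool}
    (h : ∀ j < N, T j = T' j) (hT : IsRefuted E c T N) : IsRefuted E c T' N := by
  rcases hT with ⟨p, hp, i, hi, w, hw, ht, hn⟩ | ⟨i, hi, e, he, h1, h2, h3, h4⟩ | ⟨h1, h2⟩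
  · exact Or.inl ⟨p, hp, i, hi, w, hw, ht, by rwa [← holdsIn_component_congr ht h]⟩
  · exact Or.inr (Or.inl ⟨i, hi, e, he, h1, h2, h _ h1 ▸ h3, h _ h2 ▸ h4⟩)
  · refine Or.inr (Or.inr ⟨h1, ?_⟩)
    rw [← h2]
    exact truthCode_congr fun e he => (h _ ((pair_le_pair he he).trans_lt h1)).symm

theorem IsRefuted.mono {E : List Equation} {c N N' : ℕ} {T : ℕ → Bool} (h : N ≤ N')
    (hT : IsRefuted E c T N) : IsRefuted E c T N' := by
  rcases hT with ⟨p, hp, i, hi, w, hw, ht, hn⟩ | ⟨i, hi, e, he, h1, h2, h3, h4⟩ | ⟨h1, h2⟩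
  · exact Or.inl ⟨p, hp, i, hi.trans_le h, w, hw.trans_le h, ht.trans_le h, hn⟩
  · exact Or.inr (Or.inl ⟨i, hi.trans_le h, e, he.trans_le h, h1.trans_le h, h2.trans_le h, h3, h4⟩)
  · exact Or.inr (Or.inr ⟨h1.trans_le h, h2⟩)

theorem isCounterpattern_iff {E : List Equation} {c : ℕ} {T : ℕ → Bool} :
    IsCounterpattern E c T ↔ ∀ N, ¬ IsRefuted E c T N := by
  constructor
  · rintro hT N (⟨p, hp, i, -, w, -, -, hn⟩ | ⟨i, -, e, -, -, -, h3, h4⟩ | ⟨-, h2⟩)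
    · exact hn (hT.holds i p hp _)
    · exact absurd (hT.separates i e h3) (by simp [h4])
    · exact absurd hT.false (by simp [h2])
  · intro hT
    refine ⟨fun i p hp v => ?_, fun i e he => ?_, ?_⟩
    · obtain ⟨w, hw⟩ := exists_listVal v p.varBound
      rw [← holdsIn_congr _ hw]
      by_contra hn
      exact hT (max (max i w) (p.touch i (listVal w)) + 1) (Or.inl ⟨p, hp, i, by omega, w,
        by omega, by omega, hn⟩)
    · by_contra hn
      exact hT (max (max i e) (max (Nat.pair e e) (Nat.pair i e)) + 1) (Or.inr (Or.inl
        ⟨i, by omega, e, by omega, by omega, by omega, he, by simpa using hn⟩))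
    · by_contra hn
      exact hT (Nat.pair c c + 1) (Or.inr (Or.inr ⟨by omega, by simpa using hn⟩))

/-- If every bound leaves some family unrefuted then some family is unrefuted at all bounds, since
the space of families is compact and the unrefuted families form decreasing clopen sets. -/
theorem exists_forall_not_isRefuted {E : List Equation} {c : ℕ}
    (h : ∀ N, ∃ T, ¬ IsRefuted E c T N) : ∃ T, ∀ N, ¬ IsRefuted E c T N := by
  have hclosed : ∀ N, IsClosed {T | ¬ IsRefuted E c T N} := by
    intro N
    let π : (ℕ → Bool) → (Fin N → Bool) := fun T j => T j
    have hπ : Continuous π := by fun_prop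
    have : {T | ¬ IsRefuted E c T N} = π ⁻¹' (π '' {T | ¬ IsRefuted E c T N}) := by
      refine Set.Subset.antisymm (Set.subset_preimage_image _ _) ?_
      rintro T ⟨T', hT', hTT'⟩ hT
      exact hT' (hT.congr fun j hj => (congrFun hTT' ⟨j, hj⟩).symm)
    rw [this]
    exact (isClosed_discrete _).preimage hπ
  obtain ⟨T, hT⟩ := IsCompact.nonempty_iInter_of_sequence_nonempty_isCompact_isClosed
    (fun N => {T | ¬ IsRefuted E c T N}) (fun N T hT hT' => hT (hT'.mono N.le_succ)) h
    (hclosed 0).isCompact hclosed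
  exact ⟨T, fun N => Set.mem_iInter.1 hT N⟩

/-- A valid formula has a finite certificate of its validity. -/
theorem validIn_iff_exists_isRefuted {E : List Equation} {p : QFFormula} :
    p.ValidIn (subvarietySRL.{u} {e | e ∈ E}) ↔
      ∃ N, ∀ l ∈ allLists 2 N, IsRefuted E p.code (fun j => l.getD j 0 == 1) N := by
  constructor
  · intro hp
    by_contra! h
    obtain ⟨T, hT⟩ := exists_forall_not_isRefuted fun N => ⟨_, (h N).choose_spec.2⟩
    exact not_validIn_of_isCounterpattern (isCounterpattern_iff.2 hT) hp
  · rintro ⟨N, hN⟩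
    by_contra h
    obtain ⟨T, hT⟩ := exists_isCounterpattern h
    refine isCounterpattern_iff.1 hT N ((hN ((List.range N).map fun j => (T j).toNat)
      (mem_allLists (by simp) ?_)).congr fun j hj => ?_)
    · intro x hx
      obtain ⟨j, -, rfl⟩ := List.mem_map.1 hx
      cases T j <;> simp
    · simp only [getD_map_range _ _ hj]
      cases T j <;> rfl

/-! ### Finite tables -/

/-- The entry at `x` in the `i`-th part of a table. -/
def tableEntry (l : List ℕ) (i x : ℕ) : ℕ := l.getD (Nat.pair i x) 0

/-- The number of elements of the `i`-th algebra of a table. -/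
def tableSize (l : List ℕ) (i : ℕ) : ℕ := tableEntry l i (Nat.pair 7 0) + 1

/-- The `i`-th algebra of a table, on the residues modulo its size. The entries are indexed by the
Gödel numbers of the expressions whose values they are. -/
def tableAlg (l : List ℕ) (i : ℕ) : RawAlg ℕ where
  one := tableEntry l i (Nat.pair 1 0) % tableSize l i
  op k x y := tableEntry l i
    (Nat.pair k (Nat.pair (x % tableSize l i) (y % tableSize l i))) % tableSize l i
  eq x y := x % tableSize l i = y % tableSize l i

/-- The value of a Gödel number in the `i`-th algebra of a table. -/
def tableEval (l : List ℕ) (i x : ℕ) : ℕ :=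
  evalCode (tableAlg l i) (fun n => tableEntry l i (Nat.pair 0 n)) x % tableSize l i

/-- Pairs of terms that have the same value in all the algebras of a table with index at
most `c`. -/
def tableEq (l : List ℕ) (c e : ℕ) : Prop :=
  ∀ i < c + 1, tableEval l i e.unpair.1 = tableEval l i e.unpair.2

open Classical in
/-- The algebras of the table with index at most `c` satisfy the axioms, and the formula with
Gödel number `c` is false in their product. -/
structure IsCountertable (E : List Equation) (c : ℕ) (l : List ℕ) : Prop where
  holds : ∀ i < c + 1, ∀ p ∈ theoryOf E, ∀ a ∈ allLists (tableSize l i) p.varBound,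
    p.holdsIn (tableAlg l i) fun j => a.getD j 0
  false : truthCode (fun e => decide (tableEq l c e)) c = false

theorem IsCountertable.holdsIn {E : List Equation} {c : ℕ} {l : List ℕ}
    (h : IsCountertable E c l) {i : ℕ} (hi : i < c + 1) {p : QFFormula} (hp : p ∈ theoryOf E)
    (v : ℕ → ℕ) : p.holdsIn (tableAlg l i) v := by
  have hpos : 0 < tableSize l i := Nat.succ_pos _
  rw [holdsIn_comap (tableAlg l i) (tableAlg l i) (· % tableSize l i) (by simp [tableAlg])
    (by simp [tableAlg]) (by simp [tableAlg]),
    holdsIn_congr (tableAlg l i) (v := (· % tableSize l i) ∘ v)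
      (v' := fun j => ((List.range p.varBound).map fun j => v j % tableSize l i).getD j 0)
      (fun j hj => (getD_map_range (fun j => v j % tableSize l i) 0 hj).symm)]
  refine h.holds i hi p hp _ (mem_allLists (by simp) fun x hx => ?_)
  obtain ⟨j, -, rfl⟩ := List.mem_map.1 hx
  exact Nat.mod_lt _ hpos

theorem IsCountertable.not_validIn {E : List Equation} {p : QFFormula} {l : List ℕ}
    (h : IsCountertable E p.code l) : ¬ p.ValidIn (subvarietySRL.{u} {e | e ∈ E}) := by
  classical
  choose A iA f hA hE heq heval using fun i : ULift.{u} (Fin (p.code + 1)) =>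
    exists_quotient_of_theoryOf.{u, 0} (tableAlg l i.down)
      fun q hq v => h.holdsIn i.down.2 hq v
  intro hvalid
  have hreal := hvalid (∀ i, A i) (subvarietySRL_pi hA hE)
    (fun n i => f i (tableEntry l i.down (Nat.pair 0 n)))
  rw [← truthCode_code _ (fun e => decide (tableEq l p.code e)) (fun s t => ?_)] at hreal
  · have := h.false
    rw [← Bool.not_eq_true] at this
    exact this (by convert hreal)
  have hval : ∀ (t : Term) i, t.eval (fun n i => f i (tableEntry l i.down (Nat.pair 0 n))) i =
      f i (evalCode (tableAlg l i.down)
        (fun n => tableEntry l i.down (Nat.pair 0 n)) t.code) := by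
    intro t i
    rw [eval_pi, evalCode_code, heval]
    rfl
  rw [funext_iff]
  simp only [hval, heq, decide_eq_true_eq, tableEq, Nat.unpair_pair]
  exact ⟨fun h i => h i.down i.down.2, fun h i hi => h ⟨⟨i, hi⟩⟩⟩

theorem IsPartialEmbedding.map_binOp {A C : Type u} [ResiduatedLattice A] [ResiduatedLattice C]
    {B : Set A} {h : A → C} (hh : IsPartialEmbedding B h) {k : ℕ} (hk : 2 ≤ k) (hk' : k ≤ 6)
    {x y : A} (hx : x ∈ B) (hy : y ∈ B) (hxy : binOp A k x y ∈ B) :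
    h (binOp A k x y) = binOp C k (h x) (h y) := by
  interval_cases k
  · exact hh.map_mul x hx y hy hxy
  · exact hh.map_sup x hx y hy hxy
  · exact hh.map_inf x hx y hy hxy
  · exact hh.map_ldiv x hx y hy hxy
  · exact hh.map_rdiv x hx y hy hxy

/-- A formula that fails in the variety fails in a finite product of finite unilinear algebras,
given by their tables. For each pair of terms there is an algebra that separates their values. -/
theorem exists_isCountertable {E : List Equation} (H : UnilinearFEP.{u} {e | e ∈ E})
    {p : QFFormula} (hp : ¬ p.ValidIn (subvarietySRL.{u} {e | e ∈ E})) :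
    ∃ l, IsCountertable E p.code l := by
  classical
  unfold QFFormula.ValidIn at hp
  push Not at hp
  obtain ⟨A, _, hA, v, hv⟩ := hp
  set c := p.code with hc
  set g : ℕ → A := evalCode (rawOf A Eq) v with hg
  choose Q iQ f hQ hQE hsep heval using fun e : ℕ =>
    exists_separating hA (g e.unpair.1) (g e.unpair.2)
  let B : ∀ e, Set (Q e) := fun e => insert 1 ((fun x => f e (g x)) '' Set.Iic c)
  have hBfin : ∀ e, (B e).Finite := fun e => ((Set.finite_Iic c).image _).insert 1
  choose C iC hfin hC hCE h hh using fun e => H (Q e) (hQ e) (hQE e) (B e) (hBfin e)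
  have hgB : ∀ e x, x ≤ c → f e (g x) ∈ B e := fun e x hx => Or.inr ⟨x, hx, rfl⟩
  let w : ∀ e, ℕ → C e := fun e n => h e (f e (v n))
  -- The partial embedding commutes with the evaluation of the numbers up to `c`.
  have hw : ∀ e, ∀ x ≤ c, h e (f e (g x)) = evalCode (rawOf (C e) Eq) (w e) x := by
    intro e
    refine map_evalCode (rawOf A Eq) v (rawOf (C e) Eq) (w e) (fun x => h e (f e x)) c ?_
      (fun _ _ => rfl) ?_
    · exact (congrArg (h e) (heval e v .one)).trans ((hh e).map_one (Or.inl rfl))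
    · intro k x y hk hk' hle
      have hr := (lt_pair_of_pos (by omega : 1 ≤ k) (Nat.pair x y)).le.trans hle
      have hval := evalCode_op (rawOf A Eq) v hk hk' x y
      have hmap := map_binOp (heval e) hk hk' (g x) (g y)
      refine (congrArg (h e) hmap).trans ((hh e).map_binOp hk hk'
        (hgB e x ((Nat.left_le_pair x y).trans hr)) (hgB e y ((Nat.right_le_pair x y).trans hr)) ?_)
      rw [← hmap]
      exact (congrArg (f e) hval) ▸ hgB e _ hle
  have hfin' : ∀ e, ∃ s, Nonempty (C e ≃ Fin (s + 1)) := fun e => by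
    obtain ⟨n, ⟨ε⟩⟩ := Finite.exists_equiv_fin (C e)
    obtain _ | s := n
    · exact (ε 1).elim0
    · exact ⟨s, ⟨ε⟩⟩
  choose s hs using hfin'
  let ε : ∀ e, C e ≃ Fin (s e + 1) := fun e => (hs e).some
  let dec : ∀ e, ℕ → C e := fun e x => (ε e).symm ⟨x % (s e + 1), Nat.mod_lt _ (Nat.succ_pos _)⟩
  let enc : ∀ e, C e → ℕ := fun e z => ε e z
  have hdec_enc : ∀ e z, dec e (enc e z) = z := fun e z => by
    simp [dec, enc, Nat.mod_eq_of_lt (ε e z).2]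
  have hdec : ∀ e x y, dec e x = dec e y ↔ x % (s e + 1) = y % (s e + 1) := fun e x y => by
    simp [dec]
  have hdec_mod : ∀ e x, dec e (x % (s e + 1)) = dec e x := fun e x =>
    (hdec e _ _).2 (Nat.mod_mod _ _)
  -- The table, as an infinite sequence.
  obtain ⟨t, ht⟩ : ∃ t : ℕ → ℕ → ℕ → ℕ, ∀ i k r, t i k r =
      if k = 7 then s i else if k = 0 then enc i (w i r) else if k = 1 then enc i 1 else
        enc i (binOp (C i) k (dec i r.unpair.1) (dec i r.unpair.2)) := ⟨_, fun _ _ _ => rfl⟩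
  -- A bound for the entries that matter.
  let K := ∑ i ∈ Finset.range (c + 1), s i + c
  have hK : ∀ i < c + 1, s i ≤ K := fun i hi =>
    (Finset.single_le_sum (fun _ _ => Nat.zero_le _) (Finset.mem_range.2 hi)).trans
      (Nat.le_add_right _ _)
  let l := (List.range (Nat.pair c (Nat.pair 7 (Nat.pair K K)) + 1)).map fun j =>
    t j.unpair.1 j.unpair.2.unpair.1 j.unpair.2.unpair.2
  have hl : ∀ i < c + 1, ∀ k ≤ 7, ∀ r ≤ Nat.pair K K, tableEntry l i (Nat.pair k r) = t i k r := by
    intro i hi k hk r hr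
    rw [tableEntry, getD_map_range _ _ (Nat.lt_succ_of_le (pair_le_pair (Nat.le_of_lt_succ hi)
      (pair_le_pair hk hr)))]
    simp
  have hsize : ∀ i < c + 1, tableSize l i = s i + 1 := fun i hi => by
    rw [tableSize, hl i hi 7 le_rfl 0 (Nat.zero_le _), ht, if_pos rfl]
  have hone : ∀ i < c + 1, dec i (tableAlg l i).one = 1 := fun i hi => by
    simp only [tableAlg]
    rw [hsize i hi, hdec_mod, hl i hi 1 (by omega) 0 (Nat.zero_le _), ht, if_neg (by omega),
      if_neg (by omega), if_pos rfl, hdec_enc]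
  have hop : ∀ i < c + 1, ∀ k x y, 2 ≤ k → k ≤ 6 →
      dec i ((tableAlg l i).op k x y) = binOp (C i) k (dec i x) (dec i y) := by
    intro i hi k x y hk hk'
    have hx := Nat.le_of_lt_succ (Nat.mod_lt x (Nat.succ_pos (s i)))
    have hy := Nat.le_of_lt_succ (Nat.mod_lt y (Nat.succ_pos (s i)))
    simp only [tableAlg]
    rw [hsize i hi, hdec_mod, hl i hi k (by omega) _ (pair_le_pair (hx.trans (hK i hi))
      (hy.trans (hK i hi))), ht, if_neg (by omega), if_neg (by omega), if_neg (by omega), hdec_enc,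
      Nat.unpair_pair, hdec_mod, hdec_mod]
  have heval' : ∀ i < c + 1, ∀ x ≤ c, dec i (tableEval l i x) =
      evalCode (rawOf (C i) Eq) (w i) x := by
    intro i hi x hx
    rw [tableEval, hsize i hi, hdec_mod]
    refine map_evalCode (tableAlg l i) _ (rawOf (C i) Eq) (w i) (dec i) c (hone i hi) ?_
      (fun k x y hk hk' _ => hop i hi k _ _ hk hk') x hx
    intro n hn
    have hnK : n ≤ Nat.pair K K := ((Nat.right_le_pair 0 n).trans hn).trans
      ((Nat.le_add_left _ _).trans (Nat.left_le_pair K K))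
    rw [hl i hi 0 (by omega) n hnK, ht, if_neg (by omega), if_pos rfl, hdec_enc]
  have hEq : ∀ e ≤ c, tableEq l c e ↔ g e.unpair.1 = g e.unpair.2 := by
    intro e he
    have h1 := (Nat.unpair_left_le e).trans he
    have h2 := (Nat.unpair_right_le e).trans he
    have key : ∀ i < c + 1, tableEval l i e.unpair.1 = tableEval l i e.unpair.2 ↔
        f i (g e.unpair.1) = f i (g e.unpair.2) := by
      intro i hi
      rw [← (hh i).injOn.eq_iff (hgB i _ h1) (hgB i _ h2), hw i _ h1, hw i _ h2,
        ← heval' i hi _ h1, ← heval' i hi _ h2, hdec, tableEval, tableEval, hsize i hi,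
        Nat.mod_mod, Nat.mod_mod]
    exact ⟨fun H => hsep e ((key e (Nat.lt_succ_of_le he)).1 (H e (Nat.lt_succ_of_le he))),
      fun H i hi => (key i hi).2 (congrArg _ H)⟩
  refine ⟨l, ⟨fun i hi q hq a _ => ?_, ?_⟩⟩
  · rw [holdsIn_comap (tableAlg l i) (rawOf (C i) Eq) (dec i) (hone i hi) (hop i hi)]
    · exact (holdsIn_rawOf _ _ _).2 (realize_theoryOf (hC i) (hCE i) hq _)
    · intro x y
      simp only [tableAlg, rawOf]
      rw [hsize i hi, hdec]
  · rw [truthCode_congr (τ' := fun e => decide (g e.unpair.1 = g e.unpair.2))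
      (fun e he => decide_eq_decide.2 (hEq e he)), ← Bool.not_eq_true, truthCode_code v]
    · exact hv
    · intro s t
      rw [← evalIn_rawOf A Eq v s, ← evalIn_rawOf A Eq v t, ← evalCode_code, ← evalCode_code]
      simp [hg]

/-! ### Primitive recursive predicates -/

section Primrec

variable {α : Type u} {σ : Type w} [Primcodable α]

theorem primrecPred_forall_mem_list [Primcodable σ] {f : α → List σ} (hf : Primrec f)
    {R : α → σ → Prop} (hR : PrimrecRel R) : PrimrecPred fun a => ∀ x ∈ f a, R a x :=
  (PrimrecRel.comp₂ hR Primrec₂.right Primrec₂.left).forall_mem_list.comp hf Primrec.id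

theorem primrecPred_exists_lt {f : α → ℕ} (hf : Primrec f) {R : α → ℕ → Prop}
    (hR : PrimrecRel R) : PrimrecPred fun a => ∃ x < f a, R a x :=
  ((PrimrecRel.comp₂ hR Primrec₂.right Primrec₂.left).exists_mem_list.comp
    (Primrec.list_range.comp hf) Primrec.id).of_eq (by simp)

theorem primrecPred_forall_lt {f : α → ℕ} (hf : Primrec f) {R : α → ℕ → Prop}
    (hR : PrimrecRel R) : PrimrecPred fun a => ∀ x < f a, R a x :=
  (primrecPred_forall_mem_list (Primrec.list_range.comp hf) hR).of_eq (by simp)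

theorem primrecPred_const (P : Prop) : PrimrecPred fun _ : α => P := by
  classical
  exact Primrec.primrecPred (Primrec.const (decide P))

/-- A disjunction over a fixed list of predicates. The members of the list need no coding. -/
theorem primrecPred_exists_mem {L : List σ} {P : σ → α → Prop} (h : ∀ p ∈ L, PrimrecPred (P p)) :
    PrimrecPred fun a => ∃ p ∈ L, P p a := by
  induction L with
  | nil => exact (primrecPred_const False).of_eq (by simp)
  | cons p L ih =>
    exact ((h p (by simp)).or (ih fun q hq => h q (by simp [hq]))).of_eq (by simp)

theorem primrecPred_forall_mem {L : List σ} {P : σ → α → Prop} (h : ∀ p ∈ L, PrimrecPred (P p)) :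
    PrimrecPred fun a => ∀ p ∈ L, P p a :=
  (primrecPred_exists_mem fun p hp => (h p hp).not).not.of_eq (by simp)

theorem primrecPred_eq_true {f : α → Bool} (hf : Primrec f) : PrimrecPred fun a => f a = true :=
  Primrec.eq.comp hf (Primrec.const true)

theorem primrecPred_eq_false {f : α → Bool} (hf : Primrec f) : PrimrecPred fun a => f a = false :=
  Primrec.eq.comp hf (Primrec.const false)

theorem primrec_pair {f g : α → ℕ} (hf : Primrec f) (hg : Primrec g) :
    Primrec fun a => Nat.pair (f a) (g a) :=
  Primrec₂.natPair.comp hf hg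

theorem primrec_codeRec [Primcodable σ] {g : α → ℕ → ℕ → σ → σ → σ} {d : α → σ} {c : α → ℕ}
    (hg : Primrec fun q : α × (ℕ × ℕ) × σ × σ => g q.1 q.2.1.1 q.2.1.2 q.2.2.1 q.2.2.2)
    (hd : Primrec d) (hc : Primrec c) : Primrec fun a => codeRec (g a) (d a) (c a) := by
  -- The course-of-values function: the list of previous values has length `c`, so the default value
  -- of a lookup beyond it is what the recursion uses for arguments that are not smaller than `c`.
  let G : α → List σ → σ := fun a L => g a L.length.unpair.1 L.length.unpair.2
    (L.getD L.length.unpair.2.unpair.1 (d a)) (L.getD L.length.unpair.2.unpair.2 (d a))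
  have hL : Primrec fun q : α × List σ => q.2.length := Primrec.list_length.comp Primrec.snd
  have hr : Primrec fun q : α × List σ => q.2.length.unpair.2 :=
    Primrec.snd.comp (Primrec.unpair.comp hL)
  have hget : ∀ {i : α × List σ → ℕ}, Primrec i →
      Primrec fun q : α × List σ => q.2.getD (i q) (d q.1) := fun {i} hi =>
    (Primrec.option_getD.comp (Primrec.list_getElem?.comp Primrec.snd hi)
      (hd.comp Primrec.fst)).of_eq fun q => List.getD_eq_getElem?_getD.symm
  have hG : Primrec₂ G := hg.comp (Primrec.fst.pair (((Primrec.fst.comp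
    (Primrec.unpair.comp hL)).pair hr).pair
      ((hget (Primrec.fst.comp (Primrec.unpair.comp hr))).pair
        (hget (Primrec.snd.comp (Primrec.unpair.comp hr))))))
  have key : Primrec₂ fun a c => codeRec (g a) (d a) c := by
    refine Primrec.nat_strong_rec _ (g := fun a L => some (G a L))
      (Primrec.option_some.comp hG) fun a n => ?_
    have hn : ∀ x, ((List.range n).map (codeRec (g a) (d a))).getD x (d a) =
        if x < n then codeRec (g a) (d a) x else d a := fun x => by
      by_cases hx : x < n
      · rw [getD_map_range _ _ hx, if_pos hx]
      · rw [List.getD_eq_default _ _ (by simpa using hx), if_neg hx]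
    simp only [G, hn, List.length_map, List.length_range]
    conv_rhs => rw [codeRec]
    simp
  exact key.comp Primrec.id hc

end Primrec

/-! ### Primitive recursive families of raw algebras -/

section Families

variable {α : Type} [Primcodable α]

/-- A family of raw algebras on the natural numbers whose operations and interpretation of equality
are uniformly primitive recursive. -/
structure IsPrimrecAlg (R : α → RawAlg ℕ) : Prop where
  one : Primrec fun a => (R a).one
  op : Primrec fun q : α × ℕ × ℕ × ℕ => (R q.1).op q.2.1 q.2.2.1 q.2.2.2
  eq : PrimrecPred fun q : α × ℕ × ℕ => (R q.1).eq q.2.1 q.2.2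

variable {R : α → RawAlg ℕ} {v : α → ℕ → ℕ}

theorem IsPrimrecAlg.evalIn (hR : IsPrimrecAlg R) (hv : Primrec₂ v) (t : Term) :
    Primrec fun a => t.evalIn (R a) (v a) := by
  induction t with
  | var i => exact hv.comp Primrec.id (Primrec.const i)
  | one => exact hR.one
  | mul s t hs ht => exact hR.op.comp (Primrec.id.pair ((Primrec.const 2).pair (hs.pair ht)))
  | sup s t hs ht => exact hR.op.comp (Primrec.id.pair ((Primrec.const 3).pair (hs.pair ht)))
  | inf s t hs ht => exact hR.op.comp (Primrec.id.pair ((Primrec.const 4).pair (hs.pair ht)))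
  | ldiv s t hs ht => exact hR.op.comp (Primrec.id.pair ((Primrec.const 5).pair (hs.pair ht)))
  | rdiv s t hs ht => exact hR.op.comp (Primrec.id.pair ((Primrec.const 6).pair (hs.pair ht)))

theorem IsPrimrecAlg.holdsIn (hR : IsPrimrecAlg R) (hv : Primrec₂ v) (p : QFFormula) :
    PrimrecPred fun a => p.holdsIn (R a) (v a) := by
  induction p with
  | falsum => exact primrecPred_const False
  | equal s t => exact hR.eq.comp (Primrec.id.pair ((hR.evalIn hv s).pair (hR.evalIn hv t)))
  | imp p q hp hq => exact (hp.not.or hq).of_eq fun a => imp_iff_not_or.symm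

theorem IsPrimrecAlg.evalCode (hR : IsPrimrecAlg R) (hv : Primrec₂ v) {c : α → ℕ}
    (hc : Primrec c) : Primrec fun a => evalCode (R a) (v a) (c a) := by
  refine primrec_codeRec (g := fun a k r x y => if k = 0 then v a r else
    if 2 ≤ k ∧ k ≤ 6 then (R a).op k x y else (R a).one) ?_ hR.one hc
  have hk : Primrec fun q : α × (ℕ × ℕ) × ℕ × ℕ => q.2.1.1 :=
    Primrec.fst.comp (Primrec.fst.comp Primrec.snd)
  exact Primrec.ite (Primrec.eq.comp hk (Primrec.const 0))
    (hv.comp Primrec.fst (Primrec.snd.comp (Primrec.fst.comp Primrec.snd)))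
    (Primrec.ite ((Primrec.nat_le.comp (Primrec.const 2) hk).and
        (Primrec.nat_le.comp hk (Primrec.const 6)))
      (hR.op.comp (Primrec.fst.pair (hk.pair (Primrec.snd.comp Primrec.snd))))
      (hR.one.comp Primrec.fst))

theorem primrec_truthCode {τ : α → ℕ → Bool} (hτ : Primrec₂ τ) {c : α → ℕ} (hc : Primrec c) :
    Primrec fun a => truthCode (τ a) (c a) := by
  refine primrec_codeRec (g := fun a k r x y => if k = 1 then τ a r else
    if k = 2 then !x || y else false) ?_ (Primrec.const false) hc
  have hk : Primrec fun q : α × (ℕ × ℕ) × Bool × Bool => q.2.1.1 :=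
    Primrec.fst.comp (Primrec.fst.comp Primrec.snd)
  exact Primrec.ite (Primrec.eq.comp hk (Primrec.const 1))
    (hτ.comp Primrec.fst (Primrec.snd.comp (Primrec.fst.comp Primrec.snd)))
    (Primrec.ite (Primrec.eq.comp hk (Primrec.const 2))
      (Primrec.or.comp (Primrec.not.comp (Primrec.fst.comp (Primrec.snd.comp Primrec.snd)))
        (Primrec.snd.comp (Primrec.snd.comp Primrec.snd))) (Primrec.const false))

theorem primrec_isTermCode : Primrec isTermCode := by
  refine primrec_codeRec (α := ℕ) (g := fun _ k r x y => if k = 0 then true else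
    if k = 1 then r == 0 else if k ≤ 6 then x && y else false) ?_ (Primrec.const false) Primrec.id
  have hk : Primrec fun q : ℕ × (ℕ × ℕ) × Bool × Bool => q.2.1.1 :=
    Primrec.fst.comp (Primrec.fst.comp Primrec.snd)
  exact Primrec.ite (Primrec.eq.comp hk (Primrec.const 0)) (Primrec.const true)
    (Primrec.ite (Primrec.eq.comp hk (Primrec.const 1))
      (Primrec.beq.comp (Primrec.snd.comp (Primrec.fst.comp Primrec.snd)) (Primrec.const 0))
      (Primrec.ite (Primrec.nat_le.comp hk (Primrec.const 6))
        (Primrec.and.comp (Primrec.fst.comp (Primrec.snd.comp Primrec.snd))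
          (Primrec.snd.comp (Primrec.snd.comp Primrec.snd))) (Primrec.const false)))

theorem primrec_isFormulaCode : Primrec isFormulaCode := by
  refine primrec_codeRec (α := ℕ) (g := fun _ k r x y => if k = 0 then r == 0 else
    if k = 1 then isTermCode r.unpair.1 && isTermCode r.unpair.2 else
    if k = 2 then x && y else false) ?_ (Primrec.const false) Primrec.id
  have hk : Primrec fun q : ℕ × (ℕ × ℕ) × Bool × Bool => q.2.1.1 :=
    Primrec.fst.comp (Primrec.fst.comp Primrec.snd)
  have hr : Primrec fun q : ℕ × (ℕ × ℕ) × Bool × Bool => q.2.1.2 :=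
    Primrec.snd.comp (Primrec.fst.comp Primrec.snd)
  exact Primrec.ite (Primrec.eq.comp hk (Primrec.const 0))
    (Primrec.beq.comp hr (Primrec.const 0))
    (Primrec.ite (Primrec.eq.comp hk (Primrec.const 1))
      (Primrec.and.comp
        (primrec_isTermCode.comp (Primrec.fst.comp (Primrec.unpair.comp hr)))
        (primrec_isTermCode.comp (Primrec.snd.comp (Primrec.unpair.comp hr))))
      (Primrec.ite (Primrec.eq.comp hk (Primrec.const 2))
        (Primrec.and.comp (Primrec.fst.comp (Primrec.snd.comp Primrec.snd))
          (Primrec.snd.comp (Primrec.snd.comp Primrec.snd))) (Primrec.const false)))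

theorem primrec_allLists : Primrec₂ allLists := by
  have : Primrec₂ fun n r : ℕ => (Nat.rec [[]] (fun _ L => L.flatMap fun l =>
      (List.range n).map fun x => x :: l) r : List (List ℕ)) := by
    refine Primrec.nat_rec (g := fun n (q : ℕ × List (List ℕ)) => q.2.flatMap fun l =>
      (List.range n).map fun x => x :: l) (Primrec.const [[]]) ?_
    refine Primrec.list_flatMap (Primrec.snd.comp Primrec.snd) ?_
    refine Primrec.list_map (Primrec.list_range.comp (Primrec.fst.comp Primrec.fst)) ?_
    exact Primrec.list_cons.comp Primrec.snd (Primrec.snd.comp Primrec.fst)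
  refine this.of_eq fun n r => ?_
  induction r with
  | zero => rfl
  | succ r ih => rw [allLists, ← ih]

theorem primrec_listVal : Primrec₂ listVal :=
  (Primrec.list_getD 0).comp ((Primrec.ofNat (List ℕ)).comp Primrec.fst) Primrec.snd

/-! ### Certificates of validity -/

theorem isPrimrecAlg_component {T : α → ℕ → Bool} (hT : Primrec₂ T) {i : α → ℕ}
    (hi : Primrec i) : IsPrimrecAlg fun a => codeAlg (component (T a) (i a)) where
  one := Primrec.const _
  op := primrec_pair (Primrec.fst.comp Primrec.snd) (primrec_pair
    (Primrec.fst.comp (Primrec.snd.comp Primrec.snd))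
    (Primrec.snd.comp (Primrec.snd.comp Primrec.snd)))
  eq := primrecPred_eq_true (hT.comp Primrec.fst (primrec_pair (hi.comp Primrec.fst)
    (primrec_pair (Primrec.fst.comp Primrec.snd) (Primrec.snd.comp Primrec.snd))))

theorem primrec_touch {i : α → ℕ} (hi : Primrec i) (hv : Primrec₂ v) (p : QFFormula) :
    Primrec fun a => p.touch (i a) (v a) := by
  have hR : IsPrimrecAlg fun _ : α => codeAlg Eq :=
    { one := Primrec.const _
      op := primrec_pair (Primrec.fst.comp Primrec.snd) (primrec_pair
        (Primrec.fst.comp (Primrec.snd.comp Primrec.snd))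
        (Primrec.snd.comp (Primrec.snd.comp Primrec.snd)))
      eq := Primrec.eq.comp (Primrec.fst.comp Primrec.snd) (Primrec.snd.comp Primrec.snd) }
  induction p with
  | falsum => exact Primrec.const 0
  | equal s t => exact primrec_pair hi (primrec_pair (hR.evalIn hv s) (hR.evalIn hv t))
  | imp p q hp hq => exact Primrec.nat_max.comp hp hq

theorem primrecPred_isRefuted (E : List Equation) {c N : α → ℕ} {T : α → ℕ → Bool}
    (hc : Primrec c) (hT : Primrec₂ T) (hN : Primrec N) :
    PrimrecPred fun a => IsRefuted E (c a) (T a) (N a) := by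
  have hN₁ : Primrec fun q : α × ℕ => N q.1 := hN.comp Primrec.fst
  have hN₂ : Primrec fun q : (α × ℕ) × ℕ => N q.1.1 := hN₁.comp Primrec.fst
  have hi : Primrec fun q : (α × ℕ) × ℕ => q.1.2 := Primrec.snd.comp Primrec.fst
  have hT₂ : Primrec₂ fun (q : (α × ℕ) × ℕ) j => T q.1.1 j :=
    hT.comp (Primrec.fst.comp (Primrec.fst.comp Primrec.fst)) Primrec.snd
  refine (primrecPred_exists_mem fun p _ => ?_).or (PrimrecPred.or ?_ ?_)
  · refine primrecPred_exists_lt hN (R := fun a i => ∃ w < N a, p.touch i (listVal w) < N a ∧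
      ¬ p.holdsIn (codeAlg (component (T a) i)) (listVal w)) (primrecPred_exists_lt hN₁
        (R := fun q w => p.touch q.2 (listVal w) < N q.1 ∧
          ¬ p.holdsIn (codeAlg (component (T q.1) q.2)) (listVal w)) ?_)
    have hv : Primrec₂ fun (q : (α × ℕ) × ℕ) => listVal q.2 :=
      primrec_listVal.comp (Primrec.snd.comp Primrec.fst) Primrec.snd
    exact (Primrec.nat_lt.comp (primrec_touch hi hv p) hN₂).and
      ((isPrimrecAlg_component hT₂ hi).holdsIn hv p).not
  · refine primrecPred_exists_lt hN (R := fun a i => ∃ e < N a, Nat.pair e e < N a ∧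
      Nat.pair i e < N a ∧ T a (Nat.pair e e) = true ∧ T a (Nat.pair i e) = false)
        (primrecPred_exists_lt hN₁ (R := fun q e => Nat.pair e e < N q.1 ∧
          Nat.pair q.2 e < N q.1 ∧ T q.1 (Nat.pair e e) = true ∧
          T q.1 (Nat.pair q.2 e) = false) ?_)
    have he := primrec_pair (α := (α × ℕ) × ℕ) Primrec.snd Primrec.snd
    have hie := primrec_pair hi Primrec.snd
    exact (Primrec.nat_lt.comp he hN₂).and ((Primrec.nat_lt.comp hie hN₂).and
      ((primrecPred_eq_true (hT₂.comp Primrec.id he)).and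
        (primrecPred_eq_false (hT₂.comp Primrec.id hie))))
  · refine (Primrec.nat_lt.comp (primrec_pair hc hc) hN).and (primrecPred_eq_true
      (primrec_truthCode (τ := fun a e => T a (Nat.pair e e)) ?_ hc))
    exact hT.comp Primrec.fst (primrec_pair Primrec.snd Primrec.snd)

/-! ### Certificates of invalidity -/

section Tables

variable {l : α → List ℕ} {i : α → ℕ}

theorem primrec_tableEntry (hl : Primrec l) (hi : Primrec i) {x : α → ℕ} (hx : Primrec x) :
    Primrec fun a => tableEntry (l a) (i a) (x a) :=
  (Primrec.list_getD 0).comp hl (primrec_pair hi hx)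

theorem primrec_tableSize (hl : Primrec l) (hi : Primrec i) :
    Primrec fun a => tableSize (l a) (i a) :=
  Primrec.succ.comp (primrec_tableEntry hl hi (Primrec.const _))

theorem isPrimrecAlg_tableAlg (hl : Primrec l) (hi : Primrec i) :
    IsPrimrecAlg fun a => tableAlg (l a) (i a) where
  one := Primrec.nat_mod.comp (primrec_tableEntry hl hi (Primrec.const _))
    (primrec_tableSize hl hi)
  op := by
    have hs : Primrec fun q : α × ℕ × ℕ × ℕ => tableSize (l q.1) (i q.1) :=
      (primrec_tableSize hl hi).comp Primrec.fst
    exact Primrec.nat_mod.comp (primrec_tableEntry (hl.comp Primrec.fst) (hi.comp Primrec.fst)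
      (primrec_pair (Primrec.fst.comp Primrec.snd) (primrec_pair
        (Primrec.nat_mod.comp (Primrec.fst.comp (Primrec.snd.comp Primrec.snd)) hs)
        (Primrec.nat_mod.comp (Primrec.snd.comp (Primrec.snd.comp Primrec.snd)) hs)))) hs
  eq := by
    have hs : Primrec fun q : α × ℕ × ℕ => tableSize (l q.1) (i q.1) :=
      (primrec_tableSize hl hi).comp Primrec.fst
    exact Primrec.eq.comp (Primrec.nat_mod.comp (Primrec.fst.comp Primrec.snd) hs)
      (Primrec.nat_mod.comp (Primrec.snd.comp Primrec.snd) hs)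

theorem primrec_tableEval (hl : Primrec l) (hi : Primrec i) {x : α → ℕ} (hx : Primrec x) :
    Primrec fun a => tableEval (l a) (i a) (x a) := by
  refine Primrec.nat_mod.comp ((isPrimrecAlg_tableAlg hl hi).evalCode ?_ hx)
    (primrec_tableSize hl hi)
  exact primrec_tableEntry (hl.comp Primrec.fst) (hi.comp Primrec.fst)
    (primrec_pair (Primrec.const 0) Primrec.snd)

theorem primrecPred_tableEq (hl : Primrec l) {c e : α → ℕ} (hc : Primrec c) (he : Primrec e) :
    PrimrecPred fun a => tableEq (l a) (c a) (e a) := by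
  refine primrecPred_forall_lt (R := fun a i => tableEval (l a) i (e a).unpair.1 =
    tableEval (l a) i (e a).unpair.2) (Primrec.succ.comp hc) ?_
  have hl' : Primrec fun q : α × ℕ => l q.1 := hl.comp Primrec.fst
  have he' : Primrec fun q : α × ℕ => (e q.1).unpair :=
    Primrec.unpair.comp (he.comp Primrec.fst)
  exact Primrec.eq.comp (primrec_tableEval hl' Primrec.snd (Primrec.fst.comp he'))
    (primrec_tableEval hl' Primrec.snd (Primrec.snd.comp he'))

theorem primrecPred_isCountertable (E : List Equation) {c : α → ℕ} (hc : Primrec c)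
    (hl : Primrec l) : PrimrecPred fun a => IsCountertable E (c a) (l a) := by
  classical
  refine PrimrecPred.of_eq (PrimrecPred.and (p := fun a => ∀ i < c a + 1, ∀ p ∈ theoryOf E,
    ∀ b ∈ allLists (tableSize (l a) i) p.varBound,
      p.holdsIn (tableAlg (l a) i) fun j => b.getD j 0)
    (q := fun a => truthCode (fun e => decide (tableEq (l a) (c a) e)) (c a) = false) ?_ ?_)
    fun a => ⟨fun h => ⟨h.1, ?_⟩, fun h => ⟨h.1, ?_⟩⟩
  · refine primrecPred_forall_lt (R := fun a i => ∀ p ∈ theoryOf E,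
      ∀ b ∈ allLists (tableSize (l a) i) p.varBound,
        p.holdsIn (tableAlg (l a) i) fun j => b.getD j 0) (Primrec.succ.comp hc) ?_
    refine primrecPred_forall_mem fun p _ => ?_
    have hl₁ : Primrec fun q : α × ℕ => l q.1 := hl.comp Primrec.fst
    refine primrecPred_forall_mem_list (R := fun (q : α × ℕ) b =>
      p.holdsIn (tableAlg (l q.1) q.2) fun j => b.getD j 0) (primrec_allLists.comp
        (primrec_tableSize hl₁ Primrec.snd) (Primrec.const _)) ?_
    refine (isPrimrecAlg_tableAlg (hl₁.comp Primrec.fst)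
      (Primrec.snd.comp Primrec.fst)).holdsIn ?_ p
    exact (Primrec.list_getD 0).comp (Primrec.snd.comp Primrec.fst) Primrec.snd
  · refine primrecPred_eq_false (primrec_truthCode
      (τ := fun a e => decide (tableEq (l a) (c a) e)) ?_ hc)
    exact (primrecPred_tableEq (hl.comp Primrec.fst) (hc.comp Primrec.fst) Primrec.snd).decide
  · convert h.2
  · convert h.false

end Tables

/-! ### Decidability -/

theorem rePred_exists_nat {P : α → ℕ → Prop} (hP : PrimrecRel P) :
    REPred fun a => ∃ n, P a n := by
  classical
  refine (Partrec.rfind (p := fun a n => Part.some (decide (P a n)))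
    hP.decide.to_comp.partrec).dom_re.of_eq fun a => ?_
  refine Nat.rfind_dom.trans ?_
  simp

end Families

/-- A class that is defined by finitely many equations over the semiunilinear residuated lattices
has a decidable universal theory, provided that its unilinear members have the finite embeddability
property. -/
theorem hasDecidableUniversalTheory {E : List Equation} (H : UnilinearFEP.{u} {e | e ∈ E}) :
    HasDecidableUniversalTheory.{u} (subvarietySRL {e | e ∈ E}) := by
  refine ComputablePred.computable_iff_re_compl_re'.2 ⟨?_, ?_⟩
  · refine (rePred_exists_nat (P := fun c N => isFormulaCode c = true ∧ ∀ l ∈ allLists 2 N,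
      IsRefuted E c (fun j => l.getD j 0 == 1) N) ?_).of_eq fun c => ?_
    · refine (primrecPred_eq_true (primrec_isFormulaCode.comp Primrec.fst)).and
        (primrecPred_forall_mem_list (R := fun (q : ℕ × ℕ) l =>
          IsRefuted E q.1 (fun j => l.getD j 0 == 1) q.2)
          (primrec_allLists.comp (Primrec.const 2) Primrec.snd)
          (primrecPred_isRefuted E (Primrec.fst.comp Primrec.fst) ?_
            (Primrec.snd.comp Primrec.fst)))
      exact Primrec.beq.comp ((Primrec.list_getD 0).comp (Primrec.snd.comp Primrec.fst)
        Primrec.snd) (Primrec.const 1)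
    · constructor
      · rintro ⟨N, hc, hN⟩
        obtain ⟨p, rfl⟩ := (isFormulaCode_iff c).1 hc
        exact ⟨p, rfl, validIn_iff_exists_isRefuted.2 ⟨N, hN⟩⟩
      · rintro ⟨p, rfl, hp⟩
        obtain ⟨N, hN⟩ := validIn_iff_exists_isRefuted.1 hp
        exact ⟨N, (isFormulaCode_iff _).2 ⟨p, rfl⟩, hN⟩
  · refine (rePred_exists_nat (P := fun c n => isFormulaCode c = false ∨
      IsCountertable E c (Denumerable.ofNat (List ℕ) n)) ?_).of_eq fun c => ?_
    · exact (primrecPred_eq_false (primrec_isFormulaCode.comp Primrec.fst)).or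
        (primrecPred_isCountertable E Primrec.fst
          ((Primrec.ofNat (List ℕ)).comp Primrec.snd))
    · constructor
      · rintro ⟨n, hc⟩ ⟨p, rfl, hp⟩
        rcases hc with hc | hc
        · rw [(isFormulaCode_iff _).2 ⟨p, rfl⟩] at hc
          exact absurd hc (by simp)
        · exact hc.not_validIn hp
      · intro h
        by_cases hc : isFormulaCode c = true
        · obtain ⟨p, rfl⟩ := (isFormulaCode_iff c).1 hc
          obtain ⟨l, hl⟩ := exists_isCountertable H fun hp => h ⟨p, rfl, hp⟩
          exact ⟨Encodable.encode l, Or.inr (by rwa [Denumerable.ofNat_encode])⟩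
        · exact ⟨0, Or.inl (by simpa using hc)⟩

end RL

theorem mainTheorem7 (m n : ℕ) (hmn : m ≠ n)
    (k : ℕ) (hk : 1 ≤ k) (a : ℕ → ℕ)
    (ha_sum : ∑ i ∈ Finset.range (k + 1), a i = k + 1)
    (ha_ne : ∃ i ∈ Finset.range (k + 1), a i ≠ 1)
    (E : Set RL.Equation) (hE : ∀ e ∈ E, e.IsJoinMonoid) :
    RL.HasFEP.{u}
        (RL.subvarietySRL ({RL.Equation.knotted m n, RL.Equation.weakComm k a} ∪ E)) ∧
      (E.Finite → RL.HasDecidableUniversalTheory.{u}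
        (RL.subvarietySRL ({RL.Equation.knotted m n, RL.Equation.weakComm k a} ∪ E))) := by
  obtain ⟨j, hj, haj⟩ := RL.exists_eq_zero_of_sum_eq ha_sum ha_ne
  set E' : Set RL.Equation := {RL.Equation.knotted m n, RL.Equation.weakComm k a} ∪ E with hE'
  have hjoin : ∀ e ∈ E', e.IsJoinMonoid := by
    rintro e ((rfl | rfl) | he)
    · exact RL.isJoinMonoid_knotted m n
    · exact RL.isJoinMonoid_weakComm k a
    · exact hE e he
  have hFEP : RL.UnilinearFEP.{u} E' :=
    RL.unilinearFEP hmn hj haj hjoin (Or.inl (Or.inl rfl)) (Or.inl (Or.inr rfl))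
  refine ⟨RL.hasFEP_of_unilinear hFEP, fun hfin => ?_⟩
  have hfin' : E'.Finite := (Set.toFinite _).union hfin
  obtain ⟨L, hL⟩ : ∃ L : List RL.Equation, {e | e ∈ L} = E' :=
    ⟨hfin'.toFinset.toList, by ext e; simp⟩
  rw [← hL] at hFEP ⊢
  exact RL.hasDecidableUniversalTheory hFEP
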